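/- **Setting.** Let $k$ be a field and $E$ a finite set with $n=|E|$. An *oriented matroid program* $\mathcal P=(\widetilde{\mathcal M},g,f)$ over $E$ is an oriented matroid $\widetilde{\mathcal M}$ on $E\sqcup\{f,g\}$ such that $g$ is not a loop and $f$ is not a coloop. Put $\mathcal N=\widetilde{\mathcal M}\setminus f$ and $\mathcal M=(\widetilde{\mathcal M}\setminus f)/g$, let $M$ be the matroid on $E$ underlying $\mathcal M$ and $d$ its rank. Write $z(X)$ for the zero set of a sign vector $X$. The program is *generic* if $Y(g)=0$ for every signed cocircuit $Y$ of $\mathcal N$ with $|z(Y)|>d$, and $X(f)=0$ for every signed circuit $X$ of $\widetilde{\mathcal M}/g$ with $|z(X)|>n-d$. The *dual program* is $\mathcal P^\vee=(\widetilde{\mathcal M}^\vee,f,g)$. Covectors are $0$ and the compositions of signed cocircuits; topes are the maximal covectors; $Z$ is a face of $Z'$ if $Z\circ Z'=Z'$. Let $\mathcal F$ be the set of *feasible* topes, i.e. the topes $T$ of $\mathcal N$ with $T(g)=+$, identified (for generic $\mathcal P$) with their restrictions $\alpha\in\{+,-\}^E$. A sign vector $\alpha$ is *unbounded* if there is a covector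 $Z$ of $\widetilde{\mathcal M}$ with $Z(g)=0$, $Z(f)=+$ and $Z|_E$ a face of $\alpha$; otherwise it is *bounded*. Let $\mathbf P\subseteq\mathcal F$ be the set of bounded feasible topes. A *parameter space* for $\mathcal P$ is a subspace $U\subseteq k^E$ whose coordinate projection to $k^b$ is an isomorphism for every basis $b$ of $M$. Let $U^\perp\subseteq k^E$ be its orthogonal complement for the standard pairing $\langle x,y\rangle=\sum_i x_iy_i$. **The algebra.** Let $Q$ be the quiver with vertex set $\mathcal F$ and one arrow $p(\alpha,\beta)$ from $\alpha$ to $\beta$ whenever $\alpha,\beta$ differ in exactly one coordinate, and let $e_\alpha$ be the vertex idempotents of its path algebra $P(Q)$. The algebra $A(\mathcal P,U)$ is the quotient of $P(Q)\otimes_k k[u_i\mid i\in E]$ by the two-sided ideal generated by the relations 1. $e_\alpha=0$ for $\alpha\in\mathcal F\setminus\mathbf P$; 2. $p(\alpha,\gamma)p(\gamma,\beta)=p(\alpha,\delta)p(\delta,\beta)$ for any four distinct $\alpha,\beta,\gamma,\delta\in\mathcal F$ with $\alpha$ and $\beta$ each adjacent to both $\gamma$ and $\delta$; 3. $p(\alpha,\beta)p(\beta,\alpha)=e_\alpha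 u_i$ whenever $\alpha,\beta\in\mathcal F$ differ exactly in the coordinate $i$; 4. $\sum_i x_iu_i=0$ for all $x\in U^\perp$. It is graded by $\deg e_\alpha=0$, $\deg p(\alpha,\beta)=1$, $\deg u_i=2$. **Quadratic algebras.** A graded $k$-algebra $A=\bigoplus_{j\ge 0}A_j$ is *quadratic* if $A_0$ is semisimple and the canonical homomorphism $T_{A_0}(A_1)/(W)\to A$ is an isomorphism, where $T_{A_0}(A_1)$ is the tensor algebra of the $A_0$-bimodule $A_1$ and $W=\ker(A_1\otimes_{A_0}A_1\to A_2)$. Its *quadratic dual* is $A^!=T_{A_0}(A_1^*)/(W^\perp)$. Here $A_1^*=\mathrm{Hom}_{A_0}(A_1,A_0)$ is the set of homomorphisms of right $A_0$-modules, with bimodule structure $(r\varphi)(v)=r\varphi(v)$, $(\varphi r)(v)=\varphi(rv)$, and $W^\perp\subseteq A_1^*\otimes_{A_0}A_1^*$ is the orthogonal of $W$ under the pairing $\langle\varphi\otimes\psi,v\otimes w\rangle=\varphi(\psi(v)w)$. The algebra $A^!$ is graded with $A_0$ in degree $0$ and $A_1^*$ in degree $1$. **Theorem.** Let $\mathcal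 P$ be a generic oriented matroid program over $E$ and $U\subseteq k^E$ a parameter space for $\mathcal P$. Then the algebra $A(\mathcal P,U)$, with the grading above, is quadratic, and there is an isomorphism of graded $k$-algebras $$A(\mathcal P^\vee,U^\perp)\;\simeq\;A(\mathcal P,U)^!.$$ -/

import Mathlib

open scoped TensorProduct

/-! ## Sign vectors -/

/-- Functions from an index set to the set of signs `{0, +, -}`. The support of a sign vector is
`Function.support`. -/
abbrev SignVec (α : Type*) := α → SignType

namespace SignVec

variable {α : Type*}

/-- The composition `Z ∘ Z'`. -/
def comp (Z Z' : SignVec α) : SignVec α := fun i => if Z i = 0 then Z' i else Z i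

/-- `Z` is a face of `Z'` if `Z ∘ Z' = Z'`. -/
def IsFace (Z Z' : SignVec α) : Prop := Z.comp Z' = Z'

/-- Orthogonality of sign vectors: either the supports are disjoint, or the signs agree at some
common element of the supports and are opposite at another one. -/
def Orthogonal (X Y : SignVec α) : Prop :=
  (∀ i, X i * Y i = 0) ∨ ((∃ i, X i * Y i = 1) ∧ ∃ i, X i * Y i = -1)

/-- The restriction of a sign vector to the complement of `S`, as a sign vector vanishing on `S`. -/
noncomputable def away (S : Set α) (X : SignVec α) : SignVec α := Set.indicator Sᶜ X

theorem support_away (S : Set α) (X : SignVec α) :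
    Function.support (X.away S) = Function.support X \ S := by
  unfold away
  rw [Set.support_indicator, Set.inter_comm]
  rfl

theorem away_apply_of_notMem {S : Set α} {X : SignVec α} {i : α} (h : i ∉ S) :
    X.away S i = X i := by
  unfold away
  exact Set.indicator_of_mem (by simpa using h) X

theorem support_neg (X : SignVec α) : Function.support (-X) = Function.support X := by
  ext i
  have : ∀ a : SignType, -a ≠ 0 ↔ a ≠ 0 := by decide
  exact this (X i)

theorem Orthogonal.symm {X Y : SignVec α} (h : X.Orthogonal Y) : Y.Orthogonal X := by
  unfold Orthogonal at *
  simpa only [mul_comm] using h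

end SignVec

/-! ## Oriented matroids -/

/-- `C` is a circuit signature of the matroid `M`: it consists of exactly two opposite sign vectors
supported on each circuit of `M`. -/
structure IsCircuitSignature {α : Type*} (M : Matroid α) (C : Set (SignVec α)) : Prop where
  isCircuit_support : ∀ X ∈ C, M.IsCircuit (Function.support X)
  exists_support_eq : ∀ K, M.IsCircuit K → ∃ X ∈ C, Function.support X = K
  neg_mem : ∀ X ∈ C, -X ∈ C
  eq_or_eq_neg : ∀ X ∈ C, ∀ Y ∈ C, Function.support X = Function.support Y → X = Y ∨ X = -Y

/-- An oriented matroid on the subset `matroid.E` of `α`, given by its underlying matroid, its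
signed circuits and its signed cocircuits (the orthogonality axioms of Bland and Las Vergnas: a
circuit signature and a cocircuit signature of a matroid are the signed circuits and signed
cocircuits of an oriented matroid if and only if they are orthogonal). All sign vectors are extended
by zero outside of the ground set `matroid.E`. -/
structure OrientedMatroid (α : Type*) where
  /-- the underlying matroid -/
  matroid : Matroid α
  /-- the signed circuits -/
  circuits : Set (SignVec α)
  /-- the signed cocircuits -/
  cocircuits : Set (SignVec α)
  circuits_signature : IsCircuitSignature matroid circuits
  cocircuits_signature : IsCircuitSignature matroid.dual cocircuits
  orthogonal : ∀ X ∈ circuits, ∀ Y ∈ cocircuits, X.Orthogonal Y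

/-- The signed circuits of a contraction: the restrictions to the complement of `S` of those
`X ∈ C` for which `supp X \ S` is inclusion-minimal among the nonempty sets of this form. -/
def contractSignature {α : Type*} (C : Set (SignVec α)) (S : Set α) : Set (SignVec α) :=
  {Y | ∃ X ∈ C, Y = X.away S ∧
    Minimal (fun K : Set α => K.Nonempty ∧ ∃ Z ∈ C, K = Function.support Z \ S)
      (Function.support X \ S)}

/-- The signed circuits of a deletion: the signed circuits whose support is disjoint from `S`. -/
def deleteSignature {α : Type*} (C : Set (SignVec α)) (S : Set α) : Set (SignVec α) :=
  {X ∈ C | Disjoint (Function.support X) S}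

theorem IsCircuitSignature.delete {α : Type*} {M : Matroid α} {C : Set (SignVec α)}
    (h : IsCircuitSignature M C) (S : Set α) :
    IsCircuitSignature (M.delete S) (deleteSignature C S) where
  isCircuit_support X hX := Matroid.delete_isCircuit_iff.2 ⟨h.isCircuit_support X hX.1, hX.2⟩
  exists_support_eq K hK := by
    obtain ⟨hK, hd⟩ := Matroid.delete_isCircuit_iff.1 hK
    obtain ⟨X, hX, rfl⟩ := h.exists_support_eq K hK
    exact ⟨X, ⟨hX, hd⟩, rfl⟩
  neg_mem X hX := ⟨h.neg_mem X hX.1, by rw [SignVec.support_neg]; exact hX.2⟩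
  eq_or_eq_neg X hX Y hY := h.eq_or_eq_neg X hX.1 Y hY.1

/-- Two distinct elements of a circuit are its intersection with some cocircuit. -/
theorem Matroid.IsCircuit.exists_isCocircuit_inter_eq_pair {α : Type*} {M : Matroid α} {K : Set α}
    (hK : M.IsCircuit K) {x y : α} (hx : x ∈ K) (hy : y ∈ K) (hxy : x ≠ y) :
    ∃ D, M.IsCocircuit D ∧ K ∩ D = {x, y} := by
  obtain ⟨D, hD, hDI⟩ := (hK.sdiff_singleton_indep hy).exists_isCocircuit_inter_eq_mem
    (e := x) ⟨hx, hxy⟩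
  refine ⟨D, hD, ?_⟩
  have hxD : x ∈ D := by
    have : x ∈ D ∩ (K \ {y}) := by rw [hDI]; rfl
    exact this.1
  have hsub : K ∩ D ⊆ {x, y} := by
    rintro z ⟨hzK, hzD⟩
    by_cases hzy : z = y
    · exact Or.inr hzy
    · left
      have : z ∈ ({x} : Set α) := by
        rw [← hDI]
        exact ⟨hzD, hzK, hzy⟩
      exact this
  have hnt := hK.isCocircuit_inter_nontrivial hD ⟨x, hx, hxD⟩
  refine hsub.antisymm ?_
  obtain ⟨z, hz, hzx⟩ := hnt.exists_ne x
  have hzy : z = y := (hsub hz).resolve_left hzx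
  rintro w (rfl | rfl)
  · exact ⟨hx, hxD⟩
  · rw [← hzy]; exact hz

theorem IsCircuitSignature.minimal_iff {α : Type*} {M : Matroid α} {C : Set (SignVec α)}
    (h : IsCircuitSignature M C) (S K : Set α) :
    Minimal (fun K : Set α => K.Nonempty ∧ ∃ Z ∈ C, K = Function.support Z \ S) K ↔
      (M.contract S).IsCircuit K := by
  have key : ∀ K, (M.contract S).IsCircuit K →
      K.Nonempty ∧ ∃ Z ∈ C, K = Function.support Z \ S := by
    intro K hK
    refine ⟨hK.nonempty, ?_⟩
    obtain ⟨K', hK', h1, h2⟩ := hK.exists_subset_isCircuit_of_contract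
    obtain ⟨Z, hZ, rfl⟩ := h.exists_support_eq K' hK'
    refine ⟨Z, hZ, Set.Subset.antisymm (fun x hx => ⟨h1 hx, ?_⟩) ?_⟩
    · exact (hK.subset_ground hx).2
    · rintro x ⟨hx, hxS⟩
      exact (h2 hx).resolve_right hxS
  have key2 : ∀ K : Set α, (K.Nonempty ∧ ∃ Z ∈ C, K = Function.support Z \ S) →
      ∃ K', K' ⊆ K ∧ (M.contract S).IsCircuit K' := by
    rintro K ⟨hne, Z, hZ, rfl⟩
    have hdep := (h.isCircuit_support Z hZ).contract_dep_of_not_subset (C := S) (by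
      intro hs
      obtain ⟨x, hx⟩ := hne
      exact hx.2 (hs hx.1))
    exact hdep.exists_isCircuit_subset
  constructor
  · intro hK
    obtain ⟨K', hK'K, hK'⟩ := key2 K hK.prop
    have : K = K' := Set.Subset.antisymm (hK.le_of_le (key K' hK') hK'K) hK'K
    rwa [this]
  · intro hK
    refine ⟨key K hK, ?_⟩
    intro L hL hLK
    obtain ⟨K', hK'L, hK'⟩ := key2 L hL
    have : K' = K := (hK.eq_of_superset_isCircuit hK' (hK'L.trans hLK)).symm
    rw [← this]
    exact hK'L

theorem IsCircuitSignature.contract {α : Type*} {M : Matroid α} {C D : Set (SignVec α)}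
    (hC : IsCircuitSignature M C) (hD : IsCircuitSignature M.dual D)
    (horth : ∀ X ∈ C, ∀ Y ∈ D, X.Orthogonal Y) (S : Set α) :
    IsCircuitSignature (M.contract S) (contractSignature C S) where
  isCircuit_support := by
    rintro _ ⟨X, hX, rfl, hmin⟩
    rw [SignVec.support_away]
    exact (hC.minimal_iff S _).1 hmin
  exists_support_eq K hK := by
    have hK' := (hC.minimal_iff S K).2 hK
    obtain ⟨-, Z, hZ, hKZ⟩ := hK'.prop
    exact ⟨Z.away S, ⟨Z, hZ, rfl, hKZ ▸ hK'⟩, by rw [SignVec.support_away, hKZ]⟩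
  neg_mem := by
    rintro _ ⟨X, hX, rfl, hmin⟩
    refine ⟨-X, hC.neg_mem X hX, ?_, by rwa [SignVec.support_neg]⟩
    funext i
    by_cases hi : i ∈ S
    · have : ∀ T : SignVec α, T.away S i = 0 := fun T => by simp [SignVec.away, hi]
      rw [Pi.neg_apply, this, this]
      rfl
    · rw [Pi.neg_apply, SignVec.away_apply_of_notMem hi, SignVec.away_apply_of_notMem hi]
      rfl
  eq_or_eq_neg := by
    rintro _ ⟨X, hX, rfl, hmin⟩ _ ⟨Y, hY, rfl, -⟩ hsupp
    have hK := (hC.minimal_iff S _).1 hmin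
    rw [SignVec.support_away, SignVec.support_away] at hsupp
    obtain ⟨x, hx⟩ := hK.nonempty
    have pm : ∀ a b : SignType, a ≠ 0 → b ≠ 0 → a = b ∨ a = -b := by decide
    -- the ratio of the signs at `x` and `y` is determined by orthogonality to a cocircuit
    have key : ∀ y ∈ Function.support X \ S, x ≠ y → ∃ Z : SignVec α, Z x ≠ 0 ∧ Z y ≠ 0 ∧
        (∀ T : SignVec α, T ∈ C → Function.support T \ S = Function.support X \ S →
          T x * Z x = -(T y * Z y)) := by
      intro y hy hxy
      obtain ⟨L, hL, hKL⟩ := hK.exists_isCocircuit_inter_eq_pair hx hy hxy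
      obtain ⟨hL, hLS⟩ := Matroid.contract_isCocircuit_iff.1 hL
      obtain ⟨Z, hZ, rfl⟩ := hD.exists_support_eq L hL
      have hxZ : x ∈ Function.support Z :=
        ((Set.ext_iff.1 hKL x).2 (Or.inl rfl)).2
      have hyZ : y ∈ Function.support Z :=
        ((Set.ext_iff.1 hKL y).2 (Or.inr rfl)).2
      refine ⟨Z, hxZ, hyZ, fun T hT hTX => ?_⟩
      have hTx : T x ≠ 0 := (hTX ▸ hx : x ∈ Function.support T \ S).1
      have hTy : T y ≠ 0 := (hTX ▸ hy : y ∈ Function.support T \ S).1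
      have hzero : ∀ z, z ≠ x → z ≠ y → T z * Z z = 0 := by
        intro z hzx hzy
        by_contra hne
        have hZz : Z z ≠ 0 := right_ne_zero_of_mul hne
        have hTz : T z ≠ 0 := left_ne_zero_of_mul hne
        have hzS : z ∉ S := fun hzS => Set.disjoint_left.1 hLS hZz hzS
        have : z ∈ Function.support X \ S := by rw [← hTX]; exact ⟨hTz, hzS⟩
        rcases (Set.ext_iff.1 hKL z).1 ⟨this, hZz⟩ with h | h
        · exact hzx h
        · exact hzy h
      have fin : ∀ a b : SignType, a ≠ 0 → b ≠ 0 → (a = 1 ∨ b = 1) → (a = -1 ∨ b = -1) →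
          a = -b := by decide
      have hxZ' : Z x ≠ 0 := hxZ
      have hyZ' : Z y ≠ 0 := hyZ
      have hloc : ∀ s : SignType, s ≠ 0 → (∃ i, T i * Z i = s) →
          T x * Z x = s ∨ T y * Z y = s := by
        rintro s hs ⟨i, hi⟩
        by_cases hix : i = x
        · exact Or.inl (hix ▸ hi)
        by_cases hiy : i = y
        · exact Or.inr (hiy ▸ hi)
        · exact absurd ((hzero i hix hiy).symm.trans hi).symm hs
      rcases horth T hT Z hZ with h | ⟨h1, h2⟩
      · exact absurd (h x) (mul_ne_zero hTx hxZ')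
      · exact fin _ _ (mul_ne_zero hTx hxZ') (mul_ne_zero hTy hyZ')
          (hloc 1 (by decide) h1) (hloc (-1) (by decide) h2)
    have hYx : Y x ≠ 0 := (hsupp ▸ hx : x ∈ Function.support Y \ S).1
    have tr : ∀ a b c d z w : SignType, z ≠ 0 → w ≠ 0 → a * z = -(c * w) → b * z = -(d * w) →
        (a = b → c = d) ∧ (a = -b → c = -d) := by decide
    have out : ∀ y, y ∉ Function.support X \ S → X.away S y = 0 ∧ Y.away S y = 0 := by
      intro y hy
      constructor
      · by_contra hne
        exact hy (by rw [← SignVec.support_away]; exact hne)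
      · by_contra hne
        exact hy (by rw [hsupp, ← SignVec.support_away]; exact hne)
    rcases pm (X x) (Y x) hx.1 hYx with hxy | hxy
    · left
      funext y
      by_cases hy : y ∈ Function.support X \ S
      · rw [SignVec.away_apply_of_notMem hy.2, SignVec.away_apply_of_notMem hy.2]
        by_cases hne : x = y
        · exact hne ▸ hxy
        · obtain ⟨Z, hZx, hZy, hZ⟩ := key y hy hne
          exact (tr _ _ _ _ _ _ hZx hZy (hZ X hX rfl) (hZ Y hY hsupp.symm)).1 hxy
      · rw [(out y hy).1, (out y hy).2]
    · right
      funext y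
      by_cases hy : y ∈ Function.support X \ S
      · rw [Pi.neg_apply, SignVec.away_apply_of_notMem hy.2, SignVec.away_apply_of_notMem hy.2]
        by_cases hne : x = y
        · exact hne ▸ hxy
        · obtain ⟨Z, hZx, hZy, hZ⟩ := key y hy hne
          exact (tr _ _ _ _ _ _ hZx hZy (hZ X hX rfl) (hZ Y hY hsupp.symm)).2 hxy
      · rw [Pi.neg_apply, (out y hy).1, (out y hy).2]
        rfl

theorem SignVec.Orthogonal.away_of_disjoint {α : Type*} {X Y : SignVec α} {S : Set α}
    (h : X.Orthogonal Y) (hX : Disjoint (Function.support X) S) : X.Orthogonal (Y.away S) := by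
  have : ∀ i, X i * Y.away S i = X i * Y i := by
    intro i
    by_cases hi : i ∈ S
    · have : X i = 0 := by
        by_contra hne
        exact Set.disjoint_left.1 hX hne hi
      rw [this, zero_mul, zero_mul]
    · rw [SignVec.away_apply_of_notMem hi]
  unfold SignVec.Orthogonal at *
  simpa only [this] using h

namespace OrientedMatroid

variable {α : Type*}

/-- The dual oriented matroid: the roles of circuits and cocircuits are exchanged. -/
def dual (M : OrientedMatroid α) : OrientedMatroid α where
  matroid := M.matroid.dual
  circuits := M.cocircuits
  cocircuits := M.circuits
  circuits_signature := M.cocircuits_signature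
  cocircuits_signature := by
    rw [Matroid.dual_dual]
    exact M.circuits_signature
  orthogonal X hX Y hY := (M.orthogonal Y hY X hX).symm

/-- The deletion of `S`. -/
def delete (M : OrientedMatroid α) (S : Set α) : OrientedMatroid α where
  matroid := M.matroid.delete S
  circuits := deleteSignature M.circuits S
  cocircuits := contractSignature M.cocircuits S
  circuits_signature := M.circuits_signature.delete S
  cocircuits_signature := by
    rw [Matroid.dual_delete]
    exact M.cocircuits_signature.contract (D := M.circuits)
      (by rw [Matroid.dual_dual]; exact M.circuits_signature)
      (fun X hX Y hY => (M.orthogonal Y hY X hX).symm) S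
  orthogonal := by
    rintro X hX _ ⟨Y, hY, rfl, -⟩
    exact (M.orthogonal X hX.1 Y hY).away_of_disjoint hX.2

/-- The contraction of `S`. -/
def contract (M : OrientedMatroid α) (S : Set α) : OrientedMatroid α where
  matroid := M.matroid.contract S
  circuits := contractSignature M.circuits S
  cocircuits := deleteSignature M.cocircuits S
  circuits_signature :=
    M.circuits_signature.contract M.cocircuits_signature M.orthogonal S
  cocircuits_signature := by
    rw [Matroid.dual_contract]
    exact M.cocircuits_signature.delete S
  orthogonal := by
    rintro _ ⟨X, hX, rfl, -⟩ Y hY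
    exact ((M.orthogonal X hX Y hY.1).symm.away_of_disjoint hY.2).symm

/-- The zero set of a sign vector of `M`. -/
def zeroSet (M : OrientedMatroid α) (X : SignVec α) : Set α := M.matroid.E \ Function.support X

/-- The covectors: zero and all compositions of cocircuits. -/
inductive IsCovector (M : OrientedMatroid α) : SignVec α → Prop
  | zero : IsCovector M 0
  | comp (Y Z : SignVec α) : Y ∈ M.cocircuits → IsCovector M Z → IsCovector M (Y.comp Z)

/-- The topes: the covectors that are maximal in the face order. -/
def IsTope (M : OrientedMatroid α) (T : SignVec α) : Prop :=
  M.IsCovector T ∧ ∀ T', M.IsCovector T' → T.IsFace T' → T' = T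

end OrientedMatroid

/-! ## Oriented matroid programs -/

/-- An oriented matroid program `(M̃, g, f)` over the index set `E`. The ground set of `M̃` is `E`
together with two further elements, indexed by `Bool`; one of them is `g` and the other is `f`. -/
structure OMProgram (E : Type*) where
  /-- the oriented matroid on `E ⊔ {f, g}` -/
  Mt : OrientedMatroid (E ⊕ Bool)
  /-- the label of the element `g` -/
  g : Bool
  /-- the label of the element `f` -/
  f : Bool
  g_ne_f : g ≠ f
  ground_eq : Mt.matroid.E = Set.univ
  /-- `g` is not a loop -/
  g_not_loop : ∀ X ∈ Mt.circuits, Function.support X ≠ {Sum.inr g}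
  /-- `f` is not a coloop -/
  f_not_coloop : ∃ X ∈ Mt.circuits, X (Sum.inr f) ≠ 0

namespace OMProgram

variable {E : Type*} (P : OMProgram E)

/-- The affine oriented matroid `N = M̃ \ f`. -/
def N : OrientedMatroid (E ⊕ Bool) := P.Mt.delete {Sum.inr P.f}

/-- The contraction `M̃ / g`. -/
def contractG : OrientedMatroid (E ⊕ Bool) := P.Mt.contract {Sum.inr P.g}

/-- The oriented matroid `M = (M̃ \ f) / g` on `E` of the program. -/
def M : OrientedMatroid (E ⊕ Bool) := P.N.contract {Sum.inr P.g}

/-- The dual program `(M̃^∨, f, g)`. -/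
def dual : OMProgram E where
  Mt := P.Mt.dual
  g := P.f
  f := P.g
  g_ne_f := P.g_ne_f.symm
  ground_eq := P.ground_eq
  g_not_loop := by
    intro Y hY hsupp
    obtain ⟨X, hX, hXf⟩ := P.f_not_coloop
    have hK : P.Mt.matroid.IsCocircuit {Sum.inr P.f} := by
      have := P.Mt.cocircuits_signature.isCircuit_support Y hY
      rwa [hsupp] at this
    refine (P.Mt.circuits_signature.isCircuit_support X hX).inter_isCocircuit_ne_singleton hK
      (e := Sum.inr P.f) ?_
    exact Set.inter_eq_right.2 (by rintro _ rfl; exact hXf)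
  f_not_coloop := by
    have hI : P.Mt.matroid.Indep {Sum.inr P.g} := by
      rw [Matroid.indep_iff_forall_subset_not_isCircuit
        (by rw [P.ground_eq]; exact Set.subset_univ _)]
      intro K hKg hK
      obtain ⟨X, hX, rfl⟩ := P.Mt.circuits_signature.exists_support_eq K hK
      exact P.g_not_loop X hX ((Set.subset_singleton_iff_eq.1 hKg).resolve_left hK.nonempty.ne_empty)
    obtain ⟨K, hK, hKg⟩ := hI.exists_isCocircuit_inter_eq_mem (e := Sum.inr P.g) rfl
    obtain ⟨Y, hY, rfl⟩ := P.Mt.cocircuits_signature.exists_support_eq K hK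
    refine ⟨Y, hY, ?_⟩
    have : Sum.inr P.g ∈ Function.support Y := by
      have h : (Sum.inr P.g : E ⊕ Bool) ∈ ({Sum.inr P.g} : Set (E ⊕ Bool)) := rfl
      rw [← hKg] at h
      exact h.1
    exact this

/-- Genericity, where `d` is the rank of `M` and `n = |E|`. The condition `|z(X)| > n - d` is
written as `n < |z(X)| + d`. -/
def IsGeneric : Prop :=
  (∀ Y ∈ P.N.cocircuits, P.M.matroid.eRank < (P.N.zeroSet Y).encard → Y (Sum.inr P.g) = 0) ∧
  (∀ X ∈ P.contractG.circuits,
    ENat.card E < (P.contractG.zeroSet X).encard + P.M.matroid.eRank → X (Sum.inr P.f) = 0)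

/-- The feasible topes, that is, the topes `T` of `N` with `T(g) = +`, identified with their
restrictions to `E`. -/
def IsFeasible (a : SignVec E) : Prop :=
  ∃ T, P.N.IsTope T ∧ T (Sum.inr P.g) = 1 ∧ ∀ i, T (Sum.inl i) = a i

/-- `a` is unbounded if there is an increasing direction, that is, a covector `Z` with `Z(g) = 0`
and `Z(f) = +`, whose restriction to `E` is a face of `a`. -/
def IsUnbounded (a : SignVec E) : Prop :=
  ∃ Z, P.Mt.IsCovector Z ∧ Z (Sum.inr P.g) = 0 ∧ Z (Sum.inr P.f) = 1 ∧
    SignVec.IsFace (fun i => Z (Sum.inl i)) a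

/-- The type of feasible topes. -/
def Feas : Type _ := {a : SignVec E // P.IsFeasible a}

noncomputable instance [Finite E] : Fintype P.Feas :=
  have : Finite P.Feas := inferInstanceAs (Finite {a : SignVec E // P.IsFeasible a})
  Fintype.ofFinite P.Feas

/-- The two topes differ exactly in the coordinate `i`. -/
def DifferAt (a b : P.Feas) (i : E) : Prop :=
  a.1 i ≠ b.1 i ∧ ∀ j, j ≠ i → a.1 j = b.1 j

/-- The two topes differ in exactly one coordinate. -/
def Adj (a b : P.Feas) : Prop := ∃ i, P.DifferAt a b i

/-- A subspace `U ⊆ k^E` is a parameter space if its projection to `k^b` is an isomorphism for every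
basis `b` of the matroid underlying `M`. -/
def IsParameterSpace {k : Type*} [Field k] (U : Submodule k (E → k)) : Prop :=
  ∀ b : Set E, P.M.matroid.IsBase (Sum.inl '' b) →
    Function.Bijective (fun (u : U) (i : b) => (u : E → k) i)

end OMProgram

/-- The orthogonal complement `U^⊥` for the standard pairing on `k^E`. -/
def perp {k E : Type*} [Field k] [Fintype E] (U : Submodule k (E → k)) : Submodule k (E → k) where
  carrier := {x | ∀ u ∈ U, ∑ i, x i * u i = 0}
  add_mem' {x y} hx hy u hu := by
    simp only [Pi.add_apply, add_mul, Finset.sum_add_distrib, hx u hu, hy u hu, add_zero]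
  zero_mem' u _ := by simp
  smul_mem' c x hx u hu := by
    simp only [Pi.smul_apply, smul_eq_mul, mul_assoc, ← Finset.mul_sum, hx u hu, mul_zero]

/-! ## Path algebras -/

section PathAlgebra

variable (k : Type*) [Field k] {V : Type*} [Fintype V] (Adj : V → V → Prop)

/-- The generators of the path algebra of the quiver with vertex set `V` and one arrow from `a` to
`b` whenever `Adj a b`. -/
inductive PathGen : Type _
  | vertex (a : V) : PathGen
  | arrow (a b : V) (h : Adj a b) : PathGen

/-- The relations of the path algebra: the vertices are orthogonal idempotents with sum `1`, and
each arrow starts and ends at its vertices (paths are composed from left to right). -/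
inductive PathRel : FreeAlgebra k (PathGen Adj) → FreeAlgebra k (PathGen Adj) → Prop
  | idem (a : V) : PathRel (.ι k (.vertex a) * .ι k (.vertex a)) (.ι k (.vertex a))
  | orth (a b : V) : a ≠ b → PathRel (.ι k (.vertex a) * .ι k (.vertex b)) 0
  | sum_eq_one : PathRel (∑ a, .ι k (.vertex a)) 1
  | source (a b : V) (h : Adj a b) :
      PathRel (.ι k (.vertex a) * .ι k (.arrow a b h)) (.ι k (.arrow a b h))
  | target (a b : V) (h : Adj a b) :
      PathRel (.ι k (.arrow a b h) * .ι k (.vertex b)) (.ι k (.arrow a b h))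

/-- The path algebra over `k`. -/
def PathAlgebra : Type _ := RingQuot (PathRel k Adj)

noncomputable instance : Ring (PathAlgebra k Adj) := inferInstanceAs (Ring (RingQuot _))

noncomputable instance : Algebra k (PathAlgebra k Adj) :=
  inferInstanceAs (Algebra k (RingQuot (PathRel k Adj)))

/-- The image in the path algebra of a generator. -/
noncomputable def PathAlgebra.of (x : PathGen Adj) : PathAlgebra k Adj :=
  RingQuot.mkAlgHom k (PathRel k Adj) (FreeAlgebra.ι k x)

end PathAlgebra

/-! ## Gradings given by homogeneous generators -/

section Grading

variable {k A : Type*} [Field k] [Ring A] [Algebra k A]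

/-- The products of generators, with their degrees; `gen j x` says that `x` is a generator of
degree `j`. -/
inductive IsMonomial (gen : ℕ → A → Prop) : ℕ → A → Prop
  | one : IsMonomial gen 0 1
  | gen_mul (i j : ℕ) (x y : A) : gen i x → IsMonomial gen j y → IsMonomial gen (i + j) (x * y)

variable (k) in
/-- The span of the products of generators of total degree `j`. -/
def degreePiece (gen : ℕ → A → Prop) (j : ℕ) : Submodule k A :=
  Submodule.span k {x | IsMonomial gen j x}

theorem IsMonomial.mul {gen : ℕ → A → Prop} {i j : ℕ} {x y : A} (hx : IsMonomial gen i x)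
    (hy : IsMonomial gen j y) : IsMonomial gen (i + j) (x * y) := by
  induction hx with
  | one => simpa using hy
  | gen_mul i i' x x' hx _ ih =>
    rw [add_assoc, mul_assoc]
    exact .gen_mul _ _ _ _ hx ih

instance degreePiece.gradedMonoid (gen : ℕ → A → Prop) :
    SetLike.GradedMonoid (degreePiece k gen) where
  one_mem := Submodule.subset_span .one
  mul_mem := by
    intro i j x y hx hy
    have h : x * y ∈ degreePiece k gen i * degreePiece k gen j := Submodule.mul_mem_mul hx hy
    unfold degreePiece at h
    rw [Submodule.span_mul_span] at h
    refine Submodule.span_mono ?_ h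
    rintro _ ⟨a, ha, b, hb, rfl⟩
    exact ha.mul hb

end Grading

/-! ## The algebra of a program and a parameter space -/

namespace OMProgram

variable {E : Type*} [Fintype E] {k : Type*} [Field k]

section

variable (k) (P : OMProgram E)

/-- `P(Q) ⊗ k[u₁, …, uₙ]`, where `Q` is the quiver of feasible topes. -/
abbrev PolyPath : Type _ := PathAlgebra k P.Adj ⊗[k] MvPolynomial E k

/-- The idempotent `e_a` in `P(Q) ⊗ k[u₁, …, uₙ]`. -/
noncomputable def e₀ (a : P.Feas) : P.PolyPath k := PathAlgebra.of k P.Adj (.vertex a) ⊗ₜ 1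

/-- The arrow `p(a, b)` in `P(Q) ⊗ k[u₁, …, uₙ]`. -/
noncomputable def p₀ (a b : P.Feas) (h : P.Adj a b) : P.PolyPath k :=
  PathAlgebra.of k P.Adj (.arrow a b h) ⊗ₜ 1

/-- The variable `u_i` in `P(Q) ⊗ k[u₁, …, uₙ]`. -/
noncomputable def u₀ (i : E) : P.PolyPath k := 1 ⊗ₜ MvPolynomial.X i

end

variable (P : OMProgram E) (U : Submodule k (E → k))

/-- The defining relations of the algebra `A(P, U)`. -/
inductive ARel : P.PolyPath k → P.PolyPath k → Prop
  | unbounded (a : P.Feas) : P.IsUnbounded a.1 → ARel (P.e₀ k a) 0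
  | square (a b c d : P.Feas) (hab : a ≠ b) (hcd : c ≠ d) (hac : P.Adj a c) (hcb : P.Adj c b)
      (had : P.Adj a d) (hdb : P.Adj d b) :
      ARel (P.p₀ k a c hac * P.p₀ k c b hcb) (P.p₀ k a d had * P.p₀ k d b hdb)
  | loop (a b : P.Feas) (i : E) (hi : P.DifferAt a b i) (hab : P.Adj a b) (hba : P.Adj b a) :
      ARel (P.p₀ k a b hab * P.p₀ k b a hba) (P.e₀ k a * P.u₀ k i)
  | parameter (x : E → k) : x ∈ perp U → ARel (∑ i, x i • P.u₀ k i) 0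

/-- The algebra `A(P, U)`. -/
def A : Type _ := RingQuot (P.ARel U)

noncomputable instance : Ring (P.A U) := inferInstanceAs (Ring (RingQuot (P.ARel U)))

noncomputable instance : Algebra k (P.A U) := inferInstanceAs (Algebra k (RingQuot (P.ARel U)))

/-- The projection from `P(Q) ⊗ k[u₁, …, uₙ]` to `A(P, U)`. -/
noncomputable def A.mk : P.PolyPath k →ₐ[k] P.A U := RingQuot.mkAlgHom k (P.ARel U)

/-- The generators of `A(P, U)` with their degrees: `e_a`, `p(a, b)` and `u_i` have degree `0`, `1`
and `2`. -/
inductive AGen : ℕ → P.A U → Prop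
  | e (a : P.Feas) : AGen 0 (A.mk P U (P.e₀ k a))
  | p (a b : P.Feas) (h : P.Adj a b) : AGen 1 (A.mk P U (P.p₀ k a b h))
  | u (i : E) : AGen 2 (A.mk P U (P.u₀ k i))

/-- The homogeneous pieces of `A(P, U)`. -/
noncomputable abbrev gradingA : ℕ → Submodule k (P.A U) := degreePiece k (P.AGen U)

end OMProgram

/-! ## Tensor algebras of bimodules and quadratic algebras

A bimodule over a `k`-algebra `R` is a `k`-space `V` with a left action of `R` and a commuting right
action of `R` (a left action of `Rᵐᵒᵖ`). -/

section BimoduleDual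

/-- The dual `V^* = Hom_R(V, R)` of a bimodule, consisting of the homomorphisms of right
`R`-modules. It is a bimodule through `(r φ)(v) = r φ(v)` and `(φ r)(v) = φ(r v)`. -/
def BimoduleDual (R V : Type*) [Ring R] [AddCommGroup V] [Module Rᵐᵒᵖ V] : Type _ :=
  V →ₗ[Rᵐᵒᵖ] R

namespace BimoduleDual

variable {k R V : Type*} [Field k] [Ring R] [Algebra k R] [AddCommGroup V] [Module Rᵐᵒᵖ V]

instance : AddCommGroup (BimoduleDual R V) := inferInstanceAs (AddCommGroup (V →ₗ[Rᵐᵒᵖ] R))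

instance : FunLike (BimoduleDual R V) V R := inferInstanceAs (FunLike (V →ₗ[Rᵐᵒᵖ] R) V R)

instance : LinearMapClass (BimoduleDual R V) Rᵐᵒᵖ V R :=
  inferInstanceAs (LinearMapClass (V →ₗ[Rᵐᵒᵖ] R) Rᵐᵒᵖ V R)

instance : Module k (BimoduleDual R V) := inferInstanceAs (Module k (V →ₗ[Rᵐᵒᵖ] R))

instance : Module R (BimoduleDual R V) := inferInstanceAs (Module R (V →ₗ[Rᵐᵒᵖ] R))

@[ext] theorem ext {φ ψ : BimoduleDual R V} (h : ∀ v, φ v = ψ v) : φ = ψ := LinearMap.ext h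

theorem add_apply (φ ψ : BimoduleDual R V) (v : V) : (φ + ψ) v = φ v + ψ v := rfl

theorem zero_apply (v : V) : (0 : BimoduleDual R V) v = 0 := rfl

theorem smul_apply (r : R) (φ : BimoduleDual R V) (v : V) : (r • φ) v = r * φ v := rfl

theorem scalar_smul_apply (c : k) (φ : BimoduleDual R V) (v : V) : (c • φ) v = c • φ v := rfl

theorem map_scalar_smul [Module k V] [IsScalarTower k Rᵐᵒᵖ V] (φ : BimoduleDual R V) (c : k)
    (v : V) : φ (c • v) = c • φ v := by
  have h : c • v = (c • (1 : Rᵐᵒᵖ)) • v := by rw [smul_assoc, one_smul]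
  rw [h, map_smul, smul_assoc, one_smul]

variable [Module R V] [SMulCommClass R Rᵐᵒᵖ V]

instance : SMul Rᵐᵒᵖ (BimoduleDual R V) where
  smul r φ :=
    ({ toFun := fun v => φ (r.unop • v)
       map_add' := fun v w => by rw [smul_add, map_add]
       map_smul' := fun s v => by
        rw [smul_comm, map_smul, RingHom.id_apply] } : V →ₗ[Rᵐᵒᵖ] R)

theorem op_smul_apply (r : Rᵐᵒᵖ) (φ : BimoduleDual R V) (v : V) : (r • φ) v = φ (r.unop • v) := rfl

instance : Module Rᵐᵒᵖ (BimoduleDual R V) where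
  one_smul φ := by ext v; simp [op_smul_apply]
  mul_smul r s φ := by ext v; simp [op_smul_apply, mul_smul]
  smul_zero r := by ext v; simp [op_smul_apply, zero_apply]
  smul_add r φ ψ := by ext v; simp [op_smul_apply, add_apply]
  add_smul r s φ := by ext v; simp [op_smul_apply, add_apply, add_smul]
  zero_smul φ := by ext v; simp [op_smul_apply, zero_apply]

instance : SMulCommClass R Rᵐᵒᵖ (BimoduleDual R V) where
  smul_comm r s φ := by ext v; simp [op_smul_apply, smul_apply]

end BimoduleDual

end BimoduleDual

section Bimodule

variable (k R V : Type*) [Field k] [Ring R] [Algebra k R] [AddCommGroup V] [Module k V]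
  [Module R V] [Module Rᵐᵒᵖ V]

/-- The relations defining the tensor algebra of the bimodule `V` over `R`, as a quotient of the
tensor algebra of `R × V` over `k`. -/
inductive BimoduleTensorRel : TensorAlgebra k (R × V) → TensorAlgebra k (R × V) → Prop
  | one : BimoduleTensorRel (.ι k (1, 0)) 1
  | mul (r s : R) : BimoduleTensorRel (.ι k (r * s, 0)) (.ι k (r, 0) * .ι k (s, 0))
  | left (r : R) (v : V) : BimoduleTensorRel (.ι k (0, r • v)) (.ι k (r, 0) * .ι k (0, v))
  | right (r : R) (v : V) :
      BimoduleTensorRel (.ι k (0, MulOpposite.op r • v)) (.ι k (0, v) * .ι k (r, 0))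

/-- The tensor algebra `T_R(V)` of the bimodule `V` over `R`: the universal `k`-algebra with an
algebra homomorphism from `R` and a bimodule homomorphism from `V`. -/
abbrev BimoduleTensorAlgebra : Type _ := RingQuot (BimoduleTensorRel k R V)

/-- The inclusion of `V` in `T_R(V)`. -/
noncomputable def BimoduleTensorAlgebra.ofV : V →ₗ[k] BimoduleTensorAlgebra k R V :=
  (RingQuot.mkAlgHom k (BimoduleTensorRel k R V)).toLinearMap ∘ₗ
    TensorAlgebra.ι k ∘ₗ LinearMap.inr k R V

/-- The map from `R` to `T_R(V)`. -/
noncomputable def BimoduleTensorAlgebra.ofR : R →ₗ[k] BimoduleTensorAlgebra k R V :=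
  (RingQuot.mkAlgHom k (BimoduleTensorRel k R V)).toLinearMap ∘ₗ
    TensorAlgebra.ι k ∘ₗ LinearMap.inl k R V

theorem BimoduleTensorAlgebra.ofV_left (r : R) (v : V) :
    ofV k R V (r • v) = ofR k R V r * ofV k R V v := by
  simpa [ofV, ofR] using RingQuot.mkAlgHom_rel k (BimoduleTensorRel.left (k := k) r v)

theorem BimoduleTensorAlgebra.ofV_right (r : R) (v : V) :
    ofV k R V (MulOpposite.op r • v) = ofV k R V v * ofR k R V r := by
  simpa [ofV, ofR] using RingQuot.mkAlgHom_rel k (BimoduleTensorRel.right (k := k) r v)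

/-- The subspace of `V ⊗_k V` spanned by the elements `v r ⊗ w - v ⊗ r w`. -/
def balancing : Submodule k (V ⊗[k] V) :=
  Submodule.span k {x | ∃ (v w : V) (r : R), x = (MulOpposite.op r • v) ⊗ₜ[k] w - v ⊗ₜ[k] (r • w)}

/-- The tensor square `V ⊗_R V` of a bimodule. -/
abbrev TensorSquare : Type _ := (V ⊗[k] V) ⧸ balancing k R V

variable {k R V} in
/-- A balanced `k`-bilinear map on `V × V` induces a linear map on `V ⊗_R V`. -/
noncomputable def TensorSquare.lift {X : Type*} [AddCommGroup X] [Module k X]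
    (φ : V →ₗ[k] V →ₗ[k] X)
    (h : ∀ (v w : V) (r : R), φ (MulOpposite.op r • v) w = φ v (r • w)) :
    TensorSquare k R V →ₗ[k] X :=
  (balancing k R V).liftQ (TensorProduct.lift φ) (by
    unfold balancing
    rw [Submodule.span_le]
    rintro _ ⟨v, w, r, rfl⟩
    simp [h])

/-- The map from `V ⊗_R V` to the degree two part of `T_R(V)`. -/
noncomputable def BimoduleTensorAlgebra.ofSquare :
    TensorSquare k R V →ₗ[k] BimoduleTensorAlgebra k R V :=
  TensorSquare.lift ((LinearMap.mul k _).compl₁₂ (ofV k R V) (ofV k R V)) (by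
    intro v w r
    simp [ofV_left, ofV_right, mul_assoc])

/-- The relations imposed on `T_R(V)` by a space `W ⊆ V ⊗_R V` of quadratic relations. -/
inductive QuadraticRel (W : Submodule k (TensorSquare k R V)) :
    BimoduleTensorAlgebra k R V → BimoduleTensorAlgebra k R V → Prop
  | rel (x : TensorSquare k R V) :
      x ∈ W → QuadraticRel W (BimoduleTensorAlgebra.ofSquare k R V x) 0

/-- The quotient of `T_R(V)` by the two-sided ideal generated by `W ⊆ V ⊗_R V`. -/
abbrev QuadraticQuotient (W : Submodule k (TensorSquare k R V)) : Type _ :=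
  RingQuot (QuadraticRel k R V W)

/-- The generators of the quotient of `T_R(V)`: the elements of `R` in degree `0` and those of `V`
in degree `1`. -/
inductive QuadraticGen (W : Submodule k (TensorSquare k R V)) :
    ℕ → QuadraticQuotient k R V W → Prop
  | ofR (r : R) : QuadraticGen W 0
      (RingQuot.mkAlgHom k (QuadraticRel k R V W) (BimoduleTensorAlgebra.ofR k R V r))
  | ofV (v : V) : QuadraticGen W 1
      (RingQuot.mkAlgHom k (QuadraticRel k R V W) (BimoduleTensorAlgebra.ofV k R V v))

/-- The homogeneous pieces of the quotient of `T_R(V)`. -/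
abbrev QuadraticQuotient.grading (W : Submodule k (TensorSquare k R V)) :
    ℕ → Submodule k (QuadraticQuotient k R V W) :=
  degreePiece k (QuadraticGen k R V W)

namespace BimoduleDual

variable {R V} [SMulCommClass R Rᵐᵒᵖ V] [IsScalarTower k R V] [IsScalarTower k Rᵐᵒᵖ V]

variable (R V) in
/-- The pairing of `V^* ⊗_R V^*` with `V ⊗_R V`, given by `⟨φ ⊗ ψ, v ⊗ w⟩ = φ(ψ(v) w)`. -/
noncomputable def pairing :
    TensorSquare k R (BimoduleDual R V) →ₗ[k] TensorSquare k R V →ₗ[k] R :=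
  TensorSquare.lift
    (LinearMap.mk₂ k
      (fun φ ψ => TensorSquare.lift
        (LinearMap.mk₂ k (fun v w => φ (ψ v • w))
          (fun v v' w => by simp [add_smul])
          (fun c v w => by
            rw [map_scalar_smul ψ, smul_assoc, map_scalar_smul φ])
          (fun v w w' => by simp)
          (fun c v w => by
            rw [← map_scalar_smul φ]
            congr 1
            rw [← smul_one_smul R c w, ← smul_one_smul R c (ψ v • w), ← mul_smul, ← mul_smul]
            congr 1
            simp))
        (fun v w r => by
          simp only [LinearMap.mk₂_apply, map_smul, MulOpposite.smul_eq_mul_unop,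
            MulOpposite.unop_op, mul_smul]))
      (fun φ φ' ψ => by
        apply Submodule.linearMap_qext
        ext v w
        simp [TensorSquare.lift, add_apply])
      (fun c φ ψ => by
        apply Submodule.linearMap_qext
        ext v w
        simp [TensorSquare.lift, scalar_smul_apply])
      (fun φ ψ ψ' => by
        apply Submodule.linearMap_qext
        ext v w
        simp [TensorSquare.lift, add_apply, add_smul])
      (fun c φ ψ => by
        apply Submodule.linearMap_qext
        ext v w
        simp [TensorSquare.lift, scalar_smul_apply, map_scalar_smul]))
    (by
      intro φ ψ r
      apply Submodule.linearMap_qext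
      ext v w
      simp [TensorSquare.lift, op_smul_apply, smul_apply, mul_smul])

end BimoduleDual

end Bimodule

/-! ## Quadratic graded algebras and quadratic duals -/

section Quadratic

variable {k A : Type*} [Field k] [Ring A] [Algebra k A] (𝒜 : ℕ → Submodule k A)

/-- The degree one part `A₁`, which is a bimodule over `A₀` through multiplication. -/
def DegOne : Type _ := 𝒜 1

namespace DegOne

instance : AddCommGroup (DegOne 𝒜) := inferInstanceAs (AddCommGroup (𝒜 1))

instance : Module k (DegOne 𝒜) := inferInstanceAs (Module k (𝒜 1))

/-- The inclusion of `A₁` in `A`. -/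
def incl : DegOne 𝒜 →ₗ[k] A := (𝒜 1).subtype

theorem incl_injective : Function.Injective (incl 𝒜) := Subtype.val_injective

end DegOne

variable [SetLike.GradedMonoid 𝒜]

/-- The degree zero subalgebra `A₀`. -/
abbrev DegZero : Subalgebra k A := SetLike.GradeZero.subalgebra 𝒜

namespace DegOne

instance : SMul (DegZero 𝒜) (DegOne 𝒜) where
  smul r v := ⟨(r : A) * v.1, by
    have := SetLike.GradedMul.mul_mem (A := 𝒜) r.2 v.2
    rwa [zero_add] at this⟩

instance : SMul (DegZero 𝒜)ᵐᵒᵖ (DegOne 𝒜) where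
  smul r v := ⟨v.1 * (r.unop : A), by
    have := SetLike.GradedMul.mul_mem (A := 𝒜) v.2 r.unop.2
    rwa [add_zero] at this⟩

theorem incl_smul (r : DegZero 𝒜) (v : DegOne 𝒜) : incl 𝒜 (r • v) = r * incl 𝒜 v := rfl

theorem incl_op_smul (r : (DegZero 𝒜)ᵐᵒᵖ) (v : DegOne 𝒜) :
    incl 𝒜 (r • v) = incl 𝒜 v * r.unop := rfl

instance : Module (DegZero 𝒜) (DegOne 𝒜) where
  one_smul v := incl_injective 𝒜 (by simp [incl_smul])
  mul_smul r s v := incl_injective 𝒜 (by simp [incl_smul, mul_assoc])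
  smul_zero r := incl_injective 𝒜 (by simp [incl_smul])
  smul_add r v w := incl_injective 𝒜 (by simp [incl_smul, mul_add])
  add_smul r s v := incl_injective 𝒜 (by simp [incl_smul, add_mul])
  zero_smul v := incl_injective 𝒜 (by simp [incl_smul])

instance : Module (DegZero 𝒜)ᵐᵒᵖ (DegOne 𝒜) where
  one_smul v := incl_injective 𝒜 (by simp [incl_op_smul])
  mul_smul r s v := incl_injective 𝒜 (by simp [incl_op_smul, mul_assoc])
  smul_zero r := incl_injective 𝒜 (by simp [incl_op_smul])
  smul_add r v w := incl_injective 𝒜 (by simp [incl_op_smul, add_mul])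
  add_smul r s v := incl_injective 𝒜 (by simp [incl_op_smul, mul_add])
  zero_smul v := incl_injective 𝒜 (by simp [incl_op_smul])

instance : SMulCommClass (DegZero 𝒜) (DegZero 𝒜)ᵐᵒᵖ (DegOne 𝒜) where
  smul_comm r s v := incl_injective 𝒜 (by simp [incl_smul, incl_op_smul, mul_assoc])

instance : IsScalarTower k (DegZero 𝒜) (DegOne 𝒜) where
  smul_assoc c r v := incl_injective 𝒜 (by simp [incl_smul])

instance : IsScalarTower k (DegZero 𝒜)ᵐᵒᵖ (DegOne 𝒜) where
  smul_assoc c r v := incl_injective 𝒜 (by simp [incl_op_smul])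

end DegOne

/-- The multiplication map `A₁ ⊗_{A₀} A₁ → A`. -/
noncomputable def squareToAlgebra : TensorSquare k (DegZero 𝒜) (DegOne 𝒜) →ₗ[k] A :=
  TensorSquare.lift ((LinearMap.mul k A).compl₁₂ (DegOne.incl 𝒜) (DegOne.incl 𝒜)) (by
    intro v w r
    simp [DegOne.incl_smul, DegOne.incl_op_smul, mul_assoc])

/-- The space `W ⊆ A₁ ⊗_{A₀} A₁` of quadratic relations of `A`. -/
noncomputable def quadraticRelations : Submodule k (TensorSquare k (DegZero 𝒜) (DegOne 𝒜)) :=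
  LinearMap.ker (squareToAlgebra 𝒜)

/-- The canonical homomorphism `T_{A₀}(A₁) → A`. -/
noncomputable def tensorToAlgebra :
    BimoduleTensorAlgebra k (DegZero 𝒜) (DegOne 𝒜) →ₐ[k] A :=
  RingQuot.liftAlgHom k ⟨TensorAlgebra.lift k
    (LinearMap.coprod (DegZero 𝒜).val.toLinearMap (DegOne.incl 𝒜)), by
      rintro _ _ (_ | _ | _ | _) <;> simp [DegOne.incl_smul, DegOne.incl_op_smul]⟩

theorem tensorToAlgebra_ofV (v : DegOne 𝒜) :
    tensorToAlgebra 𝒜 (BimoduleTensorAlgebra.ofV k (DegZero 𝒜) (DegOne 𝒜) v) =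
      DegOne.incl 𝒜 v := by
  simp [tensorToAlgebra, BimoduleTensorAlgebra.ofV]

theorem tensorToAlgebra_ofSquare (x : TensorSquare k (DegZero 𝒜) (DegOne 𝒜)) :
    tensorToAlgebra 𝒜 (BimoduleTensorAlgebra.ofSquare k (DegZero 𝒜) (DegOne 𝒜) x) =
      squareToAlgebra 𝒜 x := by
  have : (tensorToAlgebra 𝒜).toLinearMap ∘ₗ
      BimoduleTensorAlgebra.ofSquare k (DegZero 𝒜) (DegOne 𝒜) = squareToAlgebra 𝒜 := by
    apply Submodule.linearMap_qext
    ext v w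
    simp [BimoduleTensorAlgebra.ofSquare, squareToAlgebra, TensorSquare.lift, tensorToAlgebra_ofV]
  exact LinearMap.congr_fun this x

/-- The canonical homomorphism `T_{A₀}(A₁) / (W) → A`. -/
noncomputable def quadraticToAlgebra :
    QuadraticQuotient k (DegZero 𝒜) (DegOne 𝒜) (quadraticRelations 𝒜) →ₐ[k] A :=
  RingQuot.liftAlgHom k ⟨tensorToAlgebra 𝒜, by
    rintro _ _ ⟨x, hx⟩
    rw [tensorToAlgebra_ofSquare, map_zero]
    exact hx⟩

/-- `A` is a quadratic algebra: it is the direct sum of its homogeneous pieces, `A₀` is semisimple,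
and the canonical homomorphism `T_{A₀}(A₁) / (W) → A` is an isomorphism, that is, `A` is generated
by `A₁` over `A₀` with relations of degree two. -/
def IsQuadraticAlgebra : Prop :=
  DirectSum.IsInternal 𝒜 ∧ IsSemisimpleRing (DegZero 𝒜) ∧
    Function.Bijective (quadraticToAlgebra 𝒜)

/-- The orthogonal `W^⊥ ⊆ A₁^* ⊗_{A₀} A₁^*` of the space of quadratic relations. -/
noncomputable def dualRelations :
    Submodule k (TensorSquare k (DegZero 𝒜) (BimoduleDual (DegZero 𝒜) (DegOne 𝒜))) where
  carrier := {ξ | ∀ x ∈ quadraticRelations 𝒜,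
    BimoduleDual.pairing k (DegZero 𝒜) (DegOne 𝒜) ξ x = 0}
  add_mem' {ξ η} hξ hη x hx := by
    rw [map_add, LinearMap.add_apply, hξ x hx, hη x hx, add_zero]
  zero_mem' x _ := by simp
  smul_mem' c ξ hξ x hx := by
    rw [map_smul, LinearMap.smul_apply, hξ x hx, smul_zero]

/-- The quadratic dual `A^! = T_{A₀}(A₁^*) / (W^⊥)`. -/
abbrev QuadraticDual : Type _ :=
  QuadraticQuotient k (DegZero 𝒜) (BimoduleDual (DegZero 𝒜) (DegOne 𝒜)) (dualRelations 𝒜)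

/-- The homogeneous pieces of the quadratic dual. -/
noncomputable abbrev QuadraticDual.grading : ℕ → Submodule k (QuadraticDual 𝒜) :=
  QuadraticQuotient.grading k (DegZero 𝒜) (BimoduleDual (DegZero 𝒜) (DegOne 𝒜)) (dualRelations 𝒜)

end Quadratic

/-! ## Sign vectors, orthogonality and composition -/

/-! The variables `u_i` can be eliminated. By Minty's lemma every feasible tope `a` has a vertex, a
cocircuit with `g` positive that is conformal to `a`. By genericity its zero set is a basis of `M`,
and each coordinate in this basis can be reversed in `a` without losing feasibility
(`IsFeasible.exists_cube`). Since `U` projects isomorphically to these coordinates, each `e_a u_i`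
is a combination of loops `p(a,c) p(c,a)`. The two ends of an arrow have a common vertex
(`IsFeasible.exists_cube_of_negAt`), and the square relations then make the elements so defined
commute with the arrows. Hence `A(P,U)` is presented by vertices and arrows alone: unbounded
vertices vanish, squares commute, and at each `a` one has `∑ c_i p(a,a_i) p(a_i,a) = 0` for all `c ∈
U^⊥` supported on feasible neighbours `a_i`. This is the notion of `Realization`, with universal
property `Realization.lift`. The relations are homogeneous, and of degree two over `A₀` and `A₁`, so
there are realizations in the direct sum of the homogeneous pieces and in `T_{A₀}(A₁)/(W)`;
quadraticity follows.

For the duality, Farkas' lemma (`IsGeneric.feasible_iff`) says that feasibility for one program is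
boundedness for the other, so both have the same bounded feasible topes. Moreover a neighbour of a
bounded feasible tope is feasible or bounded (`Bdd.negAt_feasible_or`). The dual basis element of an
arrow from `a` to `b` is an arrow from `b` to `a`, and it remains to compare the relations of degree
two.

For closed paths at `a`, let `F` be the set of feasible neighbours and `B ⊆ F` that of the bounded
ones. The relations of `A(P,U)` are the restrictions to `B` of the `c ∈ U^⊥` supported on `F`. Their
orthogonal complement consists of the restrictions to `B` of the `u ∈ U` vanishing on `F \ B`
(`exists_mem_eq_on`). By the dichotomy for neighbours these are the `u` supported on the neighbours
feasible for the dual program, as required.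

From `a` to a tope `b` differing in two coordinates there are at most two paths. If both middle
vertices are bounded and feasible, the square commutes, so the orthogonal relation is
anticommutativity, which the signs `edgeSign` turn into commutativity. If only one is, the other is
either feasible and unbounded, which kills the path in `A(P,U)` and imposes nothing on the dual
side, or bounded and infeasible, with the roles exchanged.

One homomorphism needs an upper bound for `W`: representations by block matrices give functionals on
`A(P,U)` with prescribed values on products of two arrows (`exists_pathFunctional`). Its inverse
only needs the elements of `W^⊥` to be tested against the known relations (`pathCoeff_relation`). -/

namespace SignVec

variable {α : Type*}

theorem isFace_iff {Z Z' : SignVec α} : Z.IsFace Z' ↔ ∀ i, Z i = 0 ∨ Z i = Z' i := by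
  unfold IsFace comp
  rw [funext_iff]
  refine forall_congr' fun i => ?_
  by_cases h : Z i = 0 <;> simp [h]

theorem comp_assoc (X Y Z : SignVec α) : (X.comp Y).comp Z = X.comp (Y.comp Z) := by
  funext i
  by_cases h : X i = 0 <;> simp [comp, h]

theorem comp_zero (X : SignVec α) : X.comp 0 = X := by
  funext i
  by_cases h : X i = 0 <;> simp [comp, h]

/-- Two orthogonal sign vectors with no common element of opposite signs have disjoint supports. -/
theorem Orthogonal.mul_eq_zero {X Y : SignVec α} (h : X.Orthogonal Y)
    (hne : ∀ i, X i * Y i ≠ -1) (i : α) : X i * Y i = 0 := by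
  rcases h with h | ⟨-, j, hj⟩
  · exact h i
  · exact absurd hj (hne j)

theorem orthogonal_zero (X : SignVec α) : X.Orthogonal 0 := Or.inl fun i => by simp

/-- If `X` and `Y` have disjoint supports, then `X` only sees `Z` in `Y ∘ Z`; otherwise the two
witnesses for `Y` lie in its support and survive the composition. -/
theorem Orthogonal.comp {X Y Z : SignVec α} (hY : X.Orthogonal Y) (hZ : X.Orthogonal Z) :
    X.Orthogonal (Y.comp Z) := by
  rcases hY with hY | ⟨⟨i, hi⟩, j, hj⟩
  · have key : ∀ i, X i * (Y.comp Z) i = X i * Z i := by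
      intro i
      by_cases h : Y i = 0
      · simp [SignVec.comp, h]
      · have hX : X i = 0 := (_root_.mul_eq_zero.1 (hY i)).resolve_right h
        simp [hX]
    unfold Orthogonal at *
    simpa only [key] using hZ
  · refine Or.inr ⟨⟨i, ?_⟩, j, ?_⟩
    · have : Y i ≠ 0 := fun h => by simp [h] at hi
      simpa [SignVec.comp, this] using hi
    · have : Y j ≠ 0 := fun h => by simp [h] at hj
      simpa [SignVec.comp, this] using hj

end SignVec

/-! ### Covectors and Minty's coloring lemma. -/

namespace OrientedMatroid

variable {α : Type*}

theorem IsCovector.orthogonal_of_forall {M : OrientedMatroid α} {X Z : SignVec α}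
    (hZ : M.IsCovector Z) (h : ∀ Y ∈ M.cocircuits, X.Orthogonal Y) : X.Orthogonal Z := by
  induction hZ with
  | zero => exact X.orthogonal_zero
  | comp Y Z hY _ ih => exact (h Y hY).comp ih

theorem IsCovector.orthogonal {M : OrientedMatroid α} {X Z : SignVec α}
    (hZ : M.IsCovector Z) (hX : M.dual.IsCovector X) : X.Orthogonal Z :=
  hZ.orthogonal_of_forall fun Y hY =>
    (hX.orthogonal_of_forall fun X hX => (M.orthogonal X hX Y hY).symm).symm

theorem IsCovector.comp_covector {M : OrientedMatroid α} {X Z : SignVec α}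
    (hX : M.IsCovector X) (hZ : M.IsCovector Z) : M.IsCovector (X.comp Z) := by
  induction hX with
  | zero =>
    convert hZ using 1
    funext i
    simp [SignVec.comp]
  | comp Y X hY _ ih =>
    rw [SignVec.comp_assoc]
    exact .comp Y _ hY ih

theorem isCovector_of_mem_cocircuits {M : OrientedMatroid α} {Y : SignVec α}
    (hY : Y ∈ M.cocircuits) : M.IsCovector Y := by
  have := IsCovector.comp Y 0 hY .zero
  rwa [SignVec.comp_zero] at this

theorem cocircuit_support_subset_ground {M : OrientedMatroid α} {Y : SignVec α}
    (hY : Y ∈ M.cocircuits) : Function.support Y ⊆ M.matroid.E := by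
  have := (M.cocircuits_signature.isCircuit_support Y hY).subset_ground
  rwa [Matroid.dual_ground] at this

theorem IsCovector.apply_eq_zero {M : OrientedMatroid α} {Z : SignVec α}
    (hZ : M.IsCovector Z) {i : α} (hi : i ∉ M.matroid.E) : Z i = 0 := by
  induction hZ with
  | zero => rfl
  | comp Y Z hY _ ih =>
    have : Y i = 0 := by
      by_contra h
      exact hi (cocircuit_support_subset_ground hY h)
    simp [SignVec.comp, this, ih]

/-- The cocircuits of a signature can be normalized to have a given sign at a given element. -/
theorem exists_mem_apply_eq {M : Matroid α} {C : Set (SignVec α)}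
    (h : IsCircuitSignature M C) {K : Set α} (hK : M.IsCircuit K) {e : α} (he : e ∈ K)
    {s : SignType} (hs : s ≠ 0) : ∃ X ∈ C, Function.support X = K ∧ X e = s := by
  obtain ⟨X, hX, rfl⟩ := h.exists_support_eq K hK
  have he' : X e ≠ 0 := he
  have : ∀ a b : SignType, a ≠ 0 → b ≠ 0 → a = b ∨ -a = b := by decide
  rcases this _ _ he' hs with h1 | h1
  · exact ⟨X, hX, rfl, h1⟩
  · exact ⟨-X, h.neg_mem X hX, SignVec.support_neg X, h1⟩

/-- Unsigned case of Minty's lemma: in the contraction of `B` the element `e` is either a loop,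
which lifts to a circuit inside `B ∪ {e}`, or independent, and then lies on a cocircuit avoiding
`B`. -/
theorem exists_circuit_or_cocircuit (M : OrientedMatroid α) {e : α} (he : e ∈ M.matroid.E)
    {B : Set α} (heB : e ∉ B) {s : SignType} (hs : s ≠ 0) :
    (∃ X ∈ M.circuits, X e = s ∧ ∀ i, i ∉ B → i ≠ e → X i = 0) ∨
    (∃ Y ∈ M.cocircuits, Y e = s ∧ ∀ i ∈ B, Y i = 0) := by
  by_cases hI : (M.matroid.contract B).Indep {e}
  · right
    obtain ⟨K, hK, hKe⟩ := hI.exists_isCocircuit_inter_eq_mem (e := e) rfl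
    obtain ⟨hK, hKB⟩ := Matroid.contract_isCocircuit_iff.1 hK
    have heK : e ∈ K := by
      have : e ∈ K ∩ {e} := by rw [hKe]; rfl
      exact this.1
    obtain ⟨Y, hY, rfl, hYe⟩ := exists_mem_apply_eq M.cocircuits_signature hK heK hs
    refine ⟨Y, hY, hYe, fun i hi => ?_⟩
    by_contra hne
    exact Set.disjoint_left.1 hKB hne hi
  · left
    have hE : {e} ⊆ (M.matroid.contract B).E := by
      rintro _ rfl
      exact ⟨he, heB⟩
    have hdep : (M.matroid.contract B).Dep {e} := ⟨hI, hE⟩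
    obtain ⟨K', hK'e, hK'⟩ := hdep.exists_isCircuit_subset
    have : K' = {e} := (Set.subset_singleton_iff_eq.1 hK'e).resolve_left hK'.nonempty.ne_empty
    subst this
    obtain ⟨K, hK, h1, h2⟩ := hK'.exists_subset_isCircuit_of_contract
    obtain ⟨X, hX, rfl, hXe⟩ :=
      exists_mem_apply_eq M.circuits_signature hK (h1 rfl) hs
    refine ⟨X, hX, hXe, fun i hiB hie => ?_⟩
    by_contra hne
    rcases h2 hne with h | h
    · exact hie h
    · exact hiB h

/-- Minty's coloring lemma for oriented matroids. -/
theorem painting (M : OrientedMatroid α) {σ : SignVec α} {e : α} (he : e ∈ M.matroid.E)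
    (hσe : σ e ≠ 0) (D : Finset α) : ∀ B : Set α, e ∉ B → e ∉ D → (∀ i ∈ D, σ i ≠ 0) →
    (∀ i ∈ D, i ∉ B) →
    (∃ X ∈ M.circuits, X e = σ e ∧ (∀ i ∈ D, X i = 0 ∨ X i = σ i) ∧
      ∀ i, i ∉ D → i ∉ B → i ≠ e → X i = 0) ∨
    (∃ Y ∈ M.cocircuits, Y e = σ e ∧ (∀ i ∈ D, Y i = 0 ∨ Y i = σ i) ∧ ∀ i ∈ B, Y i = 0) := by
  classical
  induction D using Finset.induction_on with
  | empty =>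
    intro B heB _ _ _
    rcases M.exists_circuit_or_cocircuit he heB hσe with ⟨X, hX, h1, h2⟩ | ⟨Y, hY, h1, h2⟩
    · exact Or.inl ⟨X, hX, h1, by simp, fun i _ => h2 i⟩
    · exact Or.inr ⟨Y, hY, h1, by simp, h2⟩
  | insert x D hx ih =>
    intro B heB heD hσ hDB
    have hxB : x ∉ B := hDB x (Finset.mem_insert_self _ _)
    have hex : e ≠ x := fun h => heD (h ▸ Finset.mem_insert_self _ _)
    have heD' : e ∉ D := fun h => heD (Finset.mem_insert_of_mem h)
    have hσ' : ∀ i ∈ D, σ i ≠ 0 := fun i hi => hσ i (Finset.mem_insert_of_mem hi)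
    have hσx : σ x ≠ 0 := hσ x (Finset.mem_insert_self _ _)
    -- Elements of `B` are free for the circuit and zero for the cocircuit; elements outside `D`,
    -- `B` and `e` are zero for the circuit and free for the cocircuit. The induction hypothesis is
    -- used with `x` on either side.
    have h1 := ih (insert x B) (by simp [heB, hex]) heD' hσ' (by
      intro i hi hiB
      rcases hiB with rfl | hiB
      · exact hx hi
      · exact hDB i (Finset.mem_insert_of_mem hi) hiB)
    have h2 := ih B heB heD' hσ' (fun i hi => hDB i (Finset.mem_insert_of_mem hi))
    rcases h1 with ⟨X, hX, hXe, hXD, hX0⟩ | ⟨Y, hY, hYe, hYD, hY0⟩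
    swap
    · refine Or.inr ⟨Y, hY, hYe, ?_, fun i hi => hY0 i (Or.inr hi)⟩
      intro i hi
      rcases Finset.mem_insert.1 hi with rfl | hi
      · exact Or.inl (hY0 _ (Or.inl rfl))
      · exact hYD i hi
    rcases h2 with ⟨X', hX', hXe', hXD', hX0'⟩ | ⟨Y, hY, hYe, hYD, hY0⟩
    · refine Or.inl ⟨X', hX', hXe', ?_, fun i hi => hX0' i fun h => hi (Finset.mem_insert_of_mem h)⟩
      intro i hi
      rcases Finset.mem_insert.1 hi with rfl | hi
      · exact Or.inl (hX0' _ hx hxB hex.symm)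
      · exact hXD' i hi
    by_cases hXx : X x = 0 ∨ X x = σ x
    · refine Or.inl ⟨X, hX, hXe, ?_, ?_⟩
      · intro i hi
        rcases Finset.mem_insert.1 hi with rfl | hi
        · exact hXx
        · exact hXD i hi
      · intro i hi hiB hie
        rw [Finset.mem_insert, not_or] at hi
        exact hX0 i hi.2 (by simp [hi.1, hiB]) hie
    by_cases hYx : Y x = 0 ∨ Y x = σ x
    · refine Or.inr ⟨Y, hY, hYe, ?_, hY0⟩
      intro i hi
      rcases Finset.mem_insert.1 hi with rfl | hi
      · exact hYx
      · exact hYD i hi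
    -- Both `X` and `Y` have the sign opposite to `σ x` at `x`. So their product is nowhere `-1` but
    -- nonzero at `e`, against orthogonality.
    exfalso
    have sq : ∀ a b s : SignType, s ≠ 0 → ¬ (a = 0 ∨ a = s) → ¬ (b = 0 ∨ b = s) → a * b ≠ -1 := by
      decide
    have sq' : ∀ a b s : SignType, (a = 0 ∨ a = s) → (b = 0 ∨ b = s) → a * b ≠ -1 := by
      decide
    have := (M.orthogonal X hX Y hY).mul_eq_zero (by
      intro i
      by_cases hie : i = e
      · subst hie
        exact sq' _ _ _ (Or.inr hXe) (Or.inr hYe)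
      by_cases hix : i = x
      · subst hix
        exact sq _ _ _ hσx hXx hYx
      by_cases hiD : i ∈ D
      · exact sq' _ _ _ (hXD i hiD) (hYD i hiD)
      by_cases hiB : i ∈ B
      · rw [hY0 i hiB, mul_zero]; decide
      · rw [hX0 i hiD (by simp [hix, hiB]) hie, zero_mul]; decide) e
    rw [hXe, hYe] at this
    exact mul_ne_zero hσe hσe this

/-- The signs of a covector on an independent set can be prescribed. -/
theorem exists_covector_eq_on_indep (M : OrientedMatroid α) {I : Set α} (hI : M.matroid.Indep I)
    (hfin : I.Finite) (σ : SignVec α) : ∃ X, M.IsCovector X ∧ ∀ i ∈ I, X i = σ i := by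
  suffices H : ∀ J : Set α, J.Finite → J ⊆ I →
      ∃ X, M.IsCovector X ∧ (∀ i ∈ J, X i = σ i) ∧ ∀ i ∈ I, i ∉ J → X i = 0 by
    obtain ⟨X, hX, h, -⟩ := H I hfin subset_rfl
    exact ⟨X, hX, h⟩
  intro J hJ
  induction J, hJ using Set.Finite.induction_on with
  | empty => exact fun _ => ⟨0, .zero, by simp, by simp⟩
  | @insert x J hx _ ih =>
    intro hJI
    obtain ⟨X, hX, h1, h2⟩ := ih ((Set.subset_insert _ _).trans hJI)
    by_cases hs : σ x = 0
    · refine ⟨X, hX, ?_, fun i hi hiJ => h2 i hi fun h => hiJ (Or.inr h)⟩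
      rintro i (rfl | hi)
      · rw [hs, h2 i (hJI (Or.inl rfl)) hx]
      · exact h1 i hi
    -- A cocircuit meeting `I` only in `x`: composing with it on the left sets the sign at `x` and
    -- changes nothing else on `I`.
    obtain ⟨K, hK, hKI⟩ := hI.exists_isCocircuit_inter_eq_mem (hJI (Or.inl rfl))
    have hxK : x ∈ K := by
      have : x ∈ K ∩ I := by rw [hKI]; rfl
      exact this.1
    obtain ⟨Y, hY, rfl, hYx⟩ := exists_mem_apply_eq M.cocircuits_signature hK hxK hs
    have hY0 : ∀ i ∈ I, i ≠ x → Y i = 0 := by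
      intro i hi hix
      by_contra hne
      have : i ∈ Function.support Y ∩ I := ⟨hne, hi⟩
      rw [hKI] at this
      exact hix this
    refine ⟨Y.comp X, .comp Y X hY hX, ?_, ?_⟩
    · rintro i (rfl | hi)
      · simp [SignVec.comp, hYx, hs]
      · have hix : i ≠ x := fun h => hx (h ▸ hi)
        simp [SignVec.comp, hY0 i (hJI (Or.inr hi)) hix, h1 i hi]
    · intro i hi hiJ
      have hix : i ≠ x := fun h => hiJ (Or.inl h)
      simp [SignVec.comp, hY0 i hi hix, h2 i hi fun h => hiJ (Or.inr h)]

end OrientedMatroid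

/-! ### Duality of programs. -/

namespace OMProgram

variable {E : Type*} (P : OMProgram E)

theorem dual_dual : P.dual.dual = P := by
  obtain ⟨⟨M, C, D, _, _, _⟩, g, f, _, _, _, _⟩ := P
  simp [dual, OrientedMatroid.dual]

theorem mem_N_ground {x : E ⊕ Bool} : x ∈ P.N.matroid.E ↔ x ≠ Sum.inr P.f := by
  change x ∈ P.Mt.matroid.E \ {Sum.inr P.f} ↔ _
  simp [P.ground_eq]

theorem inr_eq (b : Bool) : b = P.g ∨ b = P.f := by
  have := P.g_ne_f
  revert this
  cases b <;> cases P.g <;> cases P.f <;> simp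

theorem inr_g_ne_f : (Sum.inr P.g : E ⊕ Bool) ≠ Sum.inr P.f := fun h => P.g_ne_f (Sum.inr.inj h)

theorem dual_M_matroid : P.dual.M.matroid = P.M.matroid.dual := by
  change (P.Mt.matroid.dual.delete {Sum.inr P.g}).contract {Sum.inr P.f} =
    ((P.Mt.matroid.delete {Sum.inr P.f}).contract {Sum.inr P.g}).dual
  rw [Matroid.dual_delete_contract, Matroid.contract_delete_comm]
  simpa using P.g_ne_f.symm

theorem M_ground : P.M.matroid.E = Set.range Sum.inl := by
  change (P.Mt.matroid.E \ {Sum.inr P.f}) \ {Sum.inr P.g} = _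
  ext (x | b)
  · simp [P.ground_eq]
  · rcases P.inr_eq b with rfl | rfl <;> simp [P.ground_eq]

theorem eRank_add_eRank_dual :
    P.M.matroid.eRank + P.dual.M.matroid.eRank = ENat.card E := by
  rw [dual_M_matroid, Matroid.eRank_add_eRank_dual, M_ground, ← Set.image_univ,
    Sum.inl_injective.encard_image, Set.encard_univ]

/-- Cocircuits of `P.dual.N` are by definition circuits of `P.contractG`, and conversely. As the
ranks of `M` and its dual add up to `n`, the two genericity conditions are exchanged; finiteness of
`E` allows the cancellation in `ℕ∞`. -/
theorem IsGeneric.dual [Finite E] {P : OMProgram E} (hP : P.IsGeneric) : P.dual.IsGeneric := by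
  have hadd := P.eRank_add_eRank_dual
  have hfin : ENat.card E ≠ ⊤ := by
    rw [← lt_top_iff_ne_top, ENat.card_lt_top]
    infer_instance
  constructor
  · intro Y hY hlt
    refine hP.2 Y hY ?_
    change _ < (P.dual.N.zeroSet Y).encard + _
    rw [← hadd, add_comm]
    refine (ENat.add_lt_add_iff_right ?_).2 hlt
    intro h
    rw [h, top_add] at hadd
    exact hfin hadd.symm
  · intro X hX hlt
    refine hP.1 X hX ?_
    change _ < (P.dual.contractG.zeroSet X).encard
    rw [← hadd] at hlt
    exact lt_of_add_lt_add_right hlt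

end OMProgram

/-! ### Reversing one sign. -/

namespace SignVec

variable {E : Type*}

open Classical in
/-- The sign vector obtained from `a` by reversing the sign at `i`. -/
noncomputable def negAt (i : E) (a : SignVec E) : SignVec E := Function.update a i (-a i)

theorem negAt_same (i : E) (a : SignVec E) : negAt i a i = -a i := by simp [negAt]

theorem negAt_of_ne {i j : E} (h : j ≠ i) (a : SignVec E) : negAt i a j = a j := by simp [negAt, h]

theorem negAt_negAt (i : E) (a : SignVec E) : negAt i (negAt i a) = a := by
  funext j
  by_cases h : j = i
  · subst h; simp [negAt_same]
  · simp [negAt_of_ne h]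

theorem negAt_comm (i j : E) (a : SignVec E) : negAt i (negAt j a) = negAt j (negAt i a) := by
  by_cases hij : i = j
  · rw [hij]
  funext l
  by_cases h : l = i
  · subst h; simp [negAt_same, negAt_of_ne hij]
  · by_cases h' : l = j
    · subst h'; simp [negAt_same, negAt_of_ne h]
    · simp [negAt_of_ne h, negAt_of_ne h']

theorem negAt_ne_zero {a : SignVec E} (ha : ∀ i, a i ≠ 0) (j i : E) : negAt j a i ≠ 0 := by
  have hneg : ∀ s : SignType, s ≠ 0 → -s ≠ 0 := by decide
  by_cases h : i = j
  · subst h; rw [negAt_same]; exact hneg _ (ha _)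
  · rw [negAt_of_ne h]; exact ha i

theorem neg_ne_self {s : SignType} (hs : s ≠ 0) : -s ≠ s := by
  revert s; decide

theorem negAt_apply_ne_iff {a : SignVec E} (ha : ∀ i, a i ≠ 0) {i j : E} :
    negAt i a j ≠ a j ↔ j = i := by
  constructor
  · intro h
    by_contra hne
    exact h (negAt_of_ne hne a)
  · rintro rfl
    rw [negAt_same]
    exact neg_ne_self (ha _)

theorem negAt_injective {a : SignVec E} (ha : ∀ i, a i ≠ 0) :
    Function.Injective fun i => negAt i a := by
  intro i j h
  have : negAt i a i ≠ a i := (negAt_apply_ne_iff ha).2 rfl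
  rw [show negAt i a = negAt j a from h] at this
  exact (negAt_apply_ne_iff ha).1 this

theorem negAt_negAt_ne_self {a : SignVec E} (ha : ∀ i, a i ≠ 0) {i j : E} (hij : i ≠ j) :
    negAt i (negAt j a) ≠ a := fun h =>
  hij (negAt_injective ha (a := a) (show negAt i a = negAt j a by
    conv_lhs => rw [← h]
    rw [negAt_negAt]))

end SignVec

open SignVec

/-! ### Feasible and bounded sign vectors: vertices, Farkas' lemma and neighbours. -/

namespace OMProgram

variable {E : Type*} (P : OMProgram E)

/-- The bounded feasible sign vectors. -/
def Bdd (a : SignVec E) : Prop := P.IsFeasible a ∧ ¬ P.IsUnbounded a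

variable {P}

theorem DifferAt.adj {a b : P.Feas} {i : E} (h : P.DifferAt a b i) : P.Adj a b := ⟨i, h⟩

theorem N_circuit_apply_f {X : SignVec (E ⊕ Bool)} (hX : X ∈ P.N.circuits) :
    X (Sum.inr P.f) = 0 := by
  by_contra h
  exact Set.disjoint_left.1 hX.2 h rfl

theorem N_covector_apply_f {X : SignVec (E ⊕ Bool)} (hX : P.N.IsCovector X) :
    X (Sum.inr P.f) = 0 := hX.apply_eq_zero (by simp [P.mem_N_ground])

theorem isTope_of_ne_zero {T : SignVec (E ⊕ Bool)} (hT : P.N.IsCovector T)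
    (hg : T (Sum.inr P.g) ≠ 0) (h : ∀ i, T (Sum.inl i) ≠ 0) : P.N.IsTope T := by
  refine ⟨hT, fun T' hT' hface => ?_⟩
  rw [SignVec.isFace_iff] at hface
  funext x
  rcases x with i | b
  · exact ((hface (Sum.inl i)).resolve_left (h i)).symm
  · rcases P.inr_eq b with rfl | rfl
    · exact ((hface _).resolve_left hg).symm
    · rw [N_covector_apply_f hT, N_covector_apply_f hT']

/-- The zero set of a vertex of a generic program is a basis. -/
theorem IsGeneric.isBase_of_cocircuit [Finite E] (hP : P.IsGeneric) {Y : SignVec (E ⊕ Bool)}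
    (hY : Y ∈ P.N.cocircuits) (hg : Y (Sum.inr P.g) ≠ 0) :
    P.M.matroid.IsBase (Sum.inl '' {i | Y (Sum.inl i) = 0}) := by
  have hle : (P.N.zeroSet Y).encard ≤ P.M.matroid.eRank := by
    by_contra h
    exact hg (hP.1 Y hY (not_le.1 h))
  have hz : P.N.zeroSet Y = Sum.inl '' {i | Y (Sum.inl i) = 0} := by
    ext (i | b)
    · simp [OrientedMatroid.zeroSet, P.mem_N_ground]
    · rcases P.inr_eq b with rfl | rfl <;>
        simp [OrientedMatroid.zeroSet, P.mem_N_ground, hg]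
  rw [← hz]
  have hK : P.N.matroid.dual.IsCircuit (Function.support Y) :=
    P.N.cocircuits_signature.isCircuit_support Y hY
  -- A cocircuit minus an element is coindependent, so the zero set of `Y` contains a basis of `M`;
  -- by genericity it is no larger than one.
  have hco : P.M.matroid.Coindep (Function.support Y \ {Sum.inr P.g}) := by
    change (P.N.matroid.contract {Sum.inr P.g}).dual.Indep _
    rw [Matroid.dual_contract, Matroid.delete_indep_iff]
    exact ⟨hK.sdiff_singleton_indep hg, Set.disjoint_sdiff_left⟩
  obtain ⟨B, hB, hBsub⟩ := hco.exists_isBase_subset_compl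
  have hBz : B ⊆ P.N.zeroSet Y := by
    intro x hx
    obtain ⟨hxE, hxn⟩ := hBsub hx
    have hxE' : x ∈ P.N.matroid.E \ {Sum.inr P.g} := hxE
    refine ⟨hxE'.1, fun hs => hxn ⟨hs, hxE'.2⟩⟩
  have : B = P.N.zeroSet Y :=
    (Set.toFinite B).eq_of_subset_of_encard_le hBz (hle.trans hB.encard_eq_eRank.ge)
  exact this ▸ hB

/-- The zero set of `Y` is independent, so some covector has the signs of `a` there. Composing `Y`
with it gives a tope: all sign patterns around a vertex are feasible. -/
theorem IsGeneric.feasible_of_vertex [Finite E] (hP : P.IsGeneric) {Y : SignVec (E ⊕ Bool)}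
    (hY : Y ∈ P.N.cocircuits) (hg : Y (Sum.inr P.g) = 1) {a : SignVec E} (ha : ∀ i, a i ≠ 0)
    (hYa : ∀ i, Y (Sum.inl i) = 0 ∨ Y (Sum.inl i) = a i) : P.IsFeasible a := by
  have hB := hP.isBase_of_cocircuit hY (by rw [hg]; decide)
  obtain ⟨X, hX, hXa⟩ := P.N.exists_covector_eq_on_indep hB.indep.of_contract (Set.toFinite _)
    (Sum.elim a fun _ => 1)
  have hT : ∀ i, (Y.comp X) (Sum.inl i) = a i := by
    intro i
    by_cases h : Y (Sum.inl i) = 0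
    · simpa [SignVec.comp, h] using hXa (Sum.inl i) ⟨i, h, rfl⟩
    · simpa [SignVec.comp, h] using (hYa i).resolve_left h
  have hTg : (Y.comp X) (Sum.inr P.g) = 1 := by simp [SignVec.comp, hg]
  refine ⟨Y.comp X, isTope_of_ne_zero (.comp Y X hY hX) ?_ ?_, hTg, hT⟩
  · rw [hTg]; decide
  · intro i; rw [hT i]; exact ha i

theorem g_indep : P.N.matroid.Indep {Sum.inr P.g} := by
  refine Matroid.delete_indep_iff.2 ⟨?_, by simpa using P.g_ne_f⟩
  rw [Matroid.indep_iff_forall_subset_not_isCircuit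
    (by rw [P.ground_eq]; exact Set.subset_univ _)]
  intro K hKg hK
  obtain ⟨X, hX, rfl⟩ := P.Mt.circuits_signature.exists_support_eq K hK
  exact P.g_not_loop X hX ((Set.subset_singleton_iff_eq.1 hKg).resolve_left hK.nonempty.ne_empty)

/-- No element of `E` is a loop of `N`: since `g` is not a loop there is a cocircuit `Y` with `Y(g)
≠ 0`, and either `Y` is nonzero at `i` or `i` lies in its independent zero set. A tope vanishing at
`i` could therefore be enlarged. -/
theorem IsFeasible.ne_zero [Finite E] (hP : P.IsGeneric) {a : SignVec E} (ha : P.IsFeasible a)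
    (i : E) : a i ≠ 0 := by
  obtain ⟨T, hT, -, hTa⟩ := ha
  have hcov : ∃ Z, P.N.IsCovector Z ∧ Z (Sum.inl i) ≠ 0 := by
    obtain ⟨K, hK, hKg⟩ := (g_indep (P := P)).exists_isCocircuit_inter_eq_mem rfl
    obtain ⟨Y, hY, rfl⟩ := P.N.cocircuits_signature.exists_support_eq K hK
    have hYg : Y (Sum.inr P.g) ≠ 0 := by
      have : (Sum.inr P.g : E ⊕ Bool) ∈ Function.support Y ∩ {Sum.inr P.g} := by rw [hKg]; rfl
      exact this.1
    by_cases h : Y (Sum.inl i) = 0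
    · obtain ⟨X, hX, hX1⟩ := P.N.exists_covector_eq_on_indep
        (hP.isBase_of_cocircuit hY hYg).indep.of_contract (Set.toFinite _) (fun _ => 1)
      exact ⟨X, hX, by rw [hX1 _ ⟨i, h, rfl⟩]; decide⟩
    · exact ⟨Y, OrientedMatroid.isCovector_of_mem_cocircuits hY, h⟩
  obtain ⟨Z, hZ, hZi⟩ := hcov
  rw [← hTa i]
  intro h0
  have := hT.2 _ (hT.1.comp_covector hZ) (by
    rw [SignVec.IsFace, ← SignVec.comp_assoc]
    congr 1
    funext x
    by_cases h : T x = 0 <;> simp [SignVec.comp, h])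
  have := congrFun this (Sum.inl i)
  simp only [SignVec.comp, h0, if_true] at this
  exact hZi this

theorem mul_ne_neg_one {a b s : SignType} (ha : a = 0 ∨ a = s) (hb : b = 0 ∨ b = s) :
    a * b ≠ -1 := by
  revert a b s; decide

/-- The tope and the circuit would agree at `g` and nowhere have opposite signs, against
orthogonality. -/
theorem IsFeasible.not_circuit {a : SignVec E} (ha : P.IsFeasible a) {X : SignVec (E ⊕ Bool)}
    (hX : X ∈ P.N.circuits) (hg : X (Sum.inr P.g) = 1)
    (hXa : ∀ i, X (Sum.inl i) = 0 ∨ X (Sum.inl i) = a i) : False := by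
  obtain ⟨T, hT, hTg, hTa⟩ := ha
  have := (hT.1.orthogonal_of_forall fun Y hY => P.N.orthogonal X hX Y hY).mul_eq_zero (by
    rintro (i | b)
    · exact mul_ne_neg_one (hXa i) (Or.inr (hTa i))
    · rcases P.inr_eq b with rfl | rfl
      · rw [hg, hTg]; decide
      · rw [N_circuit_apply_f hX, zero_mul]; decide) (Sum.inr P.g)
  rw [hg, hTg] at this
  exact absurd this (by decide)

/-- Minty's lemma at `e = g`, with the coordinates in `S` put on the side where circuits are free
and cocircuits vanish. For `S = ∅` it provides a vertex of a tope, for `S = {j}` a vertex on its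
wall in direction `j`. -/
theorem exists_circuit_or_vertex [Finite E] {a : SignVec E} (ha : ∀ i, a i ≠ 0) (S : Set E) :
    (∃ X ∈ P.N.circuits, X (Sum.inr P.g) = 1 ∧
      ∀ i, i ∉ S → X (Sum.inl i) = 0 ∨ X (Sum.inl i) = a i) ∨
    (∃ Y ∈ P.N.cocircuits, Y (Sum.inr P.g) = 1 ∧
      (∀ i, i ∉ S → Y (Sum.inl i) = 0 ∨ Y (Sum.inl i) = a i) ∧
      ∀ i ∈ S, Y (Sum.inl i) = 0) := by
  have hD : ∀ x, x ∈ (Set.toFinite (Sum.inl '' Sᶜ : Set (E ⊕ Bool))).toFinset ↔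
      ∃ i, i ∉ S ∧ Sum.inl i = x := by
    intro x; simp
  have := P.N.painting (σ := Sum.elim a fun _ => 1) (e := Sum.inr P.g)
    (P.mem_N_ground.2 P.inr_g_ne_f) (by simp)
    (Set.toFinite (Sum.inl '' Sᶜ : Set (E ⊕ Bool))).toFinset (Sum.inl '' S) (by simp)
    (by rw [hD]; simp) (by intro x hx; obtain ⟨i, -, rfl⟩ := (hD x).1 hx; exact ha i)
    (by
      intro x hx
      obtain ⟨i, hi, rfl⟩ := (hD x).1 hx
      simpa using hi)
  rcases this with ⟨X, hX, hXg, hXD, -⟩ | ⟨Y, hY, hYg, hYD, hY0⟩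
  · exact Or.inl ⟨X, hX, hXg, fun i hi => hXD _ ((hD _).2 ⟨i, hi, rfl⟩)⟩
  · exact Or.inr ⟨Y, hY, hYg, fun i hi => hYD _ ((hD _).2 ⟨i, hi, rfl⟩),
      fun i hi => hY0 _ ⟨i, hi, rfl⟩⟩

/-- Farkas' lemma: the feasible sign vectors of a generic program are the bounded sign vectors of
the dual program. -/
theorem IsGeneric.feasible_iff [Finite E] (hP : P.IsGeneric) {a : SignVec E} :
    P.IsFeasible a ↔ (∀ i, a i ≠ 0) ∧ ¬ P.dual.IsUnbounded a := by
  constructor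
  · intro h
    refine ⟨h.ne_zero hP, ?_⟩
    rintro ⟨Z, hZ, hZf, hZg, hZa⟩
    obtain ⟨T, hT, hTg, hTa⟩ := h
    rw [SignVec.isFace_iff] at hZa
    -- Cocircuits of `N` are cocircuits of `Mt` with the entry at `f` erased, and this entry does
    -- not matter because `Z` vanishes at `f`.
    have horth : Z.Orthogonal T := hT.1.orthogonal_of_forall (by
      rintro _ ⟨Y, hY, rfl, -⟩
      refine ((OrientedMatroid.isCovector_of_mem_cocircuits hY).orthogonal
        hZ).away_of_disjoint ?_
      rw [Set.disjoint_singleton_right]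
      exact fun h => h hZf)
    have := horth.mul_eq_zero (by
      rintro (i | b)
      · exact mul_ne_neg_one (hZa i) (Or.inr (hTa i))
      · rcases P.inr_eq b with rfl | rfl
        · rw [show Z (Sum.inr P.g) = 1 from hZg, hTg]; decide
        · rw [show Z (Sum.inr P.f) = 0 from hZf, zero_mul]; decide) (Sum.inr P.g)
    rw [show Z (Sum.inr P.g) = 1 from hZg, hTg] at this
    exact absurd this (by decide)
  · rintro ⟨ha, hb⟩
    rcases exists_circuit_or_vertex (P := P) ha ∅ with ⟨X, hX, hXg, hXa⟩ | ⟨Y, hY, hYg, hYa, -⟩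
    -- A circuit of `N` is a circuit of `Mt` vanishing at `f`. With `X(g) = +` it is an increasing
    -- direction for the dual program, where `f` and `g` are exchanged.
    · refine absurd ⟨X, OrientedMatroid.isCovector_of_mem_cocircuits hX.1,
        N_circuit_apply_f hX, hXg, ?_⟩ hb
      rw [SignVec.isFace_iff]
      exact fun i => hXa i (by simp)
    · exact hP.feasible_of_vertex hY hYg ha fun i => hYa i (by simp)

theorem IsGeneric.dual_feasible_iff [Finite E] (hP : P.IsGeneric) {a : SignVec E} :
    P.dual.IsFeasible a ↔ (∀ i, a i ≠ 0) ∧ ¬ P.IsUnbounded a := by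
  rw [hP.dual.feasible_iff, dual_dual]

/-- Farkas' lemma for both programs exchanges the two conditions defining `Bdd`. Hence the two
algebras have the same surviving vertices. -/
theorem IsGeneric.dual_bdd_iff [Finite E] (hP : P.IsGeneric) {a : SignVec E} :
    P.dual.Bdd a ↔ P.Bdd a := by
  rw [Bdd, Bdd, hP.dual_feasible_iff, hP.feasible_iff]
  tauto

theorem Bdd.dual_feasible [Finite E] (hP : P.IsGeneric) {a : SignVec E} (ha : P.Bdd a) :
    P.dual.IsFeasible a := (hP.dual_bdd_iff.2 ha).1

theorem IsGeneric.bdd_iff [Finite E] (hP : P.IsGeneric) {a : SignVec E} :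
    P.Bdd a ↔ P.IsFeasible a ∧ P.dual.IsFeasible a := by
  constructor
  · exact fun h => ⟨h.1, h.dual_feasible hP⟩
  · exact fun h => ⟨h.1, (hP.dual_feasible_iff.1 h.2).2⟩

/-- A neighbour of a bounded feasible sign vector is feasible or bounded. -/
theorem Bdd.negAt_feasible_or [Finite E] (hP : P.IsGeneric) {a : SignVec E} (ha : P.Bdd a) (i : E) :
    P.IsFeasible (negAt i a) ∨ P.dual.IsFeasible (negAt i a) := by
  have hne := ha.1.ne_zero hP
  rw [hP.feasible_iff, hP.dual_feasible_iff]
  by_contra! hcon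
  obtain ⟨Z, hZ, hZf, hZg, hZa⟩ := hcon.1 (negAt_ne_zero hne i)
  obtain ⟨Z', hZ', hZg', hZf', hZa'⟩ := hcon.2 (negAt_ne_zero hne i)
  have h1 : ¬ SignVec.IsFace (fun i => Z (Sum.inl i)) a := fun h =>
    (hP.feasible_iff.1 ha.1).2 ⟨Z, hZ, hZf, hZg, h⟩
  have h2 : ¬ SignVec.IsFace (fun i => Z' (Sum.inl i)) a := fun h =>
    ha.2 ⟨Z', hZ', hZg', hZf', h⟩
  rw [SignVec.isFace_iff] at hZa hZa' h1 h2
  -- A vector conformal to `negAt i a` but not to `a` must be nonzero at `i`. Thus `Z` and `Z'`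
  -- agree there, while their product is nowhere `-1` and vanishes at `f` and `g`, against
  -- orthogonality of a covector and a covector of the dual.
  have key : ∀ V : SignVec E, (∀ j, V j = 0 ∨ V j = negAt i a j) → (¬ ∀ j, V j = 0 ∨ V j = a j) →
      V i = negAt i a i := by
    intro V hV hV'
    push Not at hV'
    obtain ⟨j, hj0, hja⟩ := hV'
    have hj := (hV j).resolve_left hj0
    rw [hj] at hja
    rw [negAt_apply_ne_iff hne] at hja
    exact hja ▸ hj
  have e1 := key _ hZa h1
  have e2 := key _ hZa' h2
  have := (hZ'.orthogonal hZ).mul_eq_zero (by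
    rintro (j | b)
    · exact mul_ne_neg_one (hZa j) (hZa' j)
    · rcases P.inr_eq b with rfl | rfl
      · rw [hZg', mul_zero]; decide
      · rw [show Z (Sum.inr P.f) = 0 from hZf, zero_mul]; decide) (Sum.inl i)
  rw [e1, e2] at this
  exact mul_ne_zero (negAt_ne_zero hne i i) (negAt_ne_zero hne i i) this

/-- A basis all of whose sign reversals preserve feasibility. -/
theorem IsFeasible.exists_cube [Finite E] (hP : P.IsGeneric) {a : SignVec E}
    (ha : P.IsFeasible a) : ∃ b : Set E, P.M.matroid.IsBase (Sum.inl '' b) ∧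
      ∀ i ∈ b, P.IsFeasible (negAt i a) := by
  have hne := ha.ne_zero hP
  rcases exists_circuit_or_vertex (P := P) hne ∅ with ⟨X, hX, hXg, hXa⟩ | ⟨Y, hY, hYg, hYa, -⟩
  · exact (ha.not_circuit hX hXg fun i => hXa i (by simp)).elim
  · refine ⟨_, hP.isBase_of_cocircuit hY (by rw [hYg]; decide), fun i hi => ?_⟩
    refine hP.feasible_of_vertex hY hYg (negAt_ne_zero hne i) fun j => ?_
    by_cases h : j = i
    · exact Or.inl (h ▸ hi)
    · rw [negAt_of_ne h]; exact hYa j (by simp)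

/-- Take a vertex with `Y(j) = 0`, on the common wall of `a` and `negAt j a`; its zero set serves
both. A circuit instead would be conformal to one of the two topes, according to its sign at `j`. -/
theorem IsFeasible.exists_cube_of_negAt [Finite E] (hP : P.IsGeneric) {a : SignVec E} {j : E}
    (ha : P.IsFeasible a) (haj : P.IsFeasible (negAt j a)) :
    ∃ b : Set E, P.M.matroid.IsBase (Sum.inl '' b) ∧
      ∀ i ∈ b, P.IsFeasible (negAt i a) ∧ P.IsFeasible (negAt i (negAt j a)) := by
  have hne := ha.ne_zero hP
  rcases exists_circuit_or_vertex (P := P) hne {j} with ⟨X, hX, hXg, hXa⟩ | ⟨Y, hY, hYg, hYa, hYj⟩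
  · exfalso
    by_cases hj : X (Sum.inl j) = 0 ∨ X (Sum.inl j) = a j
    · refine ha.not_circuit hX hXg fun i => ?_
      by_cases h : i = j
      · exact h ▸ hj
      · exact hXa i h
    · refine haj.not_circuit hX hXg fun i => ?_
      by_cases h : i = j
      · subst h
        have : ∀ s t : SignType, t ≠ 0 → ¬ (s = 0 ∨ s = t) → s = -t := by decide
        rw [negAt_same]
        exact Or.inr (this _ _ (hne i) hj)
      · rw [negAt_of_ne h]; exact hXa i h
  · have hj0 : Y (Sum.inl j) = 0 := hYj j rfl
    refine ⟨_, hP.isBase_of_cocircuit hY (by rw [hYg]; decide), fun i hi => ⟨?_, ?_⟩⟩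
    · refine hP.feasible_of_vertex hY hYg (negAt_ne_zero hne i) fun l => ?_
      by_cases h : l = i
      · exact Or.inl (h ▸ hi)
      by_cases h' : l = j
      · exact Or.inl (h' ▸ hj0)
      · rw [negAt_of_ne h]; exact hYa l h'
    · refine hP.feasible_of_vertex hY hYg (negAt_ne_zero (negAt_ne_zero hne j) i) fun l => ?_
      by_cases h : l = i
      · exact Or.inl (h ▸ hi)
      by_cases h' : l = j
      · exact Or.inl (h' ▸ hj0)
      · rw [negAt_of_ne h, negAt_of_ne h']; exact hYa l h'

end OMProgram

/-! ## Parameter spaces -/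

section Perp

variable {k E : Type*} [Field k] [Fintype E]

theorem mem_perp {U : Submodule k (E → k)} {x : E → k} :
    x ∈ perp U ↔ ∀ u ∈ U, ∑ i, x i * u i = 0 := Iff.rfl

theorem perp_perp (U : Submodule k (E → k)) : perp (perp U) = U := by
  classical
  apply le_antisymm
  · intro x hx
    by_contra hxU
    obtain ⟨f, hf, hfU⟩ := Submodule.exists_dual_map_eq_bot_of_notMem hxU inferInstance
    have key : ∀ y, f y = ∑ i, y i * f (Pi.single i 1) := by
      intro y
      conv_lhs => rw [pi_eq_sum_univ' y]
      simp [map_sum]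
    apply hf
    rw [key]
    refine hx (fun i => f (Pi.single i 1)) fun u hu => ?_
    have : f u = 0 := by
      have : f u ∈ U.map f := ⟨u, hu, rfl⟩
      rwa [hfU] at this
    rw [key] at this
    simpa only [mul_comm] using this
  · intro x hx y hy
    have := hy x hx
    simpa only [mul_comm] using this

/-- A vector orthogonal to all elements of `Uᗮ` vanishing outside of `S` agrees on `S` with an
element of `U`. -/
theorem exists_mem_eq_on (U : Submodule k (E → k)) (S : Set E) {t : E → k}
    (ht : ∀ c ∈ perp U, (∀ i, c i ≠ 0 → i ∈ S) → ∑ i, c i * t i = 0) :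
    ∃ u ∈ U, ∀ i ∈ S, u i = t i := by
  classical
  -- `W` consists of the vectors vanishing on `S`. A vector orthogonal to `U + W` is an element of
  -- `Uᗮ` supported on `S`, so the hypothesis places `t` in the double orthogonal of `U + W`.
  let W : Submodule k (E → k) :=
    { carrier := {w | ∀ i ∈ S, w i = 0}
      add_mem' := fun hv hw i hi => by simp [hv i hi, hw i hi]
      zero_mem' := fun i _ => rfl
      smul_mem' := fun c w hw i hi => by simp [hw i hi] }
  have hW : ∀ w, w ∈ W ↔ ∀ i ∈ S, w i = 0 := fun w => Iff.rfl
  have : t ∈ perp (perp (U ⊔ W)) := by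
    intro c hc
    have h1 : c ∈ perp U := fun u hu => hc u (Submodule.mem_sup_left hu)
    have h2 : ∀ i, c i ≠ 0 → i ∈ S := by
      intro i hi
      by_contra hiS
      have hw : (Pi.single i 1 : E → k) ∈ W := by
        rw [hW]
        intro j hj
        rw [Pi.single_eq_of_ne]
        rintro rfl
        exact hiS hj
      have := hc _ (Submodule.mem_sup_right hw)
      simp [Pi.single_apply] at this
      exact hi this
    simpa only [mul_comm] using ht c h1 h2
  rw [perp_perp] at this
  obtain ⟨u, hu, w, hw, rfl⟩ := Submodule.mem_sup.1 this
  refine ⟨u, hu, fun i hi => ?_⟩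
  simp [(hW w).1 hw i hi]

/-- If `U` projects isomorphically to `k^b` then every vector is congruent modulo `Uᗮ` to a vector
supported on `b`. -/
theorem exists_supported_sub_mem_perp {U : Submodule k (E → k)} {b : Set E}
    (hb : Function.Bijective fun (u : U) (i : b) => (u : E → k) i) (x : E → k) :
    ∃ m : E → k, (∀ i, m i ≠ 0 → i ∈ b) ∧ x - m ∈ perp U := by
  classical
  let L₀ : U →ₗ[k] (b → k) :=
    { toFun := fun u i => (u : E → k) i
      map_add' := fun _ _ => rfl
      map_smul' := fun _ _ => rfl }
  let L : U ≃ₗ[k] (b → k) := LinearEquiv.ofBijective L₀ hb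
  -- Pairing with `x` is a functional on `U`. Transported to `k^b` it has a coordinate vector, and
  -- this is `m`.
  let l : U →ₗ[k] k := (Fintype.linearCombination k x).comp U.subtype
  have hl : ∀ u : U, l u = ∑ i, x i * (u : E → k) i := by
    intro u; simp [l, Fintype.linearCombination_apply, mul_comm]
  refine ⟨fun i => if h : i ∈ b then l (L.symm (Pi.single ⟨i, h⟩ 1)) else 0, ?_, ?_⟩
  · intro i hi
    by_contra h
    simp [h] at hi
  · intro u hu
    have h1 : L.symm (L ⟨u, hu⟩) = ⟨u, hu⟩ := L.symm_apply_apply _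
    have h2 : l ⟨u, hu⟩ = ∑ i : b, u i * l (L.symm (Pi.single i 1)) := by
      conv_lhs => rw [← h1, pi_eq_sum_univ' (L ⟨u, hu⟩)]
      simp only [map_sum, map_smul, smul_eq_mul]
      rfl
    rw [hl] at h2
    simp only [Pi.sub_apply, sub_mul, Finset.sum_sub_distrib, h2]
    rw [sub_eq_zero, eq_comm]
    exact Finset.sum_congr_set b _ (fun i : b => u i * l (L.symm (Pi.single i 1)))
      (fun i hi => by simp [hi, mul_comm]) (fun i hi => by simp [hi])

end Perp

namespace OMProgram

variable {E : Type*} [Fintype E] {k : Type*} [Field k] {P : OMProgram E} {U : Submodule k (E → k)}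

/-- Bases of the dual are complements of bases. For injectivity, pair with the element of `U` which
is a unit vector on `bᶜ`; for surjectivity, extend a vector on `b` by zero and correct it on `bᶜ` to
lie in `Uᗮ`. -/
theorem IsParameterSpace.dual (hU : P.IsParameterSpace U) :
    P.dual.IsParameterSpace (perp U) := by
  classical
  intro b hb
  have hbase : P.M.matroid.IsBase (Sum.inl '' bᶜ) := by
    rw [dual_M_matroid] at hb
    have := hb.compl_isBase_dual
    rw [Matroid.dual_dual, Matroid.dual_ground, M_ground] at this
    rwa [← Set.image_univ, ← Set.image_sdiff Sum.inl_injective, ← Set.compl_eq_univ_sdiff] at this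
  have hbij := hU _ hbase
  constructor
  · rintro ⟨x, hx⟩ ⟨y, hy⟩ hxy
    have h0 : ∀ i ∈ b, x i = y i := fun i hi => congrFun hxy ⟨i, hi⟩
    ext i
    by_cases hi : i ∈ b
    · exact h0 i hi
    obtain ⟨⟨u, hu⟩, hui⟩ := hbij.2 (Pi.single ⟨i, hi⟩ 1)
    have hui' : ∀ j, j ∉ b → u j = if j = i then 1 else 0 := by
      intro j hj
      have := congrFun hui ⟨j, hj⟩
      simpa [Pi.single_apply] using this
    have := (perp U).sub_mem hx hy u hu
    rw [Finset.sum_eq_single i] at this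
    · simpa [hui' i hi, sub_eq_zero] using this
    · intro j _ hji
      by_cases hj : j ∈ b
      · simp [h0 j hj]
      · simp [hui' j hj, hji]
    · simp
  · intro y
    obtain ⟨m, hm, hmU⟩ := exists_supported_sub_mem_perp hbij
      (fun i => if h : i ∈ b then y ⟨i, h⟩ else 0)
    refine ⟨⟨_, hmU⟩, ?_⟩
    funext i
    have : m i = 0 := by
      by_contra h
      exact hm i h i.2
    simp [this]

theorem IsParameterSpace.exists_supported_negAt (hU : P.IsParameterSpace U) (hP : P.IsGeneric)
    {a : SignVec E} (ha : P.IsFeasible a) (x : E → k) :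
    ∃ m : E → k, (∀ i, m i ≠ 0 → P.IsFeasible (negAt i a)) ∧ x - m ∈ perp U := by
  obtain ⟨b, hb, hba⟩ := ha.exists_cube hP
  obtain ⟨m, hm, hmU⟩ := exists_supported_sub_mem_perp (hU b hb) x
  exact ⟨m, fun i hi => hba i (hm i hi), hmU⟩

/-- The same `m` serves both ends of an arrow, so that `∑ x_i u_i` is expressed by loops with equal
coefficients at both ends. -/
theorem IsParameterSpace.exists_supported_negAt_negAt (hU : P.IsParameterSpace U)
    (hP : P.IsGeneric) {a : SignVec E} {j : E} (ha : P.IsFeasible a)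
    (haj : P.IsFeasible (negAt j a)) (x : E → k) :
    ∃ m : E → k, (∀ i, m i ≠ 0 → P.IsFeasible (negAt i a) ∧ P.IsFeasible (negAt i (negAt j a))) ∧
      x - m ∈ perp U := by
  obtain ⟨b, hb, hba⟩ := ha.exists_cube_of_negAt hP haj
  obtain ⟨m, hm, hmU⟩ := exists_supported_sub_mem_perp (hU b hb) x
  exact ⟨m, fun i hi => hba i (hm i hi), hmU⟩

end OMProgram

/-! ### Realizations: presenting `A(P, U)` without the variables `u_i`. -/

namespace OMProgram

noncomputable section

open scoped Classical

variable {E : Type*} [Fintype E] {k : Type*} [Field k]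

theorem differAt_iff {P : OMProgram E} (hP : P.IsGeneric) {a b : P.Feas} {i : E} :
    P.DifferAt a b i ↔ b.1 = negAt i a.1 := by
  have ha := a.2.ne_zero hP
  have hb := b.2.ne_zero hP
  constructor
  · rintro ⟨h1, h2⟩
    funext j
    by_cases h : j = i
    · subst h
      rw [negAt_same]
      have : ∀ s t : SignType, s ≠ 0 → t ≠ 0 → s ≠ t → t = -s := by decide
      exact this _ _ (ha j) (hb j) h1
    · rw [negAt_of_ne h, h2 j h]
  · intro h
    refine ⟨?_, fun j hj => ?_⟩
    · rw [h]
      exact ((negAt_apply_ne_iff ha).2 rfl).symm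
    · rw [h, negAt_of_ne hj]

/-- A feasible sign vector as an element of the type of feasible topes. -/
def Feas.of {P : OMProgram E} {a : SignVec E} (h : P.IsFeasible a) : P.Feas := ⟨a, h⟩

/-- Lets sums over vertices run over all sign vectors, the infeasible ones contributing zero. -/
theorem sum_feas (P : OMProgram E) {B : Type*} [AddCommMonoid B] (F : SignVec E → B)
    (hF : ∀ a, ¬ P.IsFeasible a → F a = 0) : ∑ a : P.Feas, F a.1 = ∑ a, F a := by
  refine Finset.sum_of_injOn (fun a : P.Feas => a.1) (fun a _ b _ h => Subtype.ext h)
    (fun _ _ => Finset.mem_coe.2 (Finset.mem_univ _)) (fun a _ ha => hF a fun h => ?_)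
    (fun _ _ => rfl)
  exact ha ⟨⟨a, h⟩, Finset.mem_coe.2 (Finset.mem_univ _), rfl⟩

/-- A family of elements of a `k`-algebra satisfying the relations of the vertices and the arrows in
`A(P, U)`: those relations which do not involve the `u_i`, and the linear relations between the
loops at a vertex. The values of `e` and `p` at arguments which are not feasible or not adjacent are
irrelevant. -/
structure Realization (P : OMProgram E) (U : Submodule k (E → k)) (B : Type*) [Ring B]
    [Algebra k B] where
  /-- the images of the vertices -/
  e : SignVec E → B
  /-- the images of the arrows -/
  p : SignVec E → SignVec E → B
  e_eq_zero : ∀ a, ¬ P.Bdd a → e a = 0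
  e_mul_self : ∀ a, e a * e a = e a
  e_mul_of_ne : ∀ a b, a ≠ b → e a * e b = 0
  sum_e : ∑ a, e a = 1
  e_mul_p : ∀ a b, e a * p a b = p a b
  p_mul_e : ∀ a b, p a b * e b = p a b
  square : ∀ a i j, i ≠ j → P.IsFeasible a → P.IsFeasible (negAt i a) → P.IsFeasible (negAt j a) →
    P.IsFeasible (negAt i (negAt j a)) →
    p a (negAt i a) * p (negAt i a) (negAt i (negAt j a)) =
      p a (negAt j a) * p (negAt j a) (negAt i (negAt j a))
  loop : ∀ a, P.IsFeasible a → ∀ c ∈ perp U, (∀ i, c i ≠ 0 → P.IsFeasible (negAt i a)) →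
    ∑ i, c i • (p a (negAt i a) * p (negAt i a) a) = 0

namespace Realization

variable {P : OMProgram E} {U : Submodule k (E → k)} {B : Type*} [Ring B] [Algebra k B]
  (R : Realization P U B)

include R

theorem e_mul_p_of_ne {a b c : SignVec E} (h : a ≠ b) : R.e a * R.p b c = 0 := by
  rw [← R.e_mul_p b c, ← mul_assoc, R.e_mul_of_ne _ _ h, zero_mul]

theorem p_mul_e_of_ne {a b c : SignVec E} (h : b ≠ c) : R.p a b * R.e c = 0 := by
  rw [← R.p_mul_e a b, mul_assoc, R.e_mul_of_ne _ _ h, mul_zero]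

theorem p_mul_p_of_ne {a b c d : SignVec E} (h : b ≠ c) : R.p a b * R.p c d = 0 := by
  rw [← R.p_mul_e a b, mul_assoc, R.e_mul_p_of_ne h, mul_zero]

theorem p_eq_zero_left {a : SignVec E} (h : ¬ P.Bdd a) (b : SignVec E) : R.p a b = 0 := by
  rw [← R.e_mul_p, R.e_eq_zero a h, zero_mul]

theorem p_eq_zero_right {b : SignVec E} (h : ¬ P.Bdd b) (a : SignVec E) : R.p a b = 0 := by
  rw [← R.p_mul_e, R.e_eq_zero b h, mul_zero]

/-- The homomorphism from the path algebra. -/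
def pathHom : PathAlgebra k P.Adj →ₐ[k] B :=
  RingQuot.liftAlgHom k ⟨FreeAlgebra.lift k fun x => match x with
    | .vertex a => R.e a.1
    | .arrow a b _ => R.p a.1 b.1, by
      rintro _ _ (a | ⟨a, b, h⟩ | _ | _ | _)
      · simp [R.e_mul_self]
      · have : a.1 ≠ b.1 := fun hab => h (Subtype.ext hab)
        simp [R.e_mul_of_ne _ _ this]
      · have := P.sum_feas R.e fun a ha => R.e_eq_zero a fun h => ha h.1
        simpa [R.sum_e] using this
      · simp [R.e_mul_p]
      · simp [R.p_mul_e]⟩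

theorem pathHom_vertex (a : P.Feas) :
    R.pathHom (PathAlgebra.of k P.Adj (.vertex a)) = R.e a.1 := by
  refine (RingQuot.liftAlgHom_mkAlgHom_apply _ _ _ _).trans ?_
  simp

theorem pathHom_arrow (a b : P.Feas) (h : P.Adj a b) :
    R.pathHom (PathAlgebra.of k P.Adj (.arrow a b h)) = R.p a.1 b.1 := by
  refine (RingQuot.liftAlgHom_mkAlgHom_apply _ _ _ _).trans ?_
  simp

theorem commute_pathHom (hP : P.IsGeneric) {c : B} (he : ∀ a, Commute c (R.e a))
    (hp : ∀ a i, P.IsFeasible a → P.IsFeasible (negAt i a) → Commute c (R.p a (negAt i a)))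
    (x : PathAlgebra k P.Adj) : Commute c (R.pathHom x) := by
  obtain ⟨x, rfl⟩ := RingQuot.mkAlgHom_surjective k (PathRel k P.Adj) x
  change Commute c (R.pathHom (RingQuot.mkAlgHom k (PathRel k P.Adj) x))
  induction x using FreeAlgebra.induction with
  | grade0 r =>
    rw [AlgHom.commutes]
    erw [AlgHom.commutes]
    exact (Algebra.commutes r c).symm
  | grade1 x =>
    rcases x with a | ⟨a, b, h⟩
    · have := R.pathHom_vertex a
      rw [PathAlgebra.of] at this
      rw [this]
      exact he a.1
    · have := R.pathHom_arrow a b h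
      rw [PathAlgebra.of] at this
      rw [this]
      obtain ⟨i, hi⟩ := h
      rw [differAt_iff hP] at hi
      have hb := b.2
      rw [hi] at hb ⊢
      exact hp a.1 i a.2 hb
  | mul x y hx hy =>
    rw [map_mul]
    erw [map_mul]
    exact hx.mul_right hy
  | add x y hx hy =>
    rw [map_add]
    erw [map_add]
    exact hx.add_right hy

/-- The relations between the loops at a feasible vertex extend uniquely to all `u_i`. -/
theorem exists_loopMap (hP : P.IsGeneric) (hU : P.IsParameterSpace U) {a : SignVec E}
    (ha : P.IsFeasible a) : ∃ L : (E → k) →ₗ[k] B, (∀ x ∈ perp U, L x = 0) ∧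
      ∀ j, P.IsFeasible (negAt j a) → L (Pi.single j 1) = R.p a (negAt j a) * R.p (negAt j a) a := by
  -- Replace each unit vector by a congruent `m i` supported on feasible directions, then map to the
  -- loops. An `x ∈ Uᗮ` goes to an element of `Uᗮ` with such support, which the loop relation kills;
  -- for feasible `j` the difference of the unit vector and `m j` is itself a loop relation.
  choose m hm hmU using fun i : E => hU.exists_supported_negAt hP ha (Pi.single i 1)
  let ℓ : E → B := fun j => R.p a (negAt j a) * R.p (negAt j a) a
  refine ⟨(Fintype.linearCombination k ℓ).comp (Fintype.linearCombination k m), ?_, ?_⟩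
  · intro x hx
    have := R.loop a ha (Fintype.linearCombination k m x) ?_ ?_
    · rw [LinearMap.comp_apply, Fintype.linearCombination_apply]
      exact this
    · have h1 : ∑ i, x i • ((Pi.single i 1 : E → k) - m i) ∈ perp U :=
        Submodule.sum_mem _ fun i _ => Submodule.smul_mem _ _ (hmU i)
      have h2 : ∑ i, x i • ((Pi.single i 1 : E → k) - m i) =
          x - Fintype.linearCombination k m x := by
        rw [Fintype.linearCombination_apply]
        simp only [smul_sub, Finset.sum_sub_distrib]
        rw [← pi_eq_sum_univ' x]
      rw [h2] at h1
      have := (perp U).sub_mem hx h1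
      simpa using this
    · intro i hi
      rw [Fintype.linearCombination_apply, Finset.sum_apply] at hi
      obtain ⟨j, -, hj⟩ := Finset.exists_ne_zero_of_sum_ne_zero hi
      refine hm j i fun h => hj ?_
      simp [h]
  · intro j hj
    have := R.loop a ha _ (hmU j) (by
      intro i hi
      by_cases h : i = j
      · exact h ▸ hj
      · refine hm j i fun h0 => hi ?_
        simp [h0, h])
    simp only [Pi.sub_apply, sub_smul, Finset.sum_sub_distrib, Pi.single_apply, ite_smul, one_smul,
      zero_smul, Finset.sum_ite_eq', Finset.mem_univ, if_true] at this
    rw [sub_eq_zero] at this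
    simp only [LinearMap.comp_apply, Fintype.linearCombination_apply_single, one_smul]
    rw [this, Fintype.linearCombination_apply]

/-- The action of `∑ x_i u_i` at the vertex `a`. -/
def loopMap (hP : P.IsGeneric) (hU : P.IsParameterSpace U) (a : SignVec E) : (E → k) →ₗ[k] B :=
  if ha : P.IsFeasible a then (R.exists_loopMap hP hU ha).choose else 0

variable (hP : P.IsGeneric) (hU : P.IsParameterSpace U)

theorem loopMap_perp (a : SignVec E) {x : E → k} (hx : x ∈ perp U) :
    R.loopMap hP hU a x = 0 := by
  unfold loopMap
  split_ifs with ha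
  · exact (R.exists_loopMap hP hU ha).choose_spec.1 x hx
  · rfl

theorem loopMap_single {a : SignVec E} (ha : P.IsFeasible a) {j : E}
    (hj : P.IsFeasible (negAt j a)) :
    R.loopMap hP hU a (Pi.single j 1) = R.p a (negAt j a) * R.p (negAt j a) a := by
  unfold loopMap
  rw [dif_pos ha]
  exact (R.exists_loopMap hP hU ha).choose_spec.2 j hj

theorem loopMap_eq_of_supported {a : SignVec E} {x m : E → k} (hx : x - m ∈ perp U) :
    R.loopMap hP hU a x = ∑ j, m j • R.loopMap hP hU a (Pi.single j 1) := by
  have := R.loopMap_perp hP hU a hx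
  rw [map_sub, sub_eq_zero] at this
  rw [this]
  conv_lhs => rw [pi_eq_sum_univ' m]
  simp

theorem loopMap_eq_sum {a : SignVec E} (ha : P.IsFeasible a) {x m : E → k}
    (hm : ∀ i, m i ≠ 0 → P.IsFeasible (negAt i a)) (hx : x - m ∈ perp U) :
    R.loopMap hP hU a x = ∑ j, m j • (R.p a (negAt j a) * R.p (negAt j a) a) := by
  rw [R.loopMap_eq_of_supported hP hU hx]
  refine Finset.sum_congr rfl fun j _ => ?_
  by_cases h : m j = 0
  · simp [h]
  · rw [R.loopMap_single hP hU ha (hm j h)]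

theorem e_mul_loopMap (a : SignVec E) (x : E → k) :
    R.e a * R.loopMap hP hU a x = R.loopMap hP hU a x := by
  by_cases ha : P.IsFeasible a
  · obtain ⟨m, hm, hmU⟩ := hU.exists_supported_negAt hP ha x
    rw [R.loopMap_eq_sum hP hU ha hm hmU, Finset.mul_sum]
    refine Finset.sum_congr rfl fun j _ => ?_
    rw [mul_smul_comm, ← mul_assoc, R.e_mul_p]
  · simp [loopMap, ha]

theorem loopMap_mul_e (a : SignVec E) (x : E → k) :
    R.loopMap hP hU a x * R.e a = R.loopMap hP hU a x := by
  by_cases ha : P.IsFeasible a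
  · obtain ⟨m, hm, hmU⟩ := hU.exists_supported_negAt hP ha x
    rw [R.loopMap_eq_sum hP hU ha hm hmU, Finset.sum_mul]
    refine Finset.sum_congr rfl fun j _ => ?_
    rw [smul_mul_assoc, mul_assoc, R.p_mul_e]
  · simp [loopMap, ha]

/-- The `u_i` commute with the arrows. -/
theorem loopMap_mul_p {a : SignVec E} {j : E} (ha : P.IsFeasible a)
    (haj : P.IsFeasible (negAt j a)) (x : E → k) :
    R.loopMap hP hU a x * R.p a (negAt j a) = R.p a (negAt j a) * R.loopMap hP hU (negAt j a) x := by
  obtain ⟨m, hm, hmU⟩ := hU.exists_supported_negAt_negAt hP ha haj x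
  rw [R.loopMap_eq_of_supported hP hU hmU, R.loopMap_eq_of_supported hP hU hmU, Finset.sum_mul,
    Finset.mul_sum]
  refine Finset.sum_congr rfl fun i _ => ?_
  by_cases hi : m i = 0
  · simp [hi]
  obtain ⟨h1, h2⟩ := hm i hi
  rw [R.loopMap_single hP hU ha h1, R.loopMap_single hP hU haj h2, smul_mul_assoc, mul_smul_comm]
  congr 1
  by_cases hij : i = j
  · subst hij
    rw [negAt_negAt, mul_assoc]
  -- A loop in direction `i` is carried along the arrow in direction `j` by two uses of
  -- commutativity on the same square, first from the corner `negAt i a` and then from `a`.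
  · have s1 := R.square a i j hij ha h1 haj h2
    have s2 := R.square (negAt i a) i j hij h1 (by rwa [negAt_negAt]) (by rwa [negAt_comm])
      (by rwa [negAt_comm j i, negAt_negAt])
    rw [negAt_comm j i a, negAt_negAt, negAt_negAt] at s2
    rw [mul_assoc, s2, ← mul_assoc, s1, mul_assoc]

/-- The image of `u_i`. -/
def u (i : E) : B := ∑ a, R.loopMap hP hU a (Pi.single i 1)

theorem e_mul_u (a : SignVec E) (i : E) :
    R.e a * R.u hP hU i = R.loopMap hP hU a (Pi.single i 1) := by
  rw [u, Finset.mul_sum, Finset.sum_eq_single a, e_mul_loopMap]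
  · intro b _ hb
    rw [← R.e_mul_loopMap, ← mul_assoc, R.e_mul_of_ne _ _ hb.symm, zero_mul]
  · simp

theorem u_mul_e (a : SignVec E) (i : E) :
    R.u hP hU i * R.e a = R.loopMap hP hU a (Pi.single i 1) := by
  rw [u, Finset.sum_mul, Finset.sum_eq_single a, loopMap_mul_e]
  · intro b _ hb
    rw [← R.loopMap_mul_e, mul_assoc, R.e_mul_of_ne _ _ hb, mul_zero]
  · simp

theorem commute_u_pathHom (i : E) (x : PathAlgebra k P.Adj) :
    Commute (R.u hP hU i) (R.pathHom x) := by
  refine R.commute_pathHom hP (fun a => ?_) (fun a j ha haj => ?_) x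
  · rw [Commute, SemiconjBy, e_mul_u, u_mul_e]
  · rw [Commute, SemiconjBy]
    conv_lhs => rw [← R.e_mul_p, ← mul_assoc, u_mul_e]
    conv_rhs => rw [← R.p_mul_e, mul_assoc, e_mul_u]
    exact R.loopMap_mul_p hP hU ha haj _

theorem p_mem_range (hP : P.IsGeneric) {a b : SignVec E} (ha : P.IsFeasible a) (hb : P.IsFeasible b)
    {i : E} (hab : b = negAt i a) : R.p a b ∈ R.pathHom.range :=
  ⟨_, R.pathHom_arrow ⟨a, ha⟩ ⟨b, hb⟩ ⟨i, (differAt_iff hP).2 hab⟩⟩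

/-- Commuting with the image of the path algebra makes `u_i` central only if `u_i` lies in that
image. -/
theorem loopMap_mem_range (a : SignVec E) (x : E → k) :
    R.loopMap hP hU a x ∈ R.pathHom.range := by
  by_cases ha : P.IsFeasible a
  · obtain ⟨m, hm, hmU⟩ := hU.exists_supported_negAt hP ha x
    rw [R.loopMap_eq_sum hP hU ha hm hmU]
    refine sum_mem fun j _ => ?_
    by_cases h : m j = 0
    · rw [h, zero_smul]
      exact zero_mem _
    · exact Subalgebra.smul_mem _ (mul_mem (R.p_mem_range hP ha (hm j h) rfl)
        (R.p_mem_range hP (hm j h) ha (i := j) (by rw [negAt_negAt]))) _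
  · simp only [loopMap, ha, dif_neg, not_false_iff, LinearMap.zero_apply]
    exact zero_mem _

/-- The image of `u_i` in the center of the image of the path algebra. -/
def uCenter (i : E) : Subalgebra.center k R.pathHom.range :=
  ⟨⟨R.u hP hU i, sum_mem fun a _ => R.loopMap_mem_range hP hU a _⟩, by
    rw [Subalgebra.mem_center_iff]
    rintro ⟨_, x, rfl⟩
    exact Subtype.ext (R.commute_u_pathHom hP hU i x).eq.symm⟩

theorem commute_center (x : PathAlgebra k P.Adj) (y : MvPolynomial E k) :
    Commute (R.pathHom.rangeRestrict x) (((Subalgebra.center k R.pathHom.range).val.comp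
      (MvPolynomial.aeval (R.uCenter hP hU))) y) :=
  Subalgebra.mem_center_iff.1 (MvPolynomial.aeval (R.uCenter hP hU) y).2 _

/-- The homomorphism from `P(Q) ⊗ k[u₁, …, uₙ]`. -/
def polyHom : P.PolyPath k →ₐ[k] B :=
  -- Evaluation of polynomials needs a commutative target, so it is done in the centre of the image
  -- of the path algebra.
  R.pathHom.range.val.comp
    (Algebra.TensorProduct.lift R.pathHom.rangeRestrict
      ((Subalgebra.center k R.pathHom.range).val.comp
        (MvPolynomial.aeval (R.uCenter hP hU))) (R.commute_center hP hU))

theorem polyHom_e₀ (a : P.Feas) : R.polyHom hP hU (P.e₀ k a) = R.e a.1 := by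
  refine (congrArg Subtype.val (Algebra.TensorProduct.lift_tmul _ _
    (R.commute_center hP hU) _ _)).trans ?_
  rw [map_one, mul_one]
  exact R.pathHom_vertex a

theorem polyHom_p₀ (a b : P.Feas) (h : P.Adj a b) :
    R.polyHom hP hU (P.p₀ k a b h) = R.p a.1 b.1 := by
  refine (congrArg Subtype.val (Algebra.TensorProduct.lift_tmul _ _
    (R.commute_center hP hU) _ _)).trans ?_
  rw [map_one, mul_one]
  exact R.pathHom_arrow a b h

theorem polyHom_u₀ (i : E) : R.polyHom hP hU (P.u₀ k i) = R.u hP hU i := by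
  refine (congrArg Subtype.val (Algebra.TensorProduct.lift_tmul _ _
    (R.commute_center hP hU) _ _)).trans ?_
  rw [map_one, one_mul, AlgHom.comp_apply, MvPolynomial.aeval_X]
  rfl

/-- The homomorphism from `A(P, U)` given by a realization. -/
def lift : P.A U →ₐ[k] B :=
  RingQuot.liftAlgHom k ⟨R.polyHom hP hU, by
    rintro _ _ (⟨a, ha⟩ | ⟨a, b, c, d, hab, hcd, hac, hcb, had, hdb⟩ | ⟨a, b, i, hi, hab, hba⟩ |
      ⟨x, hx⟩)
    · rw [polyHom_e₀, map_zero, R.e_eq_zero]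
      exact fun h => h.2 ha
    · simp only [map_mul, polyHom_p₀]
      obtain ⟨i, hi⟩ := hac
      obtain ⟨j, hj⟩ := had
      obtain ⟨i', hi'⟩ := hcb
      obtain ⟨j', hj'⟩ := hdb
      rw [differAt_iff hP] at hi hj hi' hj'
      have hne := a.2.ne_zero hP
      have hij : i ≠ j := by
        rintro rfl
        exact hcd (Subtype.ext (hi.trans hj.symm))
      have hba : b.1 ≠ a.1 := fun h => hab (Subtype.ext h.symm)
      have h1 : negAt i' (negAt i a.1) = negAt j' (negAt j a.1) := by rw [← hi, ← hj, ← hi', ← hj']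
      have hii' : i' ≠ i := by
        rintro rfl
        rw [hi, negAt_negAt] at hi'
        exact hba hi'
      -- Both paths end at `b`. At the coordinate `j` the second path has a reversed sign, so the
      -- first must reverse it too, and can only do so in its second step.
      have hi'j : i' = j := by
        by_contra hne'
        have hjj' : j' ≠ j := by
          rintro rfl
          rw [hj, negAt_negAt] at hj'
          exact hba hj'
        have := congrFun h1 j
        rw [negAt_of_ne (Ne.symm hne'), negAt_of_ne hij.symm, negAt_of_ne hjj'.symm,
          negAt_same] at this
        exact neg_ne_self (hne j) this.symm
      have hb : b.1 = negAt i (negAt j a.1) := by rw [hi', hi, hi'j, negAt_comm]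
      have hc := c.2
      have hd := d.2
      have hbf := b.2
      rw [hb] at hbf
      rw [hi] at hc
      rw [hj] at hd
      rw [hb, hi, hj]
      exact R.square a.1 i j hij a.2 hc hd hbf
    · simp only [map_mul, polyHom_p₀, polyHom_e₀, polyHom_u₀, e_mul_u]
      rw [differAt_iff hP] at hi
      have hb := b.2
      rw [hi] at hb ⊢
      rw [R.loopMap_single hP hU a.2 hb]
    · simp only [map_sum, map_smul, polyHom_u₀, map_zero, u, Finset.smul_sum]
      rw [Finset.sum_comm]
      refine Finset.sum_eq_zero fun a _ => ?_
      rw [← R.loopMap_perp hP hU a hx]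
      conv_rhs => rw [pi_eq_sum_univ' x]
      simp⟩

theorem lift_mk (x : P.PolyPath k) : R.lift hP hU (A.mk P U x) = R.polyHom hP hU x :=
  RingQuot.liftAlgHom_mkAlgHom_apply _ _ _ _

end Realization

/-! ### The universal realization in `A(P, U)`. -/

variable (P : OMProgram E) (U : Submodule k (E → k))

theorem A.mk_rel {x y : P.PolyPath k} (h : P.ARel U x y) : A.mk P U x = A.mk P U y :=
  RingQuot.mkAlgHom_rel k h

variable {P} in
theorem of_vertex_mul_vertex {a b : P.Feas} :
    PathAlgebra.of k P.Adj (.vertex a) * PathAlgebra.of k P.Adj (.vertex b) =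
      if a = b then PathAlgebra.of k P.Adj (.vertex a) else 0 := by
  split_ifs with h
  · subst h
    have := RingQuot.mkAlgHom_rel k (PathRel.idem (k := k) (Adj := P.Adj) a)
    rw [map_mul] at this
    exact this
  · have := RingQuot.mkAlgHom_rel k (PathRel.orth (k := k) (Adj := P.Adj) a b h)
    rw [map_mul, map_zero] at this
    exact this

variable {P} in
theorem of_vertex_mul_arrow {a b : P.Feas} (h : P.Adj a b) :
    PathAlgebra.of k P.Adj (.vertex a) * PathAlgebra.of k P.Adj (.arrow a b h) =
      PathAlgebra.of k P.Adj (.arrow a b h) := by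
  have := RingQuot.mkAlgHom_rel k (PathRel.source (k := k) (Adj := P.Adj) a b h)
  rw [map_mul] at this
  exact this

variable {P} in
theorem of_arrow_mul_vertex {a b : P.Feas} (h : P.Adj a b) :
    PathAlgebra.of k P.Adj (.arrow a b h) * PathAlgebra.of k P.Adj (.vertex b) =
      PathAlgebra.of k P.Adj (.arrow a b h) := by
  have := RingQuot.mkAlgHom_rel k (PathRel.target (k := k) (Adj := P.Adj) a b h)
  rw [map_mul] at this
  exact this

theorem sum_of_vertex : ∑ a, PathAlgebra.of k P.Adj (.vertex a) = 1 := by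
  have := RingQuot.mkAlgHom_rel k (PathRel.sum_eq_one (k := k) (Adj := P.Adj))
  rw [map_sum, map_one] at this
  exact this

/-- The image of the vertex `a` in `A(P, U)`. -/
def eA (a : SignVec E) : P.A U :=
  if h : P.IsFeasible a then A.mk P U (P.e₀ k (.of h)) else 0

/-- The image of the arrow from `a` to `b` in `A(P, U)`. -/
def pA (a b : SignVec E) : P.A U :=
  if h : ∃ (ha : P.IsFeasible a) (hb : P.IsFeasible b), P.Adj (.of ha) (.of hb) then
    A.mk P U (P.p₀ k (.of h.1) (.of h.2.1) h.2.2) else 0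

/-- The image of `u_i` in `A(P, U)`. -/
def uA (i : E) : P.A U := A.mk P U (P.u₀ k i)

variable {P U}

theorem eA_of {a : SignVec E} (h : P.IsFeasible a) :
    P.eA U a = A.mk P U (P.e₀ k (.of h)) := dif_pos h

theorem pA_of {a b : SignVec E} (ha : P.IsFeasible a) (hb : P.IsFeasible b)
    (h : P.Adj (.of ha) (.of hb)) : P.pA U a b = A.mk P U (P.p₀ k (.of ha) (.of hb) h) :=
  dif_pos (⟨ha, hb, h⟩ : ∃ (ha : P.IsFeasible a) (hb : P.IsFeasible b), P.Adj (.of ha) (.of hb))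

theorem mk_e₀ (a : P.Feas) : A.mk P U (P.e₀ k a) = P.eA U a.1 := (eA_of a.2).symm

theorem mk_p₀ (a b : P.Feas) (h : P.Adj a b) : A.mk P U (P.p₀ k a b h) = P.pA U a.1 b.1 :=
  (pA_of a.2 b.2 h).symm

theorem differAt_of (hP : P.IsGeneric) {a b : SignVec E} (ha : P.IsFeasible a)
    (hb : P.IsFeasible b) {i : E} (h : b = negAt i a) : P.DifferAt (.of ha) (.of hb) i :=
  (differAt_iff hP).2 h

theorem pA_eq_zero (hP : P.IsGeneric) {a b : SignVec E} (h : ∀ i, b ≠ negAt i a) :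
    P.pA U a b = 0 := by
  refine dif_neg ?_
  rintro ⟨ha, hb, i, hi⟩
  exact h i ((differAt_iff hP).1 hi)

theorem pA_mul_pA (hP : P.IsGeneric) {a : SignVec E} (ha : P.IsFeasible a) {i : E}
    (hi : P.IsFeasible (negAt i a)) :
    P.pA U a (negAt i a) * P.pA U (negAt i a) a = P.eA U a * P.uA U i := by
  have h1 : P.DifferAt (.of ha) (.of hi) i := differAt_of hP ha hi rfl
  have h2 : P.DifferAt (.of hi) (.of ha) i := differAt_of hP hi ha (negAt_negAt i a).symm
  have := A.mk_rel P U (ARel.loop _ _ i h1 h1.adj h2.adj)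
  rw [map_mul, map_mul, ← pA_of, ← pA_of, ← eA_of] at this
  exact this

variable (U) in
/-- The universal realization. -/
def univ (hP : P.IsGeneric) : Realization P U (P.A U) where
  e := P.eA U
  p := P.pA U
  e_eq_zero a ha := by
    by_cases h : P.IsFeasible a
    · have hu : P.IsUnbounded a := by
        by_contra hu
        exact ha ⟨h, hu⟩
      have := A.mk_rel P U (ARel.unbounded (.of h) hu)
      rw [map_zero, ← eA_of] at this
      exact this
    · exact dif_neg h
  e_mul_self a := by
    by_cases h : P.IsFeasible a
    · rw [eA_of h, ← map_mul, e₀, Algebra.TensorProduct.tmul_mul_tmul, of_vertex_mul_vertex]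
      simp
    · simp [eA, h]
  e_mul_of_ne a b hab := by
    by_cases h : P.IsFeasible a
    · by_cases h' : P.IsFeasible b
      · rw [eA_of h, eA_of h', ← map_mul, e₀, e₀,
          Algebra.TensorProduct.tmul_mul_tmul, of_vertex_mul_vertex, if_neg, TensorProduct.zero_tmul,
          map_zero]
        exact fun h => hab (congrArg Subtype.val h)
      · simp [eA, h']
    · simp [eA, h]
  sum_e := by
    rw [← P.sum_feas (P.eA U) fun a ha => dif_neg ha]
    have : ∀ a : P.Feas, P.eA U a.1 = A.mk P U (P.e₀ k a) := fun a => eA_of a.2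
    simp only [this]
    rw [← map_sum]
    simp only [e₀]
    rw [← TensorProduct.sum_tmul, sum_of_vertex]
    exact map_one _
  e_mul_p a b := by
    by_cases h : ∃ (ha : P.IsFeasible a) (hb : P.IsFeasible b), P.Adj (.of ha) (.of hb)
    · obtain ⟨ha, hb, hab⟩ := h
      rw [pA_of ha hb hab, eA_of ha, ← map_mul, e₀, p₀,
        Algebra.TensorProduct.tmul_mul_tmul, of_vertex_mul_arrow, one_mul]
    · rw [pA, dif_neg h, mul_zero]
  p_mul_e a b := by
    by_cases h : ∃ (ha : P.IsFeasible a) (hb : P.IsFeasible b), P.Adj (.of ha) (.of hb)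
    · obtain ⟨ha, hb, hab⟩ := h
      rw [pA_of ha hb hab, eA_of hb, ← map_mul, e₀, p₀,
        Algebra.TensorProduct.tmul_mul_tmul, of_arrow_mul_vertex, one_mul]
    · rw [pA, dif_neg h, zero_mul]
  square a i j hij ha hi hj hb := by
    have h1 : P.DifferAt (.of ha) (.of hi) i := differAt_of hP ha hi rfl
    have h2 : P.DifferAt (.of ha) (.of hj) j := differAt_of hP ha hj rfl
    have h3 : P.DifferAt (.of hj) (.of hb) i := differAt_of hP hj hb rfl
    have h4 : P.DifferAt (.of hi) (.of hb) j := differAt_of hP hi hb (negAt_comm i j a)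
    have hne := ha.ne_zero hP
    have := A.mk_rel P U (ARel.square (.of ha) (.of hb) (.of hi) (.of hj)
      (fun h => negAt_negAt_ne_self hne hij (congrArg Subtype.val h).symm)
      (fun h => hij (negAt_injective hne (congrArg Subtype.val h)))
      h1.adj h4.adj h2.adj h3.adj)
    rw [map_mul, map_mul, ← pA_of, ← pA_of, ← pA_of, ← pA_of] at this
    exact this
  loop a ha c hc hci := by
    -- Where `c i = 0` the neighbour may be infeasible, and the relation between loops and `u_i` is
    -- not available.
    have h1 : ∀ i, c i • (P.pA U a (negAt i a) * P.pA U (negAt i a) a) =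
        P.eA U a * A.mk P U (c i • P.u₀ k i) := by
      intro i
      by_cases h : c i = 0
      · simp [h]
      · rw [pA_mul_pA hP ha (hci i h), map_smul, mul_smul_comm]
        rfl
    simp only [h1]
    rw [← Finset.mul_sum, ← map_sum, A.mk_rel P U (ARel.parameter c hc), map_zero, mul_zero]

section univ

variable (hP : P.IsGeneric)

include hP

theorem eA_mul_eA (a b : SignVec E) :
    P.eA U a * P.eA U b = if a = b then P.eA U a else 0 := by
  split_ifs with h
  · rw [← h]
    exact (univ U hP).e_mul_self a
  · exact (univ U hP).e_mul_of_ne a b h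

theorem eA_mul_pA (a b c : SignVec E) :
    P.eA U a * P.pA U b c = if a = b then P.pA U b c else 0 := by
  split_ifs with h
  · rw [h]
    exact (univ U hP).e_mul_p b c
  · exact (univ U hP).e_mul_p_of_ne h

theorem pA_mul_eA (a b c : SignVec E) :
    P.pA U a b * P.eA U c = if b = c then P.pA U a b else 0 := by
  split_ifs with h
  · rw [← h]
    exact (univ U hP).p_mul_e a b
  · exact (univ U hP).p_mul_e_of_ne h

theorem sum_eA : ∑ a, P.eA U a = 1 := (univ U hP).sum_e

theorem eA_eq_zero {a : SignVec E} (h : ¬ P.Bdd a) : P.eA U a = 0 := (univ U hP).e_eq_zero a h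

theorem pA_eq_zero_left {a : SignVec E} (h : ¬ P.Bdd a) (b : SignVec E) : P.pA U a b = 0 :=
  (univ U hP).p_eq_zero_left h b

theorem pA_eq_zero_right {b : SignVec E} (h : ¬ P.Bdd b) (a : SignVec E) : P.pA U a b = 0 :=
  (univ U hP).p_eq_zero_right h a

theorem pA_square {a : SignVec E} {i j : E} (hij : i ≠ j) (ha : P.IsFeasible a)
    (hi : P.IsFeasible (negAt i a)) (hj : P.IsFeasible (negAt j a))
    (hb : P.IsFeasible (negAt i (negAt j a))) :
    P.pA U a (negAt i a) * P.pA U (negAt i a) (negAt i (negAt j a)) =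
      P.pA U a (negAt j a) * P.pA U (negAt j a) (negAt i (negAt j a)) :=
  (univ U hP).square a i j hij ha hi hj hb

theorem pA_loop {a : SignVec E} (ha : P.IsFeasible a) {c : E → k} (hc : c ∈ perp U)
    (hci : ∀ i, c i ≠ 0 → P.IsFeasible (negAt i a)) :
    ∑ i, c i • (P.pA U a (negAt i a) * P.pA U (negAt i a) a) = 0 :=
  (univ U hP).loop a ha c hc hci

end univ

/-- The unit vector at `i` is congruent modulo `Uᗮ` to a vector `m` supported on feasible
directions, and relation 4 turns this into an identity between the `u_j`. -/
theorem eA_mul_uA (hP : P.IsGeneric) (hU : P.IsParameterSpace U) (a : SignVec E) (i : E) :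
    ∃ m : E → k, P.eA U a * P.uA U i =
      ∑ j, m j • (P.pA U a (negAt j a) * P.pA U (negAt j a) a) := by
  by_cases ha : P.IsFeasible a
  · obtain ⟨m, hm, hmU⟩ := hU.exists_supported_negAt hP ha (Pi.single i 1)
    refine ⟨m, ?_⟩
    have h1 := A.mk_rel P U (ARel.parameter _ hmU)
    rw [map_sum, map_zero] at h1
    simp only [map_smul, Pi.sub_apply, sub_smul, Pi.single_apply, ite_smul, one_smul, zero_smul,
      Finset.sum_sub_distrib, Finset.sum_ite_eq', Finset.mem_univ, if_true] at h1
    rw [sub_eq_zero] at h1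
    rw [uA, h1, Finset.mul_sum]
    refine Finset.sum_congr rfl fun j _ => ?_
    by_cases h : m j = 0
    · simp [h]
    · rw [pA_mul_pA hP ha (hm j h), mul_smul_comm, uA]
  · exact ⟨0, by simp [eA, ha]⟩

theorem uA_eq (hP : P.IsGeneric) (hU : P.IsParameterSpace U) (i : E) :
    ∃ m : SignVec E → E → k, P.uA U i =
      ∑ a, ∑ j, m a j • (P.pA U a (negAt j a) * P.pA U (negAt j a) a) := by
  choose m hm using fun a => eA_mul_uA hP hU a i
  refine ⟨m, ?_⟩
  simp only [← hm]
  rw [← Finset.sum_mul, sum_eA hP, one_mul]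

/-- Vertices and arrows generate, because each `u_i` is a combination of products of two arrows. -/
theorem A_hom_ext (hP : P.IsGeneric) (hU : P.IsParameterSpace U) {B : Type*} [Ring B]
    [Algebra k B] {f g : P.A U →ₐ[k] B} (he : ∀ a, f (P.eA U a) = g (P.eA U a))
    (hp : ∀ a i, f (P.pA U a (negAt i a)) = g (P.pA U a (negAt i a))) : f = g := by
  have hu : ∀ i, f (P.uA U i) = g (P.uA U i) := by
    intro i
    obtain ⟨m, hm⟩ := uA_eq hP hU i
    rw [hm]
    simp only [map_sum, map_smul, map_mul, hp]
    refine Finset.sum_congr rfl fun a _ => Finset.sum_congr rfl fun j _ => ?_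
    have := hp (negAt j a) j
    rw [negAt_negAt] at this
    rw [this]
  have key : f.comp (A.mk P U) = g.comp (A.mk P U) := by
    apply Algebra.TensorProduct.ext
    · refine RingQuot.ringQuot_ext' k _ _ (FreeAlgebra.hom_ext ?_)
      funext x
      rcases x with a | ⟨a, b, h⟩
      · have := he a.1
        rw [eA_of a.2] at this
        exact this
      · have h' := h
        obtain ⟨i, hi⟩ := h'
        have := hp a.1 i
        rw [← (differAt_iff hP).1 hi, pA_of a.2 b.2 h] at this
        exact this
    · apply MvPolynomial.algHom_ext
      intro i
      exact hu i
  exact RingQuot.ringQuot_ext' k _ _ key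

namespace Realization

variable {B : Type*} [Ring B] [Algebra k B] (R : Realization P U B) (hP : P.IsGeneric)
  (hU : P.IsParameterSpace U)

theorem lift_eA (a : SignVec E) : R.lift hP hU (P.eA U a) = R.e a := by
  by_cases h : P.IsFeasible a
  · rw [eA_of h, lift_mk, polyHom_e₀, Feas.of]
  · rw [R.e_eq_zero a fun h' => h h'.1, eA, dif_neg h, map_zero]

/-- Restricted to neighbours because `R.p` is unconstrained elsewhere, while `pA` is zero. -/
theorem lift_pA (a : SignVec E) (i : E) :
    R.lift hP hU (P.pA U a (negAt i a)) = R.p a (negAt i a) := by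
  by_cases ha : P.IsFeasible a
  · by_cases hb : P.IsFeasible (negAt i a)
    · rw [pA_of ha hb (differAt_of hP ha hb rfl).adj, lift_mk, polyHom_p₀, Feas.of, Feas.of]
    · rw [R.p_eq_zero_right (fun h => hb h.1),
        pA_eq_zero_right hP (fun h => hb h.1), map_zero]
  · rw [R.p_eq_zero_left (fun h => ha h.1),
      pA_eq_zero_left hP (fun h => ha h.1), map_zero]

end Realization

end

end OMProgram

/-! ## The universal property of quotients of tensor algebras of bimodules -/

namespace QuadraticQuotient

noncomputable section

variable {k R V : Type*} [Field k] [Ring R] [Algebra k R] [AddCommGroup V] [Module k V]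
  [Module R V] [Module Rᵐᵒᵖ V] (W : Submodule k (TensorSquare k R V))

/-- The homomorphism from `R` to the quotient of `T_R(V)`. -/
def ofR : R →ₐ[k] QuadraticQuotient k R V W :=
  AlgHom.ofLinearMap ((RingQuot.mkAlgHom k (QuadraticRel k R V W)).toLinearMap ∘ₗ
    BimoduleTensorAlgebra.ofR k R V)
    (by
      have := RingQuot.mkAlgHom_rel k (BimoduleTensorRel.one (k := k) (R := R) (V := V))
      simp only [LinearMap.comp_apply, BimoduleTensorAlgebra.ofR, AlgHom.toLinearMap_apply,
        LinearMap.inl_apply]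
      rw [this, map_one, map_one])
    (by
      intro r s
      have := RingQuot.mkAlgHom_rel k (BimoduleTensorRel.mul (k := k) (V := V) r s)
      simp only [LinearMap.comp_apply, BimoduleTensorAlgebra.ofR, AlgHom.toLinearMap_apply,
        LinearMap.inl_apply]
      rw [this, map_mul, map_mul])

/-- The map from `V` to the quotient of `T_R(V)`. -/
def ofV : V →ₗ[k] QuadraticQuotient k R V W :=
  (RingQuot.mkAlgHom k (QuadraticRel k R V W)).toLinearMap ∘ₗ BimoduleTensorAlgebra.ofV k R V

theorem ofV_smul (r : R) (v : V) : ofV W (r • v) = ofR W r * ofV W v := by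
  change RingQuot.mkAlgHom k _ (BimoduleTensorAlgebra.ofV k R V (r • v)) = _
  rw [BimoduleTensorAlgebra.ofV_left, map_mul]
  rfl

theorem ofV_op_smul (r : R) (v : V) :
    ofV W (MulOpposite.op r • v) = ofV W v * ofR W r := by
  change RingQuot.mkAlgHom k _ (BimoduleTensorAlgebra.ofV k R V (MulOpposite.op r • v)) = _
  rw [BimoduleTensorAlgebra.ofV_right, map_mul]
  rfl

theorem mk_ofSquare (v w : V) :
    RingQuot.mkAlgHom k (QuadraticRel k R V W)
      (BimoduleTensorAlgebra.ofSquare k R V (Submodule.Quotient.mk (v ⊗ₜ w))) =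
      ofV W v * ofV W w := by
  have : BimoduleTensorAlgebra.ofSquare k R V (Submodule.Quotient.mk (v ⊗ₜ w)) =
    BimoduleTensorAlgebra.ofV k R V v * BimoduleTensorAlgebra.ofV k R V w := rfl
  rw [this, map_mul]
  rfl

theorem sum_ofV_mul_ofV {ι : Type*} (s : Finset ι) (c : ι → k) (v w : ι → V)
    (h : ∑ i ∈ s, c i • (Submodule.Quotient.mk (v i ⊗ₜ w i) : TensorSquare k R V) ∈ W) :
    ∑ i ∈ s, c i • (ofV W (v i) * ofV W (w i)) = 0 := by
  have := RingQuot.mkAlgHom_rel k (QuadraticRel.rel _ h)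
  rw [map_zero] at this
  rw [← this]
  simp only [map_sum, map_smul, mk_ofSquare]

theorem ofV_mul_ofV_eq {v w v' w' : V}
    (h : (Submodule.Quotient.mk (v ⊗ₜ w) : TensorSquare k R V) -
      Submodule.Quotient.mk (v' ⊗ₜ w') ∈ W) :
    ofV W v * ofV W w = ofV W v' * ofV W w' := by
  have := RingQuot.mkAlgHom_rel k (QuadraticRel.rel _ h)
  rwa [map_sub, map_sub, map_zero, sub_eq_zero, mk_ofSquare, mk_ofSquare] at this

section lift

variable {B : Type*} [Ring B] [Algebra k B] (f : R →ₐ[k] B) (g : V →ₗ[k] B)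
  (hl : ∀ r v, g (r • v) = f r * g v) (hr : ∀ r v, g (MulOpposite.op r • v) = g v * f r)

/-- The universal property of `T_R(V)`. -/
def tensorLift : BimoduleTensorAlgebra k R V →ₐ[k] B :=
  RingQuot.liftAlgHom k ⟨TensorAlgebra.lift k (LinearMap.coprod f.toLinearMap g), by
    rintro _ _ (_ | _ | _ | _) <;> simp [hl, hr]⟩

theorem tensorLift_ofV (v : V) :
    tensorLift f g hl hr (BimoduleTensorAlgebra.ofV k R V v) = g v := by
  simp [tensorLift, BimoduleTensorAlgebra.ofV]

theorem tensorLift_ofR (r : R) :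
    tensorLift f g hl hr (BimoduleTensorAlgebra.ofR k R V r) = f r := by
  simp [tensorLift, BimoduleTensorAlgebra.ofR]

/-- The map induced on `V ⊗_R V` by a homomorphism from `T_R(V)`. -/
def squareLift : TensorSquare k R V →ₗ[k] B :=
  (tensorLift f g hl hr).toLinearMap ∘ₗ BimoduleTensorAlgebra.ofSquare k R V

theorem squareLift_mk (v w : V) :
    squareLift f g hl hr (Submodule.Quotient.mk (v ⊗ₜ w)) = g v * g w := by
  have : BimoduleTensorAlgebra.ofSquare k R V (Submodule.Quotient.mk (v ⊗ₜ w)) =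
    BimoduleTensorAlgebra.ofV k R V v * BimoduleTensorAlgebra.ofV k R V w := rfl
  rw [squareLift, LinearMap.comp_apply, this, AlgHom.toLinearMap_apply, map_mul, tensorLift_ofV,
    tensorLift_ofV]

variable {W} in
/-- The universal property of the quotient of `T_R(V)` by quadratic relations. -/
def lift (hW : ∀ x ∈ W, squareLift f g hl hr x = 0) : QuadraticQuotient k R V W →ₐ[k] B :=
  RingQuot.liftAlgHom k ⟨tensorLift f g hl hr, by
    rintro _ _ ⟨x, hx⟩
    rw [map_zero]
    exact hW x hx⟩

variable (hW : ∀ x ∈ W, squareLift f g hl hr x = 0)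

theorem lift_ofV (v : V) : lift f g hl hr hW (ofV W v) = g v :=
  (RingQuot.liftAlgHom_mkAlgHom_apply _ _ _ _).trans (tensorLift_ofV f g hl hr v)

theorem lift_ofR (r : R) : lift f g hl hr hW (ofR W r) = f r :=
  (RingQuot.liftAlgHom_mkAlgHom_apply _ _ _ _).trans (tensorLift_ofR f g hl hr r)

end lift

theorem hom_ext {B : Type*} [Semiring B] [Algebra k B] {f g : QuadraticQuotient k R V W →ₐ[k] B}
    (hR : ∀ r, f (ofR W r) = g (ofR W r)) (hV : ∀ v, f (ofV W v) = g (ofV W v)) : f = g := by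
  refine RingQuot.ringQuot_ext' k _ _ (RingQuot.ringQuot_ext' k _ _ (TensorAlgebra.hom_ext ?_))
  refine LinearMap.prod_ext (LinearMap.ext fun r => ?_) (LinearMap.ext fun v => ?_)
  · exact hR r
  · exact hV v

theorem ofR_mem (r : R) : ofR W r ∈ QuadraticQuotient.grading k R V W 0 := by
  have := IsMonomial.gen_mul 0 0 _ _ (QuadraticGen.ofR (k := k) (W := W) r) .one
  rw [mul_one] at this
  exact Submodule.subset_span this

theorem ofV_mem (v : V) : ofV W v ∈ QuadraticQuotient.grading k R V W 1 := by
  have := IsMonomial.gen_mul 1 0 _ _ (QuadraticGen.ofV (k := k) (W := W) v) .one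
  rw [mul_one] at this
  exact Submodule.subset_span this

end

end QuadraticQuotient

/-! ### Graded pieces spanned by monomials in homogeneous generators. -/

/-- An algebra homomorphism maps homogeneous pieces to homogeneous pieces if it does so for the
generators. -/
theorem map_degreePiece_le {k A B : Type*} [Field k] [Ring A] [Algebra k A] [Ring B] [Algebra k B]
    {gen : ℕ → A → Prop} (𝒢 : ℕ → Submodule k B) [SetLike.GradedMonoid 𝒢] (f : A →ₐ[k] B)
    (h : ∀ j x, gen j x → f x ∈ 𝒢 j) (j : ℕ) :
    (degreePiece k gen j).map f.toLinearMap ≤ 𝒢 j := by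
  rw [Submodule.map_le_iff_le_comap, degreePiece, Submodule.span_le]
  intro x hx
  change f x ∈ 𝒢 j
  induction hx with
  | one => rw [map_one]; exact SetLike.GradedOne.one_mem
  | gen_mul i j x y hx _ ih => rw [map_mul]; exact SetLike.GradedMul.mul_mem (h i x hx) ih

theorem DirectSum.of_mul_of_eq {A σ : Type*} [Ring A] [SetLike σ A] [AddSubgroupClass σ A]
    (𝒢 : ℕ → σ) [SetLike.GradedMonoid 𝒢] {i j l : ℕ} (h : i + j = l) (x : 𝒢 i) (y : 𝒢 j) (z : 𝒢 l)
    (hz : (x : A) * y = z) : DirectSum.of (fun i => 𝒢 i) i x * DirectSum.of (fun i => 𝒢 i) j y =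
      DirectSum.of (fun i => 𝒢 i) l z := by
  subst h
  rw [DirectSum.of_mul_of]
  congr 1
  exact Subtype.ext hz

theorem DirectSum.mul_mem_range_lof {k A : Type*} [Field k] [Ring A] [Algebra k A]
    (𝒢 : ℕ → Submodule k A) [SetLike.GradedMonoid 𝒢] {i j : ℕ} {x y : DirectSum ℕ fun i => 𝒢 i}
    (hx : x ∈ LinearMap.range (DirectSum.lof k ℕ (fun i => 𝒢 i) i))
    (hy : y ∈ LinearMap.range (DirectSum.lof k ℕ (fun i => 𝒢 i) j)) :
    x * y ∈ LinearMap.range (DirectSum.lof k ℕ (fun i => 𝒢 i) (i + j)) := by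
  obtain ⟨x, rfl⟩ := hx
  obtain ⟨y, rfl⟩ := hy
  exact ⟨⟨_, SetLike.GradedMul.mul_mem x.2 y.2⟩, (DirectSum.of_mul_of_eq 𝒢 rfl _ _ _ rfl).symm⟩

/-- `f` sends the piece of degree `j` into the summand of degree `j`. Being a section of the
summation map, it must then be the inclusion of the summand on this piece, which makes it a
decomposition. -/
theorem isInternal_degreePiece {k A : Type*} [Field k] [Ring A] [Algebra k A]
    {gen : ℕ → A → Prop} (f : A →ₐ[k] DirectSum ℕ fun i => degreePiece k gen i)
    (hf : (DirectSum.coeAlgHom (degreePiece k gen)).comp f = AlgHom.id k A)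
    (hgen : ∀ j x, gen j x →
      f x ∈ LinearMap.range (DirectSum.lof k ℕ (fun i => degreePiece k gen i) j)) :
    DirectSum.IsInternal (degreePiece k gen) := by
  have hrange : ∀ j, degreePiece k gen j ≤ (LinearMap.range
      (DirectSum.lof k ℕ (fun i => degreePiece k gen i) j)).comap f.toLinearMap := by
    intro j
    refine Submodule.span_le.2 fun x hx => ?_
    change f x ∈ LinearMap.range (DirectSum.lof k ℕ (fun i => degreePiece k gen i) j)
    induction hx with
    | one => rw [map_one]; exact ⟨⟨1, SetLike.GradedOne.one_mem⟩, rfl⟩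
    | gen_mul i j x y hx _ ih =>
      rw [map_mul]
      exact DirectSum.mul_mem_range_lof _ (hgen i x hx) ih
  have hleft : ∀ i (x : degreePiece k gen i), f (x : A) =
      DirectSum.of (fun i => degreePiece k gen i) i x := by
    intro i x
    obtain ⟨y, hy⟩ := hrange i x.2
    have h1 : (x : A) = y := by
      have h2 : DirectSum.coeAlgHom (degreePiece k gen) (f (x : A)) = x :=
        DFunLike.congr_fun hf (x : A)
      rw [← h2]
      change DirectSum.coeAlgHom (degreePiece k gen) (f.toLinearMap (x : A)) = y
      rw [← hy]
      exact DirectSum.coeAlgHom_of _ _ _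
    change f.toLinearMap (x : A) = _
    rw [← hy, Subtype.ext h1]
    rfl
  have : GradedAlgebra (degreePiece k gen) := GradedAlgebra.ofAlgHom _ f hf hleft
  exact DirectSum.Decomposition.isInternal _

theorem DirectSum.sum_of_mul_of_eq_zero {k A ι : Type*} [Field k] [Ring A] [Algebra k A]
    (𝒢 : ℕ → Submodule k A) [SetLike.GradedMonoid 𝒢] {i j : ℕ} (s : Finset ι) (c : ι → k)
    (x : ι → 𝒢 i) (y : ι → 𝒢 j) (h : ∑ t ∈ s, c t • ((x t : A) * y t) = 0) :
    ∑ t ∈ s, c t • (DirectSum.of (fun i => 𝒢 i) i (x t) * DirectSum.of (fun i => 𝒢 i) j (y t)) =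
      0 := by
  let z : ι → 𝒢 (i + j) := fun t => ⟨x t * y t, SetLike.GradedMul.mul_mem (x t).2 (y t).2⟩
  have h1 : ∀ t, DirectSum.of (fun i => 𝒢 i) i (x t) * DirectSum.of (fun i => 𝒢 i) j (y t) =
      DirectSum.lof k ℕ (fun i => 𝒢 i) (i + j) (z t) := fun t =>
    DirectSum.of_mul_of_eq 𝒢 rfl _ _ _ rfl
  have h2 : ∑ t ∈ s, c t • z t = 0 := by
    refine Subtype.ext ?_
    rw [AddSubmonoidClass.coe_finsetSum]
    exact h
  simp only [h1]
  simp only [← map_smul, ← map_sum]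
  rw [h2, map_zero]

/-! ### The algebra `A(P, U)` is quadratic. -/

namespace OMProgram

noncomputable section

open scoped Classical

variable {E : Type*} [Fintype E] {k : Type*} [Field k] {P : OMProgram E} {U : Submodule k (E → k)}

theorem gen_mem {j : ℕ} {x : P.A U} (h : P.AGen U j x) : x ∈ P.gradingA U j := by
  have := IsMonomial.gen_mul j 0 _ _ h .one
  rw [mul_one] at this
  exact Submodule.subset_span this

variable (P U) in
theorem eA_mem (a : SignVec E) : P.eA U a ∈ P.gradingA U 0 := by
  by_cases h : P.IsFeasible a
  · rw [eA_of h]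
    exact gen_mem (.e _)
  · rw [eA, dif_neg h]
    exact zero_mem _

variable (P U) in
theorem pA_mem (a b : SignVec E) : P.pA U a b ∈ P.gradingA U 1 := by
  by_cases h : ∃ (ha : P.IsFeasible a) (hb : P.IsFeasible b), P.Adj (.of ha) (.of hb)
  · obtain ⟨ha, hb, hab⟩ := h
    rw [pA_of ha hb hab]
    exact gen_mem (.p _ _ _)
  · rw [pA, dif_neg h]
    exact zero_mem _

/-- The `u_i` have degree two and cannot occur here. The two degrees are treated together because a
vertex may stand in front of a monomial of degree one. -/
theorem monomial_mem (hP : P.IsGeneric) {j : ℕ} {x : P.A U} (hx : IsMonomial (P.AGen U) j x) :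
    (j = 0 → x ∈ Submodule.span k (Set.range (P.eA U))) ∧
    (j = 1 → x ∈ Submodule.span k (Set.range fun ab : SignVec E × SignVec E =>
      P.pA U ab.1 ab.2)) := by
  induction hx with
  | one =>
    refine ⟨fun _ => ?_, fun h => absurd h (by decide)⟩
    rw [← sum_eA hP]
    exact Submodule.sum_mem _ fun a _ => Submodule.subset_span ⟨a, rfl⟩
  | gen_mul i j x y hx _ ih =>
    have mul_mem_span : ∀ {ι : Type _} {κ : Type _} (F : ι → P.A U) (G : κ → P.A U) (x y : P.A U),
        y ∈ Submodule.span k (Set.range F) →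
        (∀ i, x * F i ∈ Submodule.span k (Set.range G)) →
        x * y ∈ Submodule.span k (Set.range G) := by
      intro ι κ F G x y hy hx
      have : Submodule.span k (Set.range F) ≤
          (Submodule.span k (Set.range G)).comap (LinearMap.mulLeft k x) := by
        rw [Submodule.span_le]
        rintro _ ⟨i, rfl⟩
        exact hx i
      exact this hy
    rcases hx with a | ⟨a, b, h⟩ | _
    · rw [mk_e₀, zero_add]
      refine ⟨fun hj => mul_mem_span _ _ _ _ (ih.1 hj) fun b => ?_,
        fun hj => mul_mem_span _ _ _ _ (ih.2 hj) fun b => ?_⟩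
      · rw [eA_mul_eA hP]
        split_ifs
        · exact Submodule.subset_span ⟨_, rfl⟩
        · exact zero_mem _
      · rw [eA_mul_pA hP]
        split_ifs
        · exact Submodule.subset_span ⟨b, rfl⟩
        · exact zero_mem _
    · rw [mk_p₀]
      refine ⟨fun hj => by omega, fun hj => mul_mem_span _ _ _ _ (ih.1 (by omega)) fun c => ?_⟩
      rw [pA_mul_eA hP]
      split_ifs
      · exact Submodule.subset_span ⟨(a.1, b.1), rfl⟩
      · exact zero_mem _
    · exact ⟨fun hj => by omega, fun hj => by omega⟩

variable (P U) in
/-- The vertices as elements of `A₀`. -/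
def eZero (a : SignVec E) : DegZero (P.gradingA U) := ⟨P.eA U a, eA_mem P U a⟩

variable (P U) in
/-- The arrows as elements of `A₁`. -/
def pOne (a b : SignVec E) : DegOne (P.gradingA U) := ⟨P.pA U a b, pA_mem P U a b⟩

theorem incl_pOne (a b : SignVec E) : DegOne.incl (P.gradingA U) (P.pOne U a b) = P.pA U a b := rfl

theorem exists_eq_sum_eZero (hP : P.IsGeneric) (r : DegZero (P.gradingA U)) :
    ∃ c : SignVec E → k, r = ∑ a, c a • P.eZero U a := by
  have : (r : P.A U) ∈ Submodule.span k (Set.range (P.eA U)) := by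
    have hle : P.gradingA U 0 ≤ Submodule.span k (Set.range (P.eA U)) :=
      Submodule.span_le.2 fun x hx => (monomial_mem hP hx).1 rfl
    exact hle r.2
  obtain ⟨c, hc⟩ := (Submodule.mem_span_range_iff_exists_fun k).1 this
  refine ⟨c, Subtype.ext ?_⟩
  rw [← hc]
  simp [eZero]

theorem exists_eq_sum_pOne (hP : P.IsGeneric) (v : DegOne (P.gradingA U)) :
    ∃ c : SignVec E × SignVec E → k, v = ∑ ab, c ab • P.pOne U ab.1 ab.2 := by
  have : DegOne.incl _ v ∈ Submodule.span k
      (Set.range fun ab : SignVec E × SignVec E => P.pA U ab.1 ab.2) := by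
    have hle : P.gradingA U 1 ≤ Submodule.span k
        (Set.range fun ab : SignVec E × SignVec E => P.pA U ab.1 ab.2) :=
      Submodule.span_le.2 fun x hx => (monomial_mem hP hx).2 rfl
    exact hle v.2
  obtain ⟨c, hc⟩ := (Submodule.mem_span_range_iff_exists_fun k).1 this
  refine ⟨c, DegOne.incl_injective _ ?_⟩
  rw [← hc]
  simp [incl_pOne]

/-- `A₀` is spanned by orthogonal idempotents with sum `1`, hence a quotient of a finite product of
copies of `k`. -/
theorem isSemisimpleRing_degZero (hP : P.IsGeneric) :
    IsSemisimpleRing (DegZero (P.gradingA U)) := by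
  have hmul : ∀ a b, P.eZero U a * P.eZero U b = if a = b then P.eZero U a else 0 := by
    intro a b
    refine Subtype.ext ((eA_mul_eA hP a b).trans ?_)
    split_ifs <;> rfl
  let f : (SignVec E → k) →+* DegZero (P.gradingA U) :=
    { toFun := fun c => ∑ a, c a • P.eZero U a
      map_one' := by
        refine Subtype.ext ?_
        have := (univ U hP).sum_e
        simpa [eZero, univ] using this
      map_mul' := fun c d => by
        simp only [Finset.sum_mul_sum, smul_mul_smul_comm, hmul, smul_ite, smul_zero,
          Finset.sum_ite_eq, Finset.mem_univ, if_true, Pi.mul_apply]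
      map_zero' := by simp
      map_add' := fun c d => by simp [add_smul, Finset.sum_add_distrib] }
  refine RingHom.isSemisimpleRing_of_surjective f fun r => ?_
  obtain ⟨c, hc⟩ := exists_eq_sum_eZero hP r
  exact ⟨c, hc.symm⟩

variable (U) in
/-- The realization in the direct sum of the homogeneous pieces. -/
def directSumRealization (hP : P.IsGeneric) :
    Realization P U (DirectSum ℕ fun i => P.gradingA U i) where
  e a := DirectSum.of (fun i => P.gradingA U i) 0 ⟨_, eA_mem P U a⟩
  p a b := DirectSum.of (fun i => P.gradingA U i) 1 ⟨_, pA_mem P U a b⟩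
  e_eq_zero a ha := by
    convert map_zero (DirectSum.of (fun i => P.gradingA U i) 0)
    exact (univ U hP).e_eq_zero a ha
  e_mul_self a := DirectSum.of_mul_of_eq _ rfl _ _ _ ((univ U hP).e_mul_self a)
  e_mul_of_ne a b h := by
    rw [← map_zero (DirectSum.of (fun i => P.gradingA U i) 0)]
    exact DirectSum.of_mul_of_eq _ rfl _ _ _ ((univ U hP).e_mul_of_ne a b h)
  sum_e := by
    rw [← map_sum, DirectSum.one_def]
    congr 1
    refine Subtype.ext ?_
    rw [AddSubmonoidClass.coe_finsetSum]
    exact (univ U hP).sum_e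
  e_mul_p a b := DirectSum.of_mul_of_eq _ rfl _ _ _ ((univ U hP).e_mul_p a b)
  p_mul_e a b := DirectSum.of_mul_of_eq _ rfl _ _ _ ((univ U hP).p_mul_e a b)
  square a i j hij ha hi hj hb :=
    (DirectSum.of_mul_of_eq (P.gradingA U) (l := 1 + 1) rfl _ _ ⟨_, SetLike.GradedMul.mul_mem
      (pA_mem P U a (negAt j a)) (pA_mem P U (negAt j a) (negAt i (negAt j a)))⟩
      (pA_square hP hij ha hi hj hb)).trans
    (DirectSum.of_mul_of_eq (P.gradingA U) rfl _ _ _ rfl).symm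
  loop a ha c hc hci :=
    DirectSum.sum_of_mul_of_eq_zero (P.gradingA U) Finset.univ c
      (fun i => ⟨_, pA_mem P U a (negAt i a)⟩) (fun i => ⟨_, pA_mem P U (negAt i a) a⟩)
      (pA_loop hP ha hc hci)

/-- The relations of a realization are homogeneous, so they hold in the external direct sum of the
pieces, and the universal property yields the required section. -/
theorem isInternal_gradingA (hP : P.IsGeneric) (hU : P.IsParameterSpace U) :
    DirectSum.IsInternal (P.gradingA U) := by
  refine isInternal_degreePiece ((directSumRealization U hP).lift hP hU) ?_ ?_
  · refine A_hom_ext hP hU (fun a => ?_) fun a i => ?_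
    · rw [AlgHom.comp_apply, Realization.lift_eA]
      exact DirectSum.coeAlgHom_of _ _ _
    · rw [AlgHom.comp_apply, Realization.lift_pA]
      exact DirectSum.coeAlgHom_of _ _ _
  · rintro _ _ (a | ⟨a, b, h⟩ | i)
    · rw [mk_e₀, Realization.lift_eA]
      exact ⟨_, rfl⟩
    · have h' := h
      obtain ⟨i, hi⟩ := h'
      rw [mk_p₀, (differAt_iff hP).1 hi, Realization.lift_pA]
      exact ⟨_, rfl⟩
    -- As a combination of products of two arrows, `u_i` lands in degree `1 + 1 = 2`.
    · obtain ⟨m, hm⟩ := uA_eq hP hU i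
      change (directSumRealization U hP).lift hP hU (P.uA U i) ∈ _
      rw [hm, map_sum]
      refine Submodule.sum_mem _ fun a _ => ?_
      rw [map_sum]
      refine Submodule.sum_mem _ fun j _ => ?_
      rw [map_smul, map_mul]
      refine Submodule.smul_mem _ _ ?_
      have := (directSumRealization U hP).lift_pA hP hU (negAt j a) j
      rw [negAt_negAt] at this
      rw [Realization.lift_pA, this]
      exact DirectSum.mul_mem_range_lof (i := 1) (j := 1) (P.gradingA U) ⟨_, rfl⟩ ⟨_, rfl⟩

variable (P U) in
/-- The algebra `T_{A₀}(A₁) / (W)`. -/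
abbrev QuadraticCover : Type _ :=
  QuadraticQuotient k (DegZero (P.gradingA U)) (DegOne (P.gradingA U))
    (quadraticRelations (P.gradingA U))

theorem mem_quadraticRelations {ι : Type*} {s : Finset ι} {c : ι → k}
    {v w : ι → DegOne (P.gradingA U)}
    (h : ∑ i ∈ s, c i • (DegOne.incl _ (v i) * DegOne.incl _ (w i)) = 0) :
    ∑ i ∈ s, c i • (Submodule.Quotient.mk (v i ⊗ₜ w i) :
      TensorSquare k (DegZero (P.gradingA U)) (DegOne (P.gradingA U))) ∈
      quadraticRelations (P.gradingA U) := by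
  change squareToAlgebra (P.gradingA U) _ = 0
  rw [map_sum, ← h]
  refine Finset.sum_congr rfl fun i _ => ?_
  rw [map_smul]
  rfl

variable (U) in
/-- The realization in `T_{A₀}(A₁) / (W)`. -/
def quadraticRealization (hP : P.IsGeneric) : Realization P U (P.QuadraticCover U) where
  e a := QuadraticQuotient.ofR _ (P.eZero U a)
  p a b := QuadraticQuotient.ofV _ (P.pOne U a b)
  e_eq_zero a ha := by
    convert map_zero (QuadraticQuotient.ofR (quadraticRelations (P.gradingA U)))
    exact Subtype.ext ((univ U hP).e_eq_zero a ha)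
  e_mul_self a := by
    rw [← map_mul]
    congr 1
    exact Subtype.ext ((univ U hP).e_mul_self a)
  e_mul_of_ne a b h := by
    rw [← map_mul, ← map_zero (QuadraticQuotient.ofR (quadraticRelations (P.gradingA U)))]
    congr 1
    exact Subtype.ext ((univ U hP).e_mul_of_ne a b h)
  sum_e := by
    rw [← map_sum, ← map_one (QuadraticQuotient.ofR (quadraticRelations (P.gradingA U)))]
    congr 1
    refine Subtype.ext ?_
    have := (univ U hP).sum_e
    simpa [eZero, univ] using this
  e_mul_p a b := by
    rw [← QuadraticQuotient.ofV_smul]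
    congr 1
    exact DegOne.incl_injective _ ((univ U hP).e_mul_p a b)
  p_mul_e a b := by
    rw [← QuadraticQuotient.ofV_op_smul]
    congr 1
    exact DegOne.incl_injective _ ((univ U hP).p_mul_e a b)
  square a i j hij ha hi hj hb := by
    refine QuadraticQuotient.ofV_mul_ofV_eq _ ?_
    change squareToAlgebra (P.gradingA U) _ = 0
    rw [map_sub, sub_eq_zero]
    exact pA_square hP hij ha hi hj hb
  loop a ha c hc hci :=
    QuadraticQuotient.sum_ofV_mul_ofV (quadraticRelations (P.gradingA U)) Finset.univ c
      (fun i => P.pOne U a (negAt i a)) (fun i => P.pOne U (negAt i a) a)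
      (mem_quadraticRelations ((univ U hP).loop a ha c hc hci))

theorem quadraticToAlgebra_ofV (v : DegOne (P.gradingA U)) :
    quadraticToAlgebra (P.gradingA U) (QuadraticQuotient.ofV _ v) = DegOne.incl _ v :=
  (RingQuot.liftAlgHom_mkAlgHom_apply _ _ _ _).trans (tensorToAlgebra_ofV _ v)

theorem quadraticToAlgebra_ofR (r : DegZero (P.gradingA U)) :
    quadraticToAlgebra (P.gradingA U) (QuadraticQuotient.ofR _ r) = r :=
  (RingQuot.liftAlgHom_mkAlgHom_apply _ _ _ _).trans (by
    simp [tensorToAlgebra, BimoduleTensorAlgebra.ofR])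

theorem degOne_ext (hP : P.IsGeneric) {B : Type*} [AddCommMonoid B] [Module k B]
    {f g : DegOne (P.gradingA U) →ₗ[k] B}
    (h : ∀ a i, f (P.pOne U a (negAt i a)) = g (P.pOne U a (negAt i a))) : f = g := by
  ext v
  obtain ⟨c, rfl⟩ := exists_eq_sum_pOne hP v
  rw [map_sum, map_sum]
  refine Finset.sum_congr rfl fun ab _ => ?_
  rw [map_smul, map_smul]
  congr 1
  by_cases hab : ∃ i, ab.2 = negAt i ab.1
  · obtain ⟨i, hi⟩ := hab
    rw [hi, h]
  · have : P.pOne U ab.1 ab.2 = 0 :=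
      DegOne.incl_injective _ (pA_eq_zero hP fun i hi => hab ⟨i, hi⟩)
    rw [this, map_zero, map_zero]

theorem degZero_ext (hP : P.IsGeneric) {B : Type*} [AddCommMonoid B] [Module k B]
    {f g : DegZero (P.gradingA U) →ₗ[k] B}
    (h : ∀ a, f (P.eZero U a) = g (P.eZero U a)) : f = g := by
  ext r
  obtain ⟨c, rfl⟩ := exists_eq_sum_eZero hP r
  simp only [map_sum, map_smul, h]

/-- The relations of a realization either take place in `A₀` and its action on `A₁`, or are
quadratic in the arrows and so belong to `W`. They therefore hold in `T_{A₀}(A₁)/(W)`, which gives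
the inverse. -/
theorem bijective_quadraticToAlgebra (hP : P.IsGeneric) (hU : P.IsParameterSpace U) :
    Function.Bijective (quadraticToAlgebra (P.gradingA U)) := by
  let f := (quadraticRealization U hP).lift hP hU
  have h1 : (quadraticToAlgebra (P.gradingA U)).comp f = AlgHom.id k _ := by
    refine A_hom_ext hP hU (fun a => ?_) fun a i => ?_
    · rw [AlgHom.comp_apply, Realization.lift_eA]
      exact quadraticToAlgebra_ofR _
    · rw [AlgHom.comp_apply, Realization.lift_pA]
      exact quadraticToAlgebra_ofV _
  have h2 : f.comp (quadraticToAlgebra (P.gradingA U)) = AlgHom.id k _ := by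
    apply QuadraticQuotient.hom_ext
    · intro r
      rw [AlgHom.comp_apply, quadraticToAlgebra_ofR]
      refine LinearMap.congr_fun (degZero_ext hP (f := f.toLinearMap ∘ₗ
        (DegZero (P.gradingA U)).val.toLinearMap)
        (g := (QuadraticQuotient.ofR (quadraticRelations (P.gradingA U))).toLinearMap) fun a => ?_) r
      exact Realization.lift_eA _ hP hU a
    · intro v
      rw [AlgHom.comp_apply, quadraticToAlgebra_ofV]
      refine LinearMap.congr_fun (degOne_ext hP (f := f.toLinearMap ∘ₗ
        DegOne.incl (P.gradingA U)) (g := QuadraticQuotient.ofV _) fun a i => ?_) v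
      exact Realization.lift_pA _ hP hU a i
  exact Function.bijective_iff_has_inverse.2
    ⟨f, fun x => DFunLike.congr_fun h2 x, fun x => DFunLike.congr_fun h1 x⟩

theorem isQuadraticAlgebra (hP : P.IsGeneric) (hU : P.IsParameterSpace U) :
    IsQuadraticAlgebra (P.gradingA U) :=
  ⟨isInternal_gradingA hP hU, isSemisimpleRing_degZero hP, bijective_quadraticToAlgebra hP hU⟩

end

end OMProgram

namespace OMProgram

noncomputable section

open scoped Classical

variable {E : Type*} [Fintype E] {k : Type*} [Field k]

/-! ## Representations by block matrices -/

/-- Block matrices with rows and columns indexed by the bounded feasible topes. -/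
abbrev BlockMatrix (P : OMProgram E) (k : Type*) : Type _ :=
  Matrix {a : SignVec E // P.Bdd a} {a : SignVec E // P.Bdd a} (Matrix (Fin 3) (Fin 3) k)

/-- The block matrix with the block `x` at the position `(a, b)`; it vanishes if one of `a` and `b`
does not belong to the index set. -/
def block (P : OMProgram E) (a b : SignVec E) (x : Matrix (Fin 3) (Fin 3) k) : P.BlockMatrix k :=
  Matrix.of fun i j => if i.1 = a ∧ j.1 = b then x else 0

/-- The entry at the position `(i, j)` of the block at the position `(a, b)`. -/
def blockEntry (P : OMProgram E) (a b : SignVec E) (i j : Fin 3) : P.BlockMatrix k →ₗ[k] k :=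
  if h : P.Bdd a ∧ P.Bdd b then
    { toFun := fun M => M ⟨a, h.1⟩ ⟨b, h.2⟩ i j
      map_add' := fun _ _ => rfl
      map_smul' := fun _ _ => rfl } else 0

section block

variable {P : OMProgram E}

theorem blockEntry_block (a b c d : SignVec E) (i j : Fin 3) (x : Matrix (Fin 3) (Fin 3) k) :
    P.blockEntry a b i j (P.block c d x) =
      if (P.Bdd a ∧ P.Bdd b) ∧ a = c ∧ b = d then x i j else 0 := by
  by_cases h : P.Bdd a ∧ P.Bdd b
  · rw [blockEntry, dif_pos h]
    change (if a = c ∧ b = d then x else 0) i j = _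
    simp only [h, true_and, and_self]
    split_ifs <;> rfl
  · simp [blockEntry, h]

theorem block_eq_zero_left {a : SignVec E} (h : ¬ P.Bdd a) (b : SignVec E)
    (x : Matrix (Fin 3) (Fin 3) k) : P.block a b x = 0 := by
  ext1 i j
  exact if_neg fun hi : i.1 = a ∧ j.1 = b => h (hi.1 ▸ i.2)

theorem block_eq_zero_right {b : SignVec E} (h : ¬ P.Bdd b) (a : SignVec E)
    (x : Matrix (Fin 3) (Fin 3) k) : P.block a b x = 0 := by
  ext1 i j
  exact if_neg fun hi : i.1 = a ∧ j.1 = b => h (hi.2 ▸ j.2)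

theorem block_mul_block_of_ne {b c : SignVec E} (h : b ≠ c) (a d : SignVec E)
    (x y : Matrix (Fin 3) (Fin 3) k) : P.block a b x * P.block c d y = 0 := by
  ext1 i j
  rw [Matrix.mul_apply]
  refine Finset.sum_eq_zero fun l _ => ?_
  simp only [block, Matrix.of_apply]
  by_cases hl : l.1 = b
  · rw [if_neg (c := l.1 = c ∧ j.1 = d) fun h' => h (hl.symm.trans h'.1), mul_zero]
  · rw [if_neg fun h' => hl h'.2, zero_mul]

/-- Only bounded feasible `b` occur as matrix indices; for any other `b` the middle index is
missing. -/
theorem block_mul_block (a b d : SignVec E) (x y : Matrix (Fin 3) (Fin 3) k) :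
    P.block a b x * P.block b d y = P.block a d (if P.Bdd b then x * y else 0) := by
  ext1 i j
  rw [Matrix.mul_apply]
  split_ifs with hb
  · rw [Finset.sum_eq_single (⟨b, hb⟩ : {a : SignVec E // P.Bdd a})]
    · simp only [block, Matrix.of_apply]
      by_cases h1 : i.1 = a <;> by_cases h2 : j.1 = d <;> simp [h1, h2]
    · intro l _ hl
      have : l.1 ≠ b := fun h => hl (Subtype.ext h)
      simp [block, this]
    · simp
  · rw [Finset.sum_eq_zero]
    · simp [block]
    · intro l _
      have : l.1 ≠ b := fun h => hb (h ▸ l.2)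
      simp [block, this]

theorem block_zero (a b : SignVec E) : P.block a b (0 : Matrix (Fin 3) (Fin 3) k) = 0 := by
  ext1 i j
  simp [block]

theorem block_smul (a b : SignVec E) (c : k) (x : Matrix (Fin 3) (Fin 3) k) :
    c • P.block a b x = P.block a b (c • x) := by
  ext1 i j
  simp [block]

theorem block_sum {ι : Type*} (s : Finset ι) (a b : SignVec E)
    (x : ι → Matrix (Fin 3) (Fin 3) k) :
    ∑ t ∈ s, P.block a b (x t) = P.block a b (∑ t ∈ s, x t) := by
  ext1 i j
  rw [Matrix.sum_apply]
  simp only [block, Matrix.of_apply]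
  split_ifs <;> simp

theorem sum_block_one : ∑ a, P.block a a (1 : Matrix (Fin 3) (Fin 3) k) = 1 := by
  ext1 i j
  rw [Matrix.sum_apply, Finset.sum_eq_single i.1]
  · simp only [block, Matrix.of_apply, true_and, Matrix.one_apply]
    by_cases h : i = j
    · simp [h]
    · rw [if_neg h, if_neg fun h' => h (Subtype.ext h'.symm)]
  · intro b _ hb
    simp [block, hb.symm]
  · simp

variable (P)

/-- The realization in block matrices with the block `N a b` for the arrow from `a` to `b`. -/
def blockRealization (U : Submodule k (E → k))
    (N : SignVec E → SignVec E → Matrix (Fin 3) (Fin 3) k)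
    (hsq : ∀ a i j, i ≠ j → P.IsFeasible a → P.IsFeasible (negAt i a) →
      P.IsFeasible (negAt j a) → P.IsFeasible (negAt i (negAt j a)) →
      (if P.Bdd (negAt i a) then N a (negAt i a) * N (negAt i a) (negAt i (negAt j a)) else 0) =
        if P.Bdd (negAt j a) then N a (negAt j a) * N (negAt j a) (negAt i (negAt j a)) else 0)
    (hloop : ∀ a, P.IsFeasible a → ∀ c ∈ perp U, (∀ i, c i ≠ 0 → P.IsFeasible (negAt i a)) →
      ∑ i, c i • (if P.Bdd (negAt i a) then N a (negAt i a) * N (negAt i a) a else 0) = 0) :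
    Realization P U (P.BlockMatrix k) where
  e a := P.block a a 1
  p a b := P.block a b (N a b)
  e_eq_zero _ ha := block_eq_zero_left ha _ _
  e_mul_self a := by
    rw [block_mul_block]
    split_ifs with h
    · rw [one_mul]
    · rw [block_eq_zero_left h, block_eq_zero_left h]
  e_mul_of_ne _ _ h := block_mul_block_of_ne h _ _ _ _
  sum_e := sum_block_one
  e_mul_p a b := by
    rw [block_mul_block]
    split_ifs with h
    · rw [one_mul]
    · rw [block_eq_zero_left h, block_eq_zero_left h]
  p_mul_e a b := by
    rw [block_mul_block]
    split_ifs with h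
    · rw [mul_one]
    · rw [block_eq_zero_right h, block_eq_zero_right h]
  square a i j hij ha hi hj hb := by
    rw [block_mul_block, block_mul_block, hsq a i j hij ha hi hj hb]
  loop a ha c hc hci := by
    simp only [block_mul_block, block_smul]
    rw [block_sum, hloop a ha c hc hci, block_zero]

/-- The realization in which all products of two arrows vanish. -/
def squareZeroRealization (U : Submodule k (E → k)) : Realization P U (P.BlockMatrix k) :=
  P.blockRealization U (fun _ _ => Matrix.single 0 1 1) (by simp) (by simp)

end block

/-! ## Coordinates on `A₀` and `A₁` -/

section coefficients

variable {P : OMProgram E} {U : Submodule k (E → k)} (hP : P.IsGeneric) (hU : P.IsParameterSpace U)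

/-- The coordinates on `A₀` with respect to the vertices. -/
def vertexCoeff (a : SignVec E) : DegZero (P.gradingA U) →ₗ[k] k :=
  P.blockEntry a a 0 0 ∘ₗ ((P.squareZeroRealization U).lift hP hU).toLinearMap ∘ₗ
    (DegZero (P.gradingA U)).val.toLinearMap

/-- The coordinates on `A₁` with respect to the arrows. -/
def arrowCoeff (a b : SignVec E) : DegOne (P.gradingA U) →ₗ[k] k :=
  P.blockEntry a b 0 1 ∘ₗ ((P.squareZeroRealization U).lift hP hU).toLinearMap ∘ₗ
    DegOne.incl (P.gradingA U)

/-- Shows that no bounded vertex vanishes in `A(P, U)` and that these vertices are independent. -/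
theorem vertexCoeff_eZero (a b : SignVec E) :
    vertexCoeff hP hU a (P.eZero U b) = if P.Bdd a ∧ a = b then 1 else 0 := by
  change P.blockEntry a a 0 0 ((P.squareZeroRealization U).lift hP hU (P.eA U b)) = _
  rw [Realization.lift_eA]
  refine (blockEntry_block _ _ _ _ _ _ _).trans ?_
  simp

theorem vertexCoeff_of_not_bdd {a : SignVec E} (h : ¬ P.Bdd a) :
    vertexCoeff hP hU a = 0 := by
  refine degZero_ext hP fun b => ?_
  rw [vertexCoeff_eZero, if_neg fun h' => h h'.1, LinearMap.zero_apply]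

/-- In the square-zero realization every product of two arrows is zero, so the relations between
paths hold trivially, while arrows between bounded vertices have nonzero blocks at distinct
positions. Hence these arrows form a basis of `A₁`. -/
theorem arrowCoeff_pOne (a b c : SignVec E) (i : E) :
    arrowCoeff hP hU a b (P.pOne U c (negAt i c)) =
      if (P.Bdd a ∧ P.Bdd b) ∧ a = c ∧ b = negAt i c then 1 else 0 := by
  change P.blockEntry a b 0 1 ((P.squareZeroRealization U).lift hP hU (P.pA U c (negAt i c))) = _
  rw [Realization.lift_pA]
  refine (blockEntry_block _ _ _ _ _ _ _).trans ?_
  simp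

theorem arrowCoeff_of_not_bdd {a b : SignVec E} (h : ¬ (P.Bdd a ∧ P.Bdd b)) :
    arrowCoeff hP hU a b = 0 := by
  refine degOne_ext hP fun c i => ?_
  rw [arrowCoeff_pOne, if_neg fun h' => h h'.1, LinearMap.zero_apply]

theorem eZero_eq_zero (hP : P.IsGeneric) {a : SignVec E} (h : ¬ P.Bdd a) : P.eZero U a = 0 :=
  Subtype.ext (eA_eq_zero hP h)

theorem pOne_eq_zero_left (hP : P.IsGeneric) {a : SignVec E} (h : ¬ P.Bdd a) (b : SignVec E) : P.pOne U a b = 0 :=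
  DegOne.incl_injective _ (pA_eq_zero_left hP h b)

theorem pOne_eq_zero_right (hP : P.IsGeneric) {b : SignVec E} (h : ¬ P.Bdd b) (a : SignVec E) : P.pOne U a b = 0 :=
  DegOne.incl_injective _ (pA_eq_zero_right hP h a)

theorem pOne_eq_zero (hP : P.IsGeneric) {a b : SignVec E} (h : ∀ i, b ≠ negAt i a) : P.pOne U a b = 0 :=
  DegOne.incl_injective _ (pA_eq_zero hP h)

theorem eZero_mul_eZero (hP : P.IsGeneric) (a b : SignVec E) :
    P.eZero U a * P.eZero U b = if a = b then P.eZero U a else 0 := by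
  refine Subtype.ext ((eA_mul_eA hP a b).trans ?_)
  split_ifs <;> rfl

theorem mul_eZero (r : DegZero (P.gradingA U)) (a : SignVec E) :
    r * P.eZero U a = vertexCoeff hP hU a r • P.eZero U a := by
  refine LinearMap.congr_fun (degZero_ext hP (f := LinearMap.mulRight k (P.eZero U a))
    (g := (vertexCoeff hP hU a).smulRight (P.eZero U a)) fun b => ?_) r
  rw [LinearMap.mulRight_apply, LinearMap.smulRight_apply, eZero_mul_eZero hP, vertexCoeff_eZero]
  by_cases hab : a = b
  · subst hab
    by_cases ha : P.Bdd a
    · simp [ha]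
    · simp [eZero_eq_zero hP ha]
  · simp [hab, Ne.symm hab]

theorem eZero_mul (r : DegZero (P.gradingA U)) (a : SignVec E) :
    P.eZero U a * r = vertexCoeff hP hU a r • P.eZero U a := by
  refine LinearMap.congr_fun (degZero_ext hP (f := LinearMap.mulLeft k (P.eZero U a))
    (g := (vertexCoeff hP hU a).smulRight (P.eZero U a)) fun b => ?_) r
  rw [LinearMap.mulLeft_apply, LinearMap.smulRight_apply, eZero_mul_eZero hP, vertexCoeff_eZero]
  by_cases hab : a = b
  · subst hab
    by_cases ha : P.Bdd a
    · simp [ha]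
    · simp [eZero_eq_zero hP ha]
  · simp [hab]

theorem sum_vertexCoeff_smul (r : DegZero (P.gradingA U)) :
    ∑ a, vertexCoeff hP hU a r • P.eZero U a = r := by
  have h : ∑ a, P.eZero U a = 1 := by
    refine Subtype.ext ?_
    simpa [eZero] using sum_eA (U := U) hP
  simp only [← mul_eZero hP hU r]
  rw [← Finset.mul_sum, h, mul_one]

theorem vertexCoeff_mul (r s : DegZero (P.gradingA U)) (a : SignVec E) :
    vertexCoeff hP hU a (r * s) = vertexCoeff hP hU a r * vertexCoeff hP hU a s := by
  by_cases ha : P.Bdd a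
  · have h := congrArg (vertexCoeff hP hU a) (mul_assoc r s (P.eZero U a))
    rw [mul_eZero hP hU, mul_eZero hP hU, mul_smul_comm, mul_eZero hP hU] at h
    simpa [vertexCoeff_eZero, ha, mul_comm] using h
  · simp [vertexCoeff_of_not_bdd hP hU ha]

theorem vertexCoeff_one {a : SignVec E} (ha : P.Bdd a) : vertexCoeff hP hU a 1 = 1 := by
  have h := congrArg (vertexCoeff hP hU a) (one_mul (P.eZero U a))
  rw [mul_eZero hP hU, map_smul, vertexCoeff_eZero, if_pos ⟨ha, rfl⟩, smul_eq_mul, mul_one] at h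
  exact h

theorem eZero_smul_pOne (hP : P.IsGeneric) (a b : SignVec E) : P.eZero U a • P.pOne U a b = P.pOne U a b :=
  DegOne.incl_injective _ ((univ U hP).e_mul_p a b)

theorem op_eZero_smul_pOne (hP : P.IsGeneric) (a b : SignVec E) :
    MulOpposite.op (P.eZero U b) • P.pOne U a b = P.pOne U a b :=
  DegOne.incl_injective _ ((univ U hP).p_mul_e a b)

theorem smul_pOne (r : DegZero (P.gradingA U)) (a b : SignVec E) :
    r • P.pOne U a b = vertexCoeff hP hU a r • P.pOne U a b := by
  conv_lhs => rw [← eZero_smul_pOne hP, ← mul_smul, mul_eZero hP hU, smul_assoc,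
    eZero_smul_pOne hP]

theorem op_smul_pOne (r : DegZero (P.gradingA U)) (a b : SignVec E) :
    MulOpposite.op r • P.pOne U a b = vertexCoeff hP hU b r • P.pOne U a b := by
  conv_lhs => rw [← op_eZero_smul_pOne hP, ← mul_smul, ← MulOpposite.op_mul, eZero_mul hP hU,
    MulOpposite.op_smul, smul_assoc, op_eZero_smul_pOne hP]

theorem arrowCoeff_smul (a b : SignVec E) (r : DegZero (P.gradingA U))
    (v : DegOne (P.gradingA U)) :
    arrowCoeff hP hU a b (r • v) = vertexCoeff hP hU a r * arrowCoeff hP hU a b v := by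
  refine LinearMap.congr_fun (degOne_ext hP
    (f := arrowCoeff hP hU a b ∘ₗ Module.toModuleEnd k (DegOne (P.gradingA U)) r)
    (g := vertexCoeff hP hU a r • arrowCoeff hP hU a b) fun c i => ?_) v
  change arrowCoeff hP hU a b (r • P.pOne U c (negAt i c)) = _ * _
  rw [smul_pOne hP hU, map_smul, smul_eq_mul, arrowCoeff_pOne]
  split_ifs with h
  · rw [h.2.1]
  · rw [mul_zero, mul_zero]

theorem arrowCoeff_op_smul (a b : SignVec E) (r : DegZero (P.gradingA U))
    (v : DegOne (P.gradingA U)) :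
    arrowCoeff hP hU a b (MulOpposite.op r • v) =
      vertexCoeff hP hU b r * arrowCoeff hP hU a b v := by
  refine LinearMap.congr_fun (degOne_ext hP
    (f := arrowCoeff hP hU a b ∘ₗ
      Module.toModuleEnd k (S := (DegZero (P.gradingA U))ᵐᵒᵖ) (DegOne (P.gradingA U))
        (MulOpposite.op r))
    (g := vertexCoeff hP hU b r • arrowCoeff hP hU a b) fun c i => ?_) v
  change arrowCoeff hP hU a b (MulOpposite.op r • P.pOne U c (negAt i c)) = _ * _
  rw [op_smul_pOne hP hU, map_smul, smul_eq_mul, arrowCoeff_pOne]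
  split_ifs with h
  · rw [h.2.2]
  · rw [mul_zero, mul_zero]

end coefficients

/-! ## The dual bimodule of `A₁` -/

section dual

variable {P : OMProgram E} {U : Submodule k (E → k)} (hP : P.IsGeneric) (hU : P.IsParameterSpace U)

variable (P U) in
/-- The dual bimodule of `A₁`. -/
abbrev DegOneDual : Type _ := BimoduleDual (DegZero (P.gradingA U)) (DegOne (P.gradingA U))

/-- The dual basis of the arrows. -/
def pDual (a b : SignVec E) : P.DegOneDual U :=
  ({ toFun := fun v => arrowCoeff hP hU a b v • P.eZero U b
     map_add' := fun v w => by rw [map_add, add_smul]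
     map_smul' := fun r v => by
      induction r using MulOpposite.rec' with | _ r
      rw [arrowCoeff_op_smul, RingHom.id_apply, MulOpposite.smul_eq_mul_unop, MulOpposite.unop_op,
        smul_mul_assoc, eZero_mul hP hU, smul_smul, mul_comm] } :
    DegOne (P.gradingA U) →ₗ[(DegZero (P.gradingA U))ᵐᵒᵖ] DegZero (P.gradingA U))

theorem pDual_apply (a b : SignVec E) (v : DegOne (P.gradingA U)) :
    pDual hP hU a b v = arrowCoeff hP hU a b v • P.eZero U b := rfl

theorem vertexCoeff_pDual_pOne (a b c d : SignVec E) :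
    vertexCoeff hP hU d (pDual hP hU a b (P.pOne U c d)) =
      if ((P.Bdd a ∧ P.Bdd b) ∧ ∃ i, b = negAt i a) ∧ a = c ∧ b = d then 1 else 0 := by
  rw [pDual_apply, map_smul, vertexCoeff_eZero]
  by_cases h : ∃ i, d = negAt i c
  · obtain ⟨i, rfl⟩ := h
    rw [arrowCoeff_pOne]
    by_cases h1 : a = c
    · subst h1
      by_cases h2 : b = negAt i a
      · subst h2
        by_cases h3 : P.Bdd a ∧ P.Bdd (negAt i a)
        · have : ∃ j, negAt i a = negAt j a := ⟨i, rfl⟩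
          simp [h3, this]
        · simp [h3]
      · simp [h2]
    · simp [h1]
  · rw [pOne_eq_zero hP fun i hi => h ⟨i, hi⟩, map_zero, zero_smul, if_neg]
    rintro ⟨⟨-, h'⟩, rfl, rfl⟩
    exact h h'

/-- The left action sees the target `b` and the right action the source `a`: the dual arrow runs
backwards, from `b` to `a`. -/
theorem eZero_smul_pDual (a b : SignVec E) :
    P.eZero U b • pDual hP hU a b = pDual hP hU a b := by
  ext v
  rw [BimoduleDual.smul_apply, pDual_apply, mul_smul_comm, eZero_mul_eZero hP, if_pos rfl]

theorem op_eZero_smul_pDual (a b : SignVec E) :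
    MulOpposite.op (P.eZero U a) • pDual hP hU a b = pDual hP hU a b := by
  ext v
  rw [BimoduleDual.op_smul_apply, pDual_apply, pDual_apply, MulOpposite.unop_op, arrowCoeff_smul]
  by_cases ha : P.Bdd a
  · rw [vertexCoeff_eZero, if_pos ⟨ha, rfl⟩, one_mul]
  · rw [arrowCoeff_of_not_bdd hP hU fun h => ha h.1, LinearMap.zero_apply, mul_zero]

theorem sum_smul_pDual (Φ : P.DegOneDual U) :
    ∑ a, ∑ b, vertexCoeff hP hU b (Φ (P.pOne U a b)) • pDual hP hU a b = Φ := by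
  let f : DegOne (P.gradingA U) →ₗ[k] DegZero (P.gradingA U) :=
    { toFun := Φ
      map_add' := map_add Φ
      map_smul' := BimoduleDual.map_scalar_smul Φ }
  let g : DegOne (P.gradingA U) →ₗ[k] DegZero (P.gradingA U) :=
    ∑ a, ∑ b, vertexCoeff hP hU b (Φ (P.pOne U a b)) •
      (arrowCoeff hP hU a b).smulRight (P.eZero U b)
  have hsum : ∀ v, (∑ a, ∑ b, vertexCoeff hP hU b (Φ (P.pOne U a b)) • pDual hP hU a b) v = g v := by
    intro v
    let ev : P.DegOneDual U →+ DegZero (P.gradingA U) :=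
      { toFun := fun Φ => Φ v
        map_zero' := rfl
        map_add' := fun _ _ => rfl }
    change ev _ = _
    simp only [map_sum, g, LinearMap.sum_apply]
    rfl
  ext1 v
  rw [hsum]
  refine LinearMap.congr_fun (degOne_ext hP (f := g) (g := f) fun c i => ?_) v
  simp only [g, LinearMap.sum_apply, LinearMap.smul_apply, LinearMap.smulRight_apply,
    arrowCoeff_pOne]
  rw [Finset.sum_eq_single c, Finset.sum_eq_single (negAt i c)]
  · have h1 : Φ (P.pOne U c (negAt i c)) * P.eZero U (negAt i c) = Φ (P.pOne U c (negAt i c)) := by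
      conv_rhs => rw [← op_eZero_smul_pOne hP, map_smul]
      rfl
    change _ = Φ (P.pOne U c (negAt i c))
    split_ifs with h
    · rw [one_smul, ← mul_eZero hP hU, h1]
    · have : P.pOne U c (negAt i c) = 0 := by
        by_cases hc : P.Bdd c
        · exact pOne_eq_zero_right hP (fun hb => h ⟨⟨hc, hb⟩, rfl, rfl⟩) _
        · exact pOne_eq_zero_left hP hc _
      rw [this, map_zero, map_zero, zero_smul]
  · intro b _ hb
    simp [hb]
  · simp
  · intro a _ ha
    simp [ha]
  · simp

end dual

end

end OMProgram

/-! ### Signs on the edges of the cube. -/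

namespace SignVec

variable {E : Type*}

/-- The two coordinates reversed are those where the endpoints differ, so a square has just two
middle vertices. -/
theorem negAt_eq_or_eq {a : SignVec E} (ha : ∀ i, a i ≠ 0) {i j i' j' : E} (hij' : i' ≠ j')
    (h : negAt i' (negAt j' a) = negAt i (negAt j a)) : (i' = i ∧ j' = j) ∨ (i' = j ∧ j' = i) := by
  have key : ∀ {i j i' j' : E}, i' ≠ j' → negAt i' (negAt j' a) = negAt i (negAt j a) →
      i' = i ∨ i' = j := by
    intro i j i' j' hij h
    by_contra! hne
    have := congrFun h i'
    rw [negAt_same, negAt_of_ne hij, negAt_of_ne hne.1, negAt_of_ne hne.2] at this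
    exact neg_ne_self (ha i') this
  have h' : negAt j' (negAt i' a) = negAt i (negAt j a) := by rw [negAt_comm, h]
  rcases key hij' h with h1 | h1 <;> rcases key hij'.symm h' with h2 | h2
  · exact absurd (h1.trans h2.symm) hij'
  · exact Or.inl ⟨h1, h2⟩
  · exact Or.inr ⟨h1, h2⟩
  · exact absurd (h1.trans h2.symm) hij'

noncomputable section

open scoped Classical

variable [Fintype E] (k : Type*) [Field k]

/-- The sign of the coordinates of `a` preceding `i`. -/
def signBefore (i : E) (a : SignVec E) : k :=
  ∏ j, if Fintype.equivFin E j < Fintype.equivFin E i then ((a j : SignType) : k) else 1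

/-- The sign of the edge from `a` to `b`: every square of the cube is anticommutative. -/
def edgeSign (a b : SignVec E) : k := ∏ i, if a i = b i then 1 else signBefore k i a

variable {k}

theorem signBefore_negAt_of_not_lt {i j : E}
    (h : ¬ Fintype.equivFin E j < Fintype.equivFin E i) (a : SignVec E) :
    signBefore k i (negAt j a) = signBefore k i a := by
  refine Finset.prod_congr rfl fun l _ => ?_
  split_ifs with hl
  · have : l ≠ j := by
      rintro rfl
      exact h hl
    rw [negAt_of_ne this]
  · rfl

theorem signBefore_negAt_of_lt {i j : E}
    (h : Fintype.equivFin E j < Fintype.equivFin E i) (a : SignVec E) :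
    signBefore k i (negAt j a) = -signBefore k i a := by
  unfold signBefore
  rw [← Finset.mul_prod_erase _ _ (Finset.mem_univ j), ← Finset.mul_prod_erase _ _
    (Finset.mem_univ j), if_pos h, if_pos h, negAt_same, ← neg_mul]
  congr 1
  · rw [SignType.coe_neg]
  · refine Finset.prod_congr rfl fun l hl => ?_
    rw [negAt_of_ne (Finset.ne_of_mem_erase hl)]

theorem signBefore_mul_self {a : SignVec E} (ha : ∀ i, a i ≠ 0) (i : E) :
    signBefore k i a * signBefore k i a = 1 := by
  unfold signBefore
  rw [← Finset.prod_mul_distrib]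
  refine Finset.prod_eq_one fun j _ => ?_
  split_ifs
  · rcases h : a j with _ | _ | _
    · exact absurd h (ha j)
    · simp
    · simp
  · rw [one_mul]

theorem edgeSign_negAt {a : SignVec E} (ha : ∀ i, a i ≠ 0) (i : E) :
    edgeSign k a (negAt i a) = signBefore k i a := by
  unfold edgeSign
  rw [Finset.prod_eq_single i]
  · rw [if_neg ((negAt_apply_ne_iff ha).2 rfl).symm]
  · intro j _ hj
    rw [negAt_of_ne hj, if_pos rfl]
  · simp

theorem edgeSign_negAt_self {a : SignVec E} (ha : ∀ i, a i ≠ 0) (i : E) :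
    edgeSign k (negAt i a) a = signBefore k i a := by
  have := edgeSign_negAt (k := k) (negAt_ne_zero ha i) i
  rw [negAt_negAt] at this
  rw [this, signBefore_negAt_of_not_lt (lt_irrefl _)]

/-- The sign of an edge in direction `i` ignores the coordinate `i`, hence is the same in both
directions. The relations between loops are thus unaffected by the signs. -/
theorem edgeSign_mul_edgeSign_swap {a : SignVec E} (ha : ∀ i, a i ≠ 0) (i : E) :
    edgeSign k (negAt i a) a * edgeSign k a (negAt i a) = 1 := by
  rw [edgeSign_negAt_self ha, edgeSign_negAt ha, signBefore_mul_self ha]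

theorem edgeSign_mul_self {a : SignVec E} (ha : ∀ i, a i ≠ 0) (i : E) :
    edgeSign k (negAt i a) a * edgeSign k (negAt i a) a = 1 := by
  rw [edgeSign_negAt_self ha, signBefore_mul_self ha]

/-- Reversing the coordinate `j` changes the sign of the edges in direction `i` exactly when `j`
precedes `i`. So of the two pairs of parallel edges in a square exactly one has differing signs. -/
theorem edgeSign_square {a : SignVec E} (ha : ∀ i, a i ≠ 0) {i j : E} (hij : i ≠ j) :
    edgeSign k (negAt j a) (negAt i (negAt j a)) * edgeSign k a (negAt j a) =
      -(edgeSign k (negAt i a) (negAt i (negAt j a)) * edgeSign k a (negAt i a)) := by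
  rw [edgeSign_negAt (negAt_ne_zero ha _), negAt_comm i j, edgeSign_negAt (negAt_ne_zero ha _),
    edgeSign_negAt ha, edgeSign_negAt ha]
  rcases lt_or_gt_of_ne ((Fintype.equivFin E).injective.ne hij) with h | h
  · rw [signBefore_negAt_of_not_lt h.not_gt, signBefore_negAt_of_lt h]
    ring
  · rw [signBefore_negAt_of_lt h, signBefore_negAt_of_not_lt h.not_gt]
    ring

end

end SignVec

namespace OMProgram

noncomputable section

open scoped Classical

variable {E : Type*} [Fintype E] {k : Type*} [Field k]
variable {P : OMProgram E} {U : Submodule k (E → k)} (hP : P.IsGeneric) (hU : P.IsParameterSpace U)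

/-! ## Relations of the quadratic dual -/

/-- The block at the arrow from `c` to `d` in a representation detecting the paths of length two from
`a` to `b`, with weight `μ c` for the path through `c`. -/
def pathBlock (a b : SignVec E) (μ : SignVec E → k) (c d : SignVec E) : Matrix (Fin 3) (Fin 3) k :=
  (if c = a then Matrix.single 0 1 1 else 0) + if d = b then Matrix.single 1 2 (μ c) else 0

/-- The three indices record the progress along a path: leaving `a` raises `0` to `1`, and entering
`b` raises `1` to `2` with the weight of the middle vertex. -/
theorem pathBlock_mul_pathBlock (a b : SignVec E) (μ : SignVec E → k) (c d e : SignVec E) :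
    pathBlock a b μ c d * pathBlock a b μ d e =
      if c = a ∧ e = b then Matrix.single 0 2 (μ d) else 0 := by
  have h1 : ∀ x y : k, (Matrix.single 0 1 x * Matrix.single 0 1 y : Matrix (Fin 3) (Fin 3) k) = 0 :=
    fun x y => Matrix.single_mul_single_of_ne x 0 1 0 (by decide) y
  have h2 : ∀ x y : k, (Matrix.single 1 2 x * Matrix.single 0 1 y : Matrix (Fin 3) (Fin 3) k) = 0 :=
    fun x y => Matrix.single_mul_single_of_ne x 1 2 0 (by decide) y
  have h3 : ∀ x y : k, (Matrix.single 1 2 x * Matrix.single 1 2 y : Matrix (Fin 3) (Fin 3) k) = 0 :=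
    fun x y => Matrix.single_mul_single_of_ne x 1 2 1 (by decide) y
  by_cases hc : c = a <;> by_cases he : e = b <;>
    simp [pathBlock, hc, he, add_mul, mul_add, mul_ite, ite_mul, h1, h2, h3]

section pathRealization

variable {a b : SignVec E} {μ : SignVec E → k} (hμ : ∀ c, ¬ P.Bdd c → μ c = 0)
  (hsq : ∀ i j, i ≠ j → P.IsFeasible a → P.IsFeasible (negAt i a) → P.IsFeasible (negAt j a) →
    P.IsFeasible b → b = negAt i (negAt j a) → μ (negAt i a) = μ (negAt j a))
  (hloop : a = b → P.IsFeasible a → ∀ c ∈ perp U, (∀ i, c i ≠ 0 → P.IsFeasible (negAt i a)) →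
    ∑ i, c i * μ (negAt i a) = 0)

include hμ in
theorem ite_pathBlock_mul_pathBlock (c d e : SignVec E) :
    (if P.Bdd d then pathBlock a b μ c d * pathBlock a b μ d e else 0) =
      if c = a ∧ e = b then Matrix.single 0 2 (μ d) else 0 := by
  rw [pathBlock_mul_pathBlock]
  by_cases hd : P.Bdd d
  · rw [if_pos hd]
  · simp [hd, hμ d hd]

/-- The realization detecting the paths of length two from `a` to `b` with weights `μ`. -/
def pathRealization : Realization P U (P.BlockMatrix k) :=
  P.blockRealization U (pathBlock a b μ)
    (by
      intro c i j hij hc hi hj hb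
      rw [ite_pathBlock_mul_pathBlock hμ, ite_pathBlock_mul_pathBlock hμ]
      split_ifs with h
      · obtain ⟨rfl, h⟩ := h
        rw [hsq i j hij hc hi hj (h ▸ hb) h.symm]
      · rfl)
    (by
      intro c hc x hx hxi
      simp only [ite_pathBlock_mul_pathBlock hμ]
      by_cases h : c = a ∧ c = b
      · obtain ⟨rfl, rfl⟩ := h
        have := congrArg (Matrix.singleLinearMap k (0 : Fin 3) (2 : Fin 3))
          (hloop rfl hc x hx hxi)
        rw [map_sum, map_zero] at this
        rw [← this]
        refine Finset.sum_congr rfl fun i _ => ?_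
        rw [if_pos ⟨rfl, rfl⟩, ← smul_eq_mul, map_smul]
        rfl
      · simp [h])

-- The `(0,2)` entry of the block at `(a,b)` reads off the weighted count of paths. Its existence
-- bounds `W` from above: quadratic relations can only be those respected by all admissible weights
-- `μ`.
include hμ hsq hloop in
theorem exists_pathFunctional : ∃ τ : P.A U →ₗ[k] k, ∀ v w : DegOne (P.gradingA U),
    τ (DegOne.incl _ v * DegOne.incl _ w) =
      ∑ c, μ c * (arrowCoeff hP hU a c v * arrowCoeff hP hU c b w) := by
  by_cases hab : P.Bdd a ∧ P.Bdd b
  · let τ : P.A U →ₗ[k] k :=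
      P.blockEntry a b 0 2 ∘ₗ ((pathRealization hμ hsq hloop).lift hP hU).toLinearMap
    refine ⟨τ, fun v w => ?_⟩
    let f : DegOne (P.gradingA U) →ₗ[k] DegOne (P.gradingA U) →ₗ[k] k :=
      ((LinearMap.mul k (P.A U)).compr₂ τ).compl₁₂ (DegOne.incl _) (DegOne.incl _)
    let g : DegOne (P.gradingA U) →ₗ[k] DegOne (P.gradingA U) →ₗ[k] k :=
      ∑ c, μ c • (LinearMap.mul k k).compl₁₂ (arrowCoeff hP hU a c) (arrowCoeff hP hU c b)
    have hfg : f = g := by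
      refine degOne_ext hP fun x i => degOne_ext hP fun y j => ?_
      change P.blockEntry a b 0 2 ((pathRealization hμ hsq hloop).lift hP hU
        (P.pA U x (negAt i x) * P.pA U y (negAt j y))) = _
      rw [map_mul, Realization.lift_pA, Realization.lift_pA]
      have hg : g (P.pOne U x (negAt i x)) (P.pOne U y (negAt j y)) =
          ∑ c, μ c * (arrowCoeff hP hU a c (P.pOne U x (negAt i x)) *
            arrowCoeff hP hU c b (P.pOne U y (negAt j y))) := by
        simp [g, LinearMap.sum_apply]
      rw [hg]
      simp only [arrowCoeff_pOne]
      change P.blockEntry a b 0 2 (P.block x (negAt i x) (pathBlock a b μ x (negAt i x)) *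
        P.block y (negAt j y) (pathBlock a b μ y (negAt j y))) = _
      by_cases hy : negAt i x = y
      · rw [hy, block_mul_block, ite_pathBlock_mul_pathBlock hμ, blockEntry_block,
          Finset.sum_eq_single y]
        · by_cases h1 : x = a
          · by_cases h2 : negAt j y = b
            · by_cases h3 : P.Bdd y
              · simp [h1, h2, h3, hab]
              · simp [h1, h2, h3, hμ y h3]
            · simp [Ne.symm h2]
          · simp [Ne.symm h1]
        · intro c _ hc
          simp [hc]
        · simp
      · rw [block_mul_block_of_ne hy, map_zero]
        refine (Finset.sum_eq_zero fun c _ => ?_).symm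
        by_cases h1 : c = y
        · simp [h1, Ne.symm hy]
        · simp [h1]
    have := LinearMap.congr_fun₂ hfg v w
    simpa [f, g, LinearMap.sum_apply] using this
  · refine ⟨0, fun v w => (Finset.sum_eq_zero fun c _ => ?_).symm⟩
    by_cases ha : P.Bdd a
    · rw [arrowCoeff_of_not_bdd hP hU fun h => hab ⟨ha, h.2⟩]
      simp
    · rw [arrowCoeff_of_not_bdd hP hU fun h => ha h.1]
      simp

-- Pairing with this tensor is multiplication in `A(P, U)` followed by the path functional, hence
-- zero on `W`.
include hμ hsq hloop in
theorem sum_smul_pDual_mem_dualRelations :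
    ∑ c, μ c • (Submodule.Quotient.mk (pDual hP hU c b ⊗ₜ pDual hP hU a c) :
      TensorSquare k (DegZero (P.gradingA U)) (P.DegOneDual U)) ∈
      dualRelations (P.gradingA U) := by
  obtain ⟨τ, hτ⟩ := exists_pathFunctional hP hU hμ hsq hloop
  have key : BimoduleDual.pairing k (DegZero (P.gradingA U)) (DegOne (P.gradingA U))
      (∑ c, μ c • (Submodule.Quotient.mk (pDual hP hU c b ⊗ₜ pDual hP hU a c) :
        TensorSquare k (DegZero (P.gradingA U)) (P.DegOneDual U))) =
      τ.smulRight (P.eZero U b) ∘ₗ squareToAlgebra (P.gradingA U) := by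
    apply Submodule.linearMap_qext
    ext1
    refine LinearMap.ext fun v => LinearMap.ext fun w => ?_
    have h1 : ∀ c, BimoduleDual.pairing k (DegZero (P.gradingA U)) (DegOne (P.gradingA U))
        (Submodule.Quotient.mk (pDual hP hU c b ⊗ₜ pDual hP hU a c))
        (Submodule.Quotient.mk (v ⊗ₜ w)) =
        (arrowCoeff hP hU a c v * arrowCoeff hP hU c b w) • P.eZero U b := by
      intro c
      change pDual hP hU c b (pDual hP hU a c v • w) = _
      rw [pDual_apply, pDual_apply, smul_assoc, map_smul, arrowCoeff_smul, smul_eq_mul,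
        vertexCoeff_eZero]
      by_cases hc : P.Bdd c
      · simp [hc]
      · rw [arrowCoeff_of_not_bdd hP hU (a := c) fun h => hc h.1]
        simp
    change _ = τ (DegOne.incl _ v * DegOne.incl _ w) • P.eZero U b
    rw [hτ]
    change BimoduleDual.pairing k (DegZero (P.gradingA U)) (DegOne (P.gradingA U)) _
      (Submodule.Quotient.mk (v ⊗ₜ w)) = _
    rw [map_sum, LinearMap.sum_apply, Finset.sum_smul]
    refine Finset.sum_congr rfl fun c _ => ?_
    rw [map_smul, LinearMap.smul_apply, h1, smul_smul]
  intro x hx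
  rw [key, LinearMap.comp_apply, show squareToAlgebra (P.gradingA U) x = 0 from hx, map_zero]

end pathRealization

end

end OMProgram

namespace OMProgram

noncomputable section

open scoped Classical

variable {E : Type*} [Fintype E] {k : Type*} [Field k]
variable {P : OMProgram E} {U : Submodule k (E → k)} (hP : P.IsGeneric) (hU : P.IsParameterSpace U)

/-! ## The comparison of the dual program with the quadratic dual -/

theorem Bdd.ne_zero (hP : P.IsGeneric) {a : SignVec E} (ha : P.Bdd a) (i : E) : a i ≠ 0 :=
  IsFeasible.ne_zero hP ha.1 i

theorem pDual_of_not_bdd {a b : SignVec E} (h : ¬ (P.Bdd a ∧ P.Bdd b)) :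
    pDual hP hU a b = 0 := by
  ext1 v
  rw [pDual_apply, arrowCoeff_of_not_bdd hP hU h, LinearMap.zero_apply, zero_smul]
  rfl

theorem smul_eq_neg_smul_of_add_eq_zero {B : Type*} [Ring B] [Algebra k B] {s : k} {x y : B}
    (h : s • x + s • y = 0) : s • x = -s • y := by
  rw [neg_smul]
  exact eq_neg_of_add_eq_zero_left h

/-- The arrow from `b` to `a` in the quadratic dual, with the sign of the edge from `a` to `b`. -/
def pBang (b a : SignVec E) : QuadraticDual (P.gradingA U) :=
  edgeSign k a b • QuadraticQuotient.ofV (dualRelations (P.gradingA U)) (pDual hP hU a b)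

theorem pBang_of_not_bdd {a b : SignVec E} (h : ¬ (P.Bdd a ∧ P.Bdd b)) :
    pBang hP hU b a = 0 := by
  rw [pBang, pDual_of_not_bdd hP hU h, map_zero, smul_zero]

theorem pBang_mul_pBang (a b c : SignVec E) : pBang hP hU b c * pBang hP hU c a =
    (edgeSign k c b * edgeSign k a c) •
      (QuadraticQuotient.ofV (dualRelations (P.gradingA U)) (pDual hP hU c b) *
        QuadraticQuotient.ofV (dualRelations (P.gradingA U)) (pDual hP hU a c)) :=
  smul_mul_smul_comm _ _ _ _

/-- Equal weights on the two middle vertices respect the square relation of `A(P, U)`. So the two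
dual paths add up to zero in the quadratic dual, and the edge signs turn this into an equality. -/
theorem pBang_square {a b : SignVec E} {i j : E} (hij : i ≠ j) (ha : P.dual.IsFeasible a)
    (hi : P.dual.IsFeasible (negAt i a)) (hj : P.dual.IsFeasible (negAt j a))
    (hba : b = negAt i (negAt j a)) :
    pBang hP hU b (negAt i a) * pBang hP hU (negAt i a) a =
      pBang hP hU b (negAt j a) * pBang hP hU (negAt j a) a := by
  have hne := IsFeasible.ne_zero hP.dual ha
  have hsign := edgeSign_square (k := k) hne hij
  rw [← hba] at hsign
  let s := edgeSign k (negAt i a) b * edgeSign k a (negAt i a)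
  -- Middle vertices are feasible for the dual program, so a feasible one is automatically bounded
  -- and gets weight `s`. A middle vertex that is not bounded and feasible gets weight zero.
  let μ : SignVec E → k := fun c => (if c = negAt i a then if P.Bdd c then s else 0 else 0) +
    if c = negAt j a then if P.Bdd c then s else 0 else 0
  have hinj : ∀ l m, negAt l a = negAt m a ↔ l = m := fun l m => (negAt_injective hne).eq_iff
  have hμi : P.IsFeasible (negAt i a) → μ (negAt i a) = s := fun h => by
    simp [μ, hP.bdd_iff.2 ⟨h, hi⟩, hinj, hij]
  have hμj : P.IsFeasible (negAt j a) → μ (negAt j a) = s := fun h => by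
    simp [μ, hP.bdd_iff.2 ⟨h, hj⟩, hinj, hij.symm]
  have hrel := QuadraticQuotient.sum_ofV_mul_ofV (dualRelations (P.gradingA U)) Finset.univ μ
    (fun c => pDual hP hU c b) (fun c => pDual hP hU a c)
    (sum_smul_pDual_mem_dualRelations hP hU (a := a) (b := b) (μ := μ)
      (by
        intro c hc
        simp [μ, hc])
      (by
        intro i' j' hij' _ hi' hj' _ h
        rcases negAt_eq_or_eq hne hij' (h.symm.trans hba) with ⟨rfl, rfl⟩ | ⟨rfl, rfl⟩
        · rw [hμi hi', hμj hj']
        · rw [hμj hi', hμi hj'])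
      (fun h => absurd (h.trans hba).symm (negAt_negAt_ne_self hne hij)))
  have hterm : ∀ c, (if P.Bdd c then s • (QuadraticQuotient.ofV (dualRelations (P.gradingA U))
      (pDual hP hU c b) * QuadraticQuotient.ofV (dualRelations (P.gradingA U))
      (pDual hP hU a c)) else 0) = s • (QuadraticQuotient.ofV (dualRelations (P.gradingA U))
      (pDual hP hU c b) * QuadraticQuotient.ofV (dualRelations (P.gradingA U))
      (pDual hP hU a c)) := fun c => by
    split_ifs with hc
    · rfl
    · rw [pDual_of_not_bdd hP hU fun h => hc h.1, map_zero, zero_mul, smul_zero]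
  simp only [μ, add_smul, ite_smul, zero_smul, Finset.sum_add_distrib, Finset.sum_ite_eq',
    Finset.mem_univ, if_true, hterm] at hrel
  rw [pBang_mul_pBang, pBang_mul_pBang, hsign]
  exact smul_eq_neg_smul_of_add_eq_zero (B := QuadraticDual (P.gradingA U)) (s := s) hrel

/-- The coordinates of `x ∈ U` at the bounded feasible neighbours are admissible weights: if `c ∈
Uᗮ` is supported on feasible neighbours, then `c_i x_i ≠ 0` only where the neighbour is feasible for
both programs, so the sum is the full pairing of `c` and `x`. -/
theorem pBang_loop {a : SignVec E} (ha : P.dual.IsFeasible a) {x : E → k}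
    (hx : x ∈ perp (perp U)) (hxi : ∀ i, x i ≠ 0 → P.dual.IsFeasible (negAt i a)) :
    ∑ i, x i • (pBang hP hU a (negAt i a) * pBang hP hU (negAt i a) a) = 0 := by
  have hne := IsFeasible.ne_zero hP.dual ha
  let μ : SignVec E → k := fun c =>
    ∑ i, if c = negAt i a then (if P.Bdd c then x i else 0) else 0
  have hμi : ∀ i, μ (negAt i a) = if P.Bdd (negAt i a) then x i else 0 := by
    intro i
    simp only [μ]
    rw [Finset.sum_eq_single i]
    · simp
    · intro j _ hj
      rw [if_neg fun h => hj (negAt_injective hne h).symm]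
    · simp
  have hrel := QuadraticQuotient.sum_ofV_mul_ofV (dualRelations (P.gradingA U)) Finset.univ μ
    (fun c => pDual hP hU c a) (fun c => pDual hP hU a c)
    (sum_smul_pDual_mem_dualRelations hP hU (a := a) (b := a) (μ := μ)
      (by
        intro c hc
        simp [μ, hc])
      (fun i j hij _ _ _ _ h => absurd h.symm (negAt_negAt_ne_self hne hij))
      (by
        intro _ _ c hc hci
        rw [← mem_perp.1 hx c hc]
        refine Finset.sum_congr rfl fun i _ => ?_
        rw [hμi]
        by_cases h1 : c i = 0
        · simp [h1]
        by_cases h2 : x i = 0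
        · simp [h2]
        rw [if_pos (hP.bdd_iff.2 ⟨hci i h1, hxi i h2⟩)]
        ring))
  simp only [μ, Finset.sum_smul, ite_smul, zero_smul] at hrel
  rw [Finset.sum_comm] at hrel
  rw [← hrel]
  refine Finset.sum_congr rfl fun i _ => ?_
  rw [Finset.sum_ite_eq' , if_pos (Finset.mem_univ _)]
  split_ifs with h
  · rw [pBang_mul_pBang, edgeSign_mul_edgeSign_swap hne, one_smul]
  · rw [pBang_of_not_bdd hP hU fun h' => h h'.1, zero_mul, smul_zero]

/-- The realization of the dual program in the quadratic dual. -/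
def dualRealization : Realization P.dual (perp U) (QuadraticDual (P.gradingA U)) where
  e a := QuadraticQuotient.ofR _ (P.eZero U a)
  p b a := pBang hP hU b a
  e_eq_zero a ha := by
    rw [eZero_eq_zero hP fun h => ha (hP.dual_bdd_iff.2 h), map_zero]
  e_mul_self a := by
    rw [← map_mul, eZero_mul_eZero hP, if_pos rfl]
  e_mul_of_ne a b h := by
    rw [← map_mul, eZero_mul_eZero hP, if_neg h, map_zero]
  sum_e := by
    rw [← map_sum, ← map_one (QuadraticQuotient.ofR (dualRelations (P.gradingA U)))]
    congr 1
    refine Subtype.ext ?_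
    simpa [eZero] using sum_eA (U := U) hP
  e_mul_p b a := by
    rw [pBang, mul_smul_comm, ← QuadraticQuotient.ofV_smul, eZero_smul_pDual]
  p_mul_e b a := by
    rw [pBang, smul_mul_assoc, ← QuadraticQuotient.ofV_op_smul, op_eZero_smul_pDual]
  square b i j hij hb hi hj ha := by
    -- `pBang_square` is based at the end of the paths, here the corner opposite to `b`.
    have h1 : negAt i (negAt i (negAt j b)) = negAt j b := negAt_negAt i _
    have h2 : negAt j (negAt i (negAt j b)) = negAt i b := by rw [negAt_comm i j, negAt_negAt]
    have := pBang_square hP hU hij ha (h1.symm ▸ hj) (h2.symm ▸ hi) (b := b)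
      (by rw [h2, negAt_negAt])
    rw [h1, h2] at this
    exact this.symm
  loop _ ha _ hc hci := pBang_loop hP hU ha hc hci

/-- The homomorphism from the algebra of the dual program to the quadratic dual. -/
def toQuadraticDual : P.dual.A (perp U) →ₐ[k] QuadraticDual (P.gradingA U) :=
  (dualRealization hP hU).lift hP.dual hU.dual

theorem toQuadraticDual_eA (a : SignVec E) :
    toQuadraticDual hP hU (P.dual.eA (perp U) a) = QuadraticQuotient.ofR _ (P.eZero U a) :=
  Realization.lift_eA _ hP.dual hU.dual a

theorem toQuadraticDual_pA (b : SignVec E) (i : E) :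
    toQuadraticDual hP hU (P.dual.pA (perp U) b (negAt i b)) = pBang hP hU b (negAt i b) :=
  Realization.lift_pA _ hP.dual hU.dual b i

/-! ## The inverse homomorphism -/

/-- The homomorphism from `A₀` to the algebra of the dual program. -/
def degZeroToDual : DegZero (P.gradingA U) →ₐ[k] P.dual.A (perp U) :=
  AlgHom.ofLinearMap (∑ a, (vertexCoeff hP hU a).smulRight (P.dual.eA (perp U) a))
    (by
      rw [← sum_eA hP.dual, LinearMap.sum_apply]
      refine Finset.sum_congr rfl fun a _ => ?_
      rw [LinearMap.smulRight_apply]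
      by_cases ha : P.Bdd a
      · rw [vertexCoeff_one hP hU ha, one_smul]
      · rw [eA_eq_zero hP.dual fun h => ha (hP.dual_bdd_iff.1 h), smul_zero])
    (by
      intro r s
      simp only [LinearMap.sum_apply, LinearMap.smulRight_apply, Finset.sum_mul_sum,
        smul_mul_smul_comm, eA_mul_eA hP.dual, smul_ite, smul_zero, Finset.sum_ite_eq,
        Finset.mem_univ, if_true, vertexCoeff_mul])

theorem degZeroToDual_apply (r : DegZero (P.gradingA U)) :
    degZeroToDual hP hU r = ∑ a, vertexCoeff hP hU a r • P.dual.eA (perp U) a := by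
  simp [degZeroToDual, LinearMap.sum_apply]

theorem degZeroToDual_mul_eA (r : DegZero (P.gradingA U)) (a : SignVec E) :
    degZeroToDual hP hU r * P.dual.eA (perp U) a =
      vertexCoeff hP hU a r • P.dual.eA (perp U) a := by
  rw [degZeroToDual_apply, Finset.sum_mul, Finset.sum_eq_single a]
  · rw [smul_mul_assoc, eA_mul_eA hP.dual, if_pos rfl]
  · intro b _ hb
    rw [smul_mul_assoc, eA_mul_eA hP.dual, if_neg hb, smul_zero]
  · simp

theorem eA_mul_degZeroToDual (r : DegZero (P.gradingA U)) (a : SignVec E) :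
    P.dual.eA (perp U) a * degZeroToDual hP hU r =
      vertexCoeff hP hU a r • P.dual.eA (perp U) a := by
  rw [degZeroToDual_apply, Finset.mul_sum, Finset.sum_eq_single a]
  · rw [mul_smul_comm, eA_mul_eA hP.dual, if_pos rfl]
  · intro b _ hb
    rw [mul_smul_comm, eA_mul_eA hP.dual, if_neg hb.symm, smul_zero]
  · simp

theorem degZeroToDual_mul_pA (r : DegZero (P.gradingA U)) (b a : SignVec E) :
    degZeroToDual hP hU r * P.dual.pA (perp U) b a =
      vertexCoeff hP hU b r • P.dual.pA (perp U) b a := by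
  have h : P.dual.eA (perp U) b * P.dual.pA (perp U) b a = P.dual.pA (perp U) b a := by
    rw [eA_mul_pA hP.dual, if_pos rfl]
  conv_lhs => rw [← h, ← mul_assoc, degZeroToDual_mul_eA, smul_mul_assoc, h]

theorem pA_mul_degZeroToDual (r : DegZero (P.gradingA U)) (b a : SignVec E) :
    P.dual.pA (perp U) b a * degZeroToDual hP hU r =
      vertexCoeff hP hU a r • P.dual.pA (perp U) b a := by
  have h : P.dual.pA (perp U) b a * P.dual.eA (perp U) a = P.dual.pA (perp U) b a := by
    rw [pA_mul_eA hP.dual, if_pos rfl]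
  conv_lhs => rw [← h, mul_assoc, eA_mul_degZeroToDual, mul_smul_comm, h]

/-- The map from the dual of `A₁` to the algebra of the dual program. -/
def degOneDualToDual : P.DegOneDual U →ₗ[k] P.dual.A (perp U) where
  toFun Φ := ∑ a, ∑ b, vertexCoeff hP hU b (Φ (P.pOne U a b)) •
    edgeSign k a b • P.dual.pA (perp U) b a
  map_add' Φ Ψ := by
    simp only [BimoduleDual.add_apply, map_add, add_smul, Finset.sum_add_distrib]
  map_smul' c Φ := by
    simp only [BimoduleDual.scalar_smul_apply, map_smul, smul_assoc, Finset.smul_sum,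
      RingHom.id_apply]

theorem degOneDualToDual_apply (Φ : P.DegOneDual U) :
    degOneDualToDual hP hU Φ = ∑ a, ∑ b, vertexCoeff hP hU b (Φ (P.pOne U a b)) •
      edgeSign k a b • P.dual.pA (perp U) b a := rfl

theorem degOneDualToDual_smul (r : DegZero (P.gradingA U)) (Φ : P.DegOneDual U) :
    degOneDualToDual hP hU (r • Φ) = degZeroToDual hP hU r * degOneDualToDual hP hU Φ := by
  simp only [degOneDualToDual_apply, Finset.mul_sum, BimoduleDual.smul_apply, vertexCoeff_mul,
    mul_smul_comm, degZeroToDual_mul_pA]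
  refine Finset.sum_congr rfl fun a _ => Finset.sum_congr rfl fun b _ => ?_
  rw [smul_smul, smul_smul, smul_smul]
  congr 1
  ring

theorem degOneDualToDual_op_smul (r : DegZero (P.gradingA U)) (Φ : P.DegOneDual U) :
    degOneDualToDual hP hU (MulOpposite.op r • Φ) =
      degOneDualToDual hP hU Φ * degZeroToDual hP hU r := by
  simp only [degOneDualToDual_apply, Finset.sum_mul, BimoduleDual.op_smul_apply,
    MulOpposite.unop_op, smul_pOne hP hU, BimoduleDual.map_scalar_smul, map_smul,
    smul_mul_assoc, pA_mul_degZeroToDual]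
  refine Finset.sum_congr rfl fun a _ => Finset.sum_congr rfl fun b _ => ?_
  rw [smul_smul, smul_smul, smul_eq_mul, smul_smul]
  congr 1
  ring

/-- The value of a tensor at the product of the arrows from `a` to `c` and from `c` to `b`. -/
def pathCoeff (a b c : SignVec E) :
    TensorSquare k (DegZero (P.gradingA U)) (P.DegOneDual U) →ₗ[k] k :=
  vertexCoeff hP hU b ∘ₗ LinearMap.flip
    (BimoduleDual.pairing k (DegZero (P.gradingA U)) (DegOne (P.gradingA U)))
    (Submodule.Quotient.mk (P.pOne U a c ⊗ₜ P.pOne U c b))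

theorem pathCoeff_mk (a b c : SignVec E) (Φ Ψ : P.DegOneDual U) :
    pathCoeff hP hU a b c (Submodule.Quotient.mk (Φ ⊗ₜ Ψ)) =
      vertexCoeff hP hU c (Ψ (P.pOne U a c)) * vertexCoeff hP hU b (Φ (P.pOne U c b)) := by
  change vertexCoeff hP hU b (Φ (Ψ (P.pOne U a c) • P.pOne U c b)) = _
  rw [smul_pOne hP hU, BimoduleDual.map_scalar_smul, map_smul, smul_eq_mul]

/-- A linear relation between paths from `a` to `b` in `A(P, U)` is an element of `W`, on which `ξ`
vanishes. -/
theorem pathCoeff_relation {ξ : TensorSquare k (DegZero (P.gradingA U)) (P.DegOneDual U)}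
    (hξ : ξ ∈ dualRelations (P.gradingA U)) (a b : SignVec E) {ι : Type*} {s : Finset ι}
    {m : ι → k} {c : ι → SignVec E}
    (h : ∑ i ∈ s, m i • (P.pA U a (c i) * P.pA U (c i) b) = 0) :
    ∑ i ∈ s, m i * pathCoeff hP hU a b (c i) ξ = 0 := by
  have h1 := hξ _ (mem_quadraticRelations (U := U) (s := s) (c := m)
    (v := fun i => P.pOne U a (c i)) (w := fun i => P.pOne U (c i) b) h)
  have h2 := congrArg (vertexCoeff hP hU b) h1
  simp only [map_sum, map_smul, map_zero] at h2
  exact h2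

theorem pathCoeff_eq_zero_left {a c : SignVec E} (h : P.pOne U a c = 0) (b : SignVec E) :
    pathCoeff hP hU a b c = 0 := by
  refine LinearMap.ext fun ξ => ?_
  change vertexCoeff hP hU b (BimoduleDual.pairing k _ _ ξ
    (Submodule.Quotient.mk (P.pOne U a c ⊗ₜ P.pOne U c b))) = 0
  rw [h, TensorProduct.zero_tmul, Submodule.Quotient.mk_zero, map_zero, map_zero]

theorem pathCoeff_eq_zero_right {b c : SignVec E} (h : P.pOne U c b = 0) (a : SignVec E) :
    pathCoeff hP hU a b c = 0 := by
  refine LinearMap.ext fun ξ => ?_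
  change vertexCoeff hP hU b (BimoduleDual.pairing k _ _ ξ
    (Submodule.Quotient.mk (P.pOne U a c ⊗ₜ P.pOne U c b))) = 0
  rw [h, TensorProduct.tmul_zero, Submodule.Quotient.mk_zero, map_zero, map_zero]

/-- On a pure tensor both factors are expanded along the arrows, and products whose middle vertices
differ vanish. -/
theorem squareLift_eq (ξ : TensorSquare k (DegZero (P.gradingA U)) (P.DegOneDual U)) :
    QuadraticQuotient.squareLift (degZeroToDual hP hU) (degOneDualToDual hP hU)
      (degOneDualToDual_smul hP hU) (degOneDualToDual_op_smul hP hU) ξ =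
    ∑ a, ∑ b, ∑ c, (pathCoeff hP hU a b c ξ * (edgeSign k c b * edgeSign k a c)) •
      (P.dual.pA (perp U) b c * P.dual.pA (perp U) c a) := by
  let g : TensorSquare k (DegZero (P.gradingA U)) (P.DegOneDual U) →ₗ[k] P.dual.A (perp U) :=
    ∑ a, ∑ b, ∑ c, (pathCoeff hP hU a b c).smulRight ((edgeSign k c b * edgeSign k a c) •
      (P.dual.pA (perp U) b c * P.dual.pA (perp U) c a))
  have hg : ∀ ξ, g ξ = ∑ a, ∑ b, ∑ c,
      (pathCoeff hP hU a b c ξ * (edgeSign k c b * edgeSign k a c)) •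
      (P.dual.pA (perp U) b c * P.dual.pA (perp U) c a) := by
    intro ξ
    simp only [g, LinearMap.sum_apply, LinearMap.smulRight_apply, smul_smul]
  rw [← hg]
  refine LinearMap.congr_fun ?_ ξ
  apply Submodule.linearMap_qext
  ext1
  refine LinearMap.ext fun Φ => LinearMap.ext fun Ψ => ?_
  change QuadraticQuotient.squareLift _ _ _ _ (Submodule.Quotient.mk (Φ ⊗ₜ Ψ)) =
    g (Submodule.Quotient.mk (Φ ⊗ₜ Ψ))
  rw [QuadraticQuotient.squareLift_mk, hg, degOneDualToDual_apply, degOneDualToDual_apply]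
  simp only [pathCoeff_mk, Finset.sum_mul_sum, smul_smul, smul_mul_smul_comm]
  rw [Finset.sum_comm]
  refine Finset.sum_congr rfl fun a _ => ?_
  rw [Finset.sum_comm]
  refine Finset.sum_congr rfl fun b _ => Finset.sum_congr rfl fun c _ => ?_
  rw [Finset.sum_eq_single c]
  · congr 1
    ring
  · intro c' _ hc
    have : P.dual.pA (perp U) b c * P.dual.pA (perp U) c' a = 0 :=
      (univ (perp U) hP.dual).p_mul_p_of_ne hc.symm
    rw [this, smul_zero]
  · simp

/-- The relation in the algebra of the dual program at the closed paths from `a`. -/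
theorem sum_pathCoeff_self {ξ : TensorSquare k (DegZero (P.gradingA U)) (P.DegOneDual U)}
    (hξ : ξ ∈ dualRelations (P.gradingA U)) (a : SignVec E) :
    ∑ c, (pathCoeff hP hU a a c ξ * (edgeSign k c a * edgeSign k a c)) •
      (P.dual.pA (perp U) a c * P.dual.pA (perp U) c a) = 0 := by
  by_cases ha : P.Bdd a
  swap
  · refine Finset.sum_eq_zero fun c _ => ?_
    rw [pA_eq_zero_left hP.dual fun h => ha (hP.dual_bdd_iff.1 h), zero_mul, smul_zero]
  have hne := Bdd.ne_zero hP ha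
  have hsum : ∑ c, (pathCoeff hP hU a a c ξ * (edgeSign k c a * edgeSign k a c)) •
      (P.dual.pA (perp U) a c * P.dual.pA (perp U) c a) =
      ∑ i, pathCoeff hP hU a a (negAt i a) ξ •
        (P.dual.pA (perp U) a (negAt i a) * P.dual.pA (perp U) (negAt i a) a) := by
    symm
    refine Finset.sum_of_injOn (fun i => negAt i a) (fun i _ j _ h => negAt_injective hne h)
      (fun _ _ => Finset.mem_coe.2 (Finset.mem_univ _)) (fun c _ hc => ?_) fun i _ => ?_
    · rw [pA_eq_zero hP.dual, zero_mul, smul_zero]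
      rintro i rfl
      exact hc ⟨i, Finset.mem_coe.2 (Finset.mem_univ _), rfl⟩
    · rw [edgeSign_mul_edgeSign_swap hne, mul_one]
  rw [hsum]
  have hnot : ∀ i, ¬ P.Bdd (negAt i a) → pathCoeff hP hU a a (negAt i a) ξ = 0 := by
    intro i hi
    rw [pathCoeff_eq_zero_left hP hU (pOne_eq_zero_right hP hi a), LinearMap.zero_apply]
  -- The coefficients of `ξ` on feasible neighbours are orthogonal to all loop relations of `A(P,
  -- U)` at `a`, so they come from an element of `U`.
  obtain ⟨u, hu, hut⟩ := exists_mem_eq_on U {i | P.IsFeasible (negAt i a)}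
    (t := fun i => pathCoeff hP hU a a (negAt i a) ξ)
    (fun c hc hci => pathCoeff_relation hP hU hξ a a (pA_loop hP ha.1 hc hci))
  -- A neighbour infeasible for the dual program is feasible and unbounded, and there the
  -- coefficient vanishes. So `u` has the support required of a loop relation of the dual algebra.
  have hdual := pA_loop (U := perp U) hP.dual (Bdd.dual_feasible hP ha) (c := u)
    (by rwa [perp_perp]) (by
      intro i hi
      by_contra hdf
      have hf := (Bdd.negAt_feasible_or hP ha i).resolve_right hdf
      exact hi ((hut i hf).trans (hnot i fun h => hdf (Bdd.dual_feasible hP h))))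
  rw [← hdual]
  refine Finset.sum_congr rfl fun i _ => ?_
  by_cases hi : P.IsFeasible (negAt i a)
  · rw [← hut i hi]
  · rw [pA_eq_zero_right hP.dual fun h => hi (hP.dual_bdd_iff.1 h).1]
    simp

theorem pathCoeff_square {ξ : TensorSquare k (DegZero (P.gradingA U)) (P.DegOneDual U)}
    (hξ : ξ ∈ dualRelations (P.gradingA U)) {a b : SignVec E} {i j : E} (hij : i ≠ j)
    (hba : b = negAt i (negAt j a)) (ha : P.Bdd a) (hb : P.Bdd b) :
    pathCoeff hP hU a b (negAt i a) ξ •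
      (P.dual.pA (perp U) b (negAt i a) * P.dual.pA (perp U) (negAt i a) a) =
    pathCoeff hP hU a b (negAt j a) ξ •
      (P.dual.pA (perp U) b (negAt j a) * P.dual.pA (perp U) (negAt j a) a) := by
  have hnot : ∀ l, ¬ P.Bdd (negAt l a) → pathCoeff hP hU a b (negAt l a) ξ = 0 := by
    intro l hl
    rw [pathCoeff_eq_zero_left hP hU (pOne_eq_zero_right hP hl a), LinearMap.zero_apply]
  have hnot' : ∀ l, ¬ P.Bdd (negAt l a) →
      P.dual.pA (perp U) b (negAt l a) * P.dual.pA (perp U) (negAt l a) a = 0 := by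
    intro l hl
    rw [pA_eq_zero_right hP.dual fun h => hl (hP.dual_bdd_iff.1 h), zero_mul]
  have hF : P.IsFeasible (negAt i a) → P.IsFeasible (negAt j a) →
      pathCoeff hP hU a b (negAt i a) ξ = pathCoeff hP hU a b (negAt j a) ξ := by
    intro hi hj
    have hsq := pA_square (U := U) hP hij ha.1 hi hj (hba ▸ hb.1)
    rw [← hba] at hsq
    have := pathCoeff_relation hP hU hξ a b (s := Finset.univ) (m := ![1, -1])
      (c := ![negAt i a, negAt j a]) (by simp [Fin.sum_univ_two, hsq])
    simpa [Fin.sum_univ_two, sub_eq_zero, ← sub_eq_add_neg] using this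
  have hq : P.dual.IsFeasible (negAt i a) → P.dual.IsFeasible (negAt j a) →
      P.dual.pA (perp U) b (negAt i a) * P.dual.pA (perp U) (negAt i a) a =
        P.dual.pA (perp U) b (negAt j a) * P.dual.pA (perp U) (negAt j a) a := by
    intro hi hj
    have h1 : negAt i b = negAt j a := by rw [hba, negAt_negAt]
    have h2 : negAt j b = negAt i a := by rw [hba, negAt_comm i j, negAt_negAt]
    have h3 : negAt i (negAt j b) = a := by rw [h2, negAt_negAt]
    have := pA_square (U := perp U) hP.dual hij (Bdd.dual_feasible hP hb) (h1.symm ▸ hj)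
      (h2.symm ▸ hi) (h3.symm ▸ Bdd.dual_feasible hP ha)
    rw [h3, h1, h2] at this
    exact this.symm
  -- If only one middle vertex is bounded and feasible, the other is still feasible for one of the
  -- programs. In `P` the coefficients then agree and are zero; in the dual program the products of
  -- arrows agree and are zero.
  by_cases hi : P.Bdd (negAt i a) <;> by_cases hj : P.Bdd (negAt j a)
  · rw [hF hi.1 hj.1, hq (Bdd.dual_feasible hP hi) (Bdd.dual_feasible hP hj)]
  · rw [hnot j hj, zero_smul]
    rcases Bdd.negAt_feasible_or hP ha j with h | h
    · rw [hF hi.1 h, hnot j hj, zero_smul]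
    · rw [hq (Bdd.dual_feasible hP hi) h, hnot' j hj, smul_zero]
  · rw [hnot i hi, zero_smul]
    rcases Bdd.negAt_feasible_or hP ha i with h | h
    · rw [← hF h hj.1, hnot i hi, zero_smul]
    · rw [← hq h (Bdd.dual_feasible hP hj), hnot' i hi, smul_zero]
  · rw [hnot i hi, hnot j hj, zero_smul, zero_smul]

/-- The relation in the algebra of the dual program at the paths between distinct vertices. -/
theorem sum_pathCoeff_of_ne {ξ : TensorSquare k (DegZero (P.gradingA U)) (P.DegOneDual U)}
    (hξ : ξ ∈ dualRelations (P.gradingA U)) {a b : SignVec E} (hab : b ≠ a) :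
    ∑ c, (pathCoeff hP hU a b c ξ * (edgeSign k c b * edgeSign k a c)) •
      (P.dual.pA (perp U) b c * P.dual.pA (perp U) c a) = 0 := by
  by_cases ha : P.Bdd a
  swap
  · refine Finset.sum_eq_zero fun c _ => ?_
    rw [pA_eq_zero_right hP.dual fun h => ha (hP.dual_bdd_iff.1 h), mul_zero, smul_zero]
  by_cases hb : P.Bdd b
  swap
  · refine Finset.sum_eq_zero fun c _ => ?_
    rw [pA_eq_zero_left hP.dual fun h => hb (hP.dual_bdd_iff.1 h), zero_mul, smul_zero]
  have hne := Bdd.ne_zero hP ha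
  have hpath : ∀ c, P.pOne U a c ≠ 0 → P.pOne U c b ≠ 0 →
      ∃ i j, i ≠ j ∧ c = negAt j a ∧ b = negAt i (negAt j a) := by
    intro c h1 h2
    obtain ⟨j, rfl⟩ : ∃ j, c = negAt j a := by
      by_contra! h
      exact h1 (pOne_eq_zero hP h)
    obtain ⟨i, rfl⟩ : ∃ i, b = negAt i (negAt j a) := by
      by_contra! h
      exact h2 (pOne_eq_zero hP h)
    refine ⟨i, j, ?_, rfl, rfl⟩
    rintro rfl
    exact hab (negAt_negAt i a)
  have hzero : ∀ c, (P.pOne U a c = 0 ∨ P.pOne U c b = 0) → pathCoeff hP hU a b c ξ = 0 := by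
    rintro c (h | h)
    · rw [pathCoeff_eq_zero_left hP hU h, LinearMap.zero_apply]
    · rw [pathCoeff_eq_zero_right hP hU h, LinearMap.zero_apply]
  by_cases h : ∃ i j, i ≠ j ∧ b = negAt i (negAt j a)
  · obtain ⟨i, j, hij, hba⟩ := h
    have hcd : negAt i a ≠ negAt j a := fun h => hij (negAt_injective hne h)
    rw [Finset.sum_eq_add (negAt i a) (negAt j a) hcd]
    -- The weighted products along the two paths agree by `pathCoeff_square`, while the edge signs
    -- are opposite, so the two terms cancel.
    · have hsign := edgeSign_square (k := k) hne hij
      rw [← hba] at hsign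
      have hsq := congrArg ((edgeSign k (negAt i a) b * edgeSign k a (negAt i a)) • ·)
        (pathCoeff_square hP hU hξ hij hba ha hb)
      simp only [smul_smul, mul_comm _ (pathCoeff hP hU _ _ _ ξ)] at hsq
      rw [hsign, hsq, mul_neg, neg_smul, add_neg_cancel]
    · rintro c - ⟨hci, hcj⟩
      rw [hzero c, zero_mul, zero_smul]
      by_contra! h
      obtain ⟨i', j', hij', rfl, h'⟩ := hpath c h.1 h.2
      rcases negAt_eq_or_eq hne hij' (h'.symm.trans hba) with ⟨-, rfl⟩ | ⟨-, rfl⟩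
      · exact hcj rfl
      · exact hci rfl
    · simp
    · simp
  · refine Finset.sum_eq_zero fun c _ => ?_
    rw [hzero c, zero_mul, zero_smul]
    by_contra! h'
    obtain ⟨i, j, hij, -, hba⟩ := hpath c h'.1 h'.2
    exact h ⟨i, j, hij, hba⟩

theorem squareLift_eq_zero (ξ : TensorSquare k (DegZero (P.gradingA U)) (P.DegOneDual U))
    (hξ : ξ ∈ dualRelations (P.gradingA U)) :
    QuadraticQuotient.squareLift (degZeroToDual hP hU) (degOneDualToDual hP hU)
      (degOneDualToDual_smul hP hU) (degOneDualToDual_op_smul hP hU) ξ = 0 := by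
  rw [squareLift_eq]
  refine Finset.sum_eq_zero fun a _ => Finset.sum_eq_zero fun b _ => ?_
  by_cases hab : b = a
  · rw [hab]
    exact sum_pathCoeff_self hP hU hξ a
  · exact sum_pathCoeff_of_ne hP hU hξ hab

/-- The homomorphism from the quadratic dual to the algebra of the dual program. -/
def ofQuadraticDual : QuadraticDual (P.gradingA U) →ₐ[k] P.dual.A (perp U) :=
  QuadraticQuotient.lift (degZeroToDual hP hU) (degOneDualToDual hP hU)
    (degOneDualToDual_smul hP hU) (degOneDualToDual_op_smul hP hU) (squareLift_eq_zero hP hU)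

theorem ofQuadraticDual_ofR (r : DegZero (P.gradingA U)) :
    ofQuadraticDual hP hU (QuadraticQuotient.ofR _ r) = degZeroToDual hP hU r :=
  QuadraticQuotient.lift_ofR _ _ _ _ _ _ r

theorem ofQuadraticDual_ofV (Φ : P.DegOneDual U) :
    ofQuadraticDual hP hU (QuadraticQuotient.ofV _ Φ) = degOneDualToDual hP hU Φ :=
  QuadraticQuotient.lift_ofV _ _ _ _ _ _ Φ

theorem degZeroToDual_eZero (a : SignVec E) :
    degZeroToDual hP hU (P.eZero U a) = P.dual.eA (perp U) a := by
  rw [degZeroToDual_apply, Finset.sum_eq_single a]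
  · rw [vertexCoeff_eZero]
    by_cases ha : P.Bdd a
    · simp [ha]
    · rw [eA_eq_zero hP.dual fun h => ha (hP.dual_bdd_iff.1 h), smul_zero]
  · intro b _ hb
    simp [vertexCoeff_eZero, hb]
  · simp

theorem degOneDualToDual_pDual (b : SignVec E) (i : E) :
    degOneDualToDual hP hU (pDual hP hU (negAt i b) b) =
      edgeSign k (negAt i b) b • P.dual.pA (perp U) b (negAt i b) := by
  rw [degOneDualToDual_apply, Finset.sum_eq_single (negAt i b), Finset.sum_eq_single b]
  · rw [vertexCoeff_pDual_pOne]
    by_cases h : P.Bdd (negAt i b) ∧ P.Bdd b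
    · have : ∃ j, b = negAt j (negAt i b) := ⟨i, (negAt_negAt i b).symm⟩
      rw [if_pos ⟨⟨h, this⟩, rfl, rfl⟩, one_smul]
    · have : P.dual.pA (perp U) b (negAt i b) = 0 := by
        by_cases hb : P.Bdd b
        · exact pA_eq_zero_right hP.dual (fun h' => h ⟨hP.dual_bdd_iff.1 h', hb⟩) _
        · exact pA_eq_zero_left hP.dual (fun h' => hb (hP.dual_bdd_iff.1 h')) _
      rw [this, smul_zero, smul_zero]
  · intro c _ hc
    rw [vertexCoeff_pDual_pOne, if_neg fun h => hc h.2.2.symm, zero_smul]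
  · simp
  · intro c _ hc
    refine Finset.sum_eq_zero fun d _ => ?_
    rw [vertexCoeff_pDual_pOne, if_neg fun h => hc h.2.1.symm, zero_smul]
  · simp

theorem ofQuadraticDual_comp_toQuadraticDual :
    (ofQuadraticDual hP hU).comp (toQuadraticDual hP hU) = AlgHom.id k _ := by
  refine A_hom_ext hP.dual hU.dual (fun a => ?_) fun b i => ?_
  · rw [AlgHom.comp_apply, toQuadraticDual_eA, ofQuadraticDual_ofR, degZeroToDual_eZero]
    rfl
  · rw [AlgHom.comp_apply, toQuadraticDual_pA, pBang, map_smul, ofQuadraticDual_ofV,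
      degOneDualToDual_pDual, smul_smul, AlgHom.id_apply]
    by_cases hb : P.Bdd b
    · rw [edgeSign_mul_self (Bdd.ne_zero hP hb), one_smul]
    · rw [pA_eq_zero_left hP.dual fun h => hb (hP.dual_bdd_iff.1 h), smul_zero]

theorem toQuadraticDual_degOneDualToDual (Φ : P.DegOneDual U) :
    toQuadraticDual hP hU (degOneDualToDual hP hU Φ) = QuadraticQuotient.ofV _ Φ := by
  conv_rhs => rw [← sum_smul_pDual hP hU Φ]
  simp only [degOneDualToDual_apply, map_sum, map_smul]
  refine Finset.sum_congr rfl fun a _ => Finset.sum_congr rfl fun b _ => ?_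
  by_cases h : P.Bdd b ∧ ∃ i, b = negAt i a
  · obtain ⟨hb, i, hi⟩ := h
    have ha : a = negAt i b := by rw [hi, negAt_negAt]
    subst ha
    rw [toQuadraticDual_pA, pBang, smul_smul (edgeSign k _ _),
      edgeSign_mul_self (Bdd.ne_zero hP hb), one_smul]
  · have : P.pOne U a b = 0 := by
      by_cases hb : P.Bdd b
      · exact pOne_eq_zero hP fun i hi => h ⟨hb, i, hi⟩
      · exact pOne_eq_zero_right hP hb a
    rw [this, map_zero, map_zero, zero_smul, zero_smul]

theorem toQuadraticDual_comp_ofQuadraticDual :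
    (toQuadraticDual hP hU).comp (ofQuadraticDual hP hU) = AlgHom.id k _ := by
  apply QuadraticQuotient.hom_ext
  · intro r
    rw [AlgHom.comp_apply, ofQuadraticDual_ofR, AlgHom.id_apply]
    conv_rhs => rw [← sum_vertexCoeff_smul hP hU r]
    simp only [degZeroToDual_apply, map_sum, map_smul, toQuadraticDual_eA]
  · intro Φ
    rw [AlgHom.comp_apply, ofQuadraticDual_ofV, toQuadraticDual_degOneDualToDual, AlgHom.id_apply]

/-- The algebra of the dual program is the quadratic dual. -/
def dualEquivQuadraticDual : P.dual.A (perp U) ≃ₐ[k] QuadraticDual (P.gradingA U) :=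
  AlgEquiv.ofAlgHom (toQuadraticDual hP hU) (ofQuadraticDual hP hU)
    (toQuadraticDual_comp_ofQuadraticDual hP hU) (ofQuadraticDual_comp_toQuadraticDual hP hU)

/-! ### Compatibility of the isomorphism with the gradings. -/

theorem pBang_mem (b a : SignVec E) :
    pBang hP hU b a ∈ QuadraticDual.grading (P.gradingA U) 1 :=
  Submodule.smul_mem _ _ (QuadraticQuotient.ofV_mem _ _)

theorem toQuadraticDual_pA_mem (b a : SignVec E) :
    toQuadraticDual hP hU (P.dual.pA (perp U) b a) ∈ QuadraticDual.grading (P.gradingA U) 1 := by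
  by_cases h : ∃ i, a = negAt i b
  · obtain ⟨i, rfl⟩ := h
    rw [toQuadraticDual_pA]
    exact pBang_mem hP hU _ _
  · rw [pA_eq_zero hP.dual fun i hi => h ⟨i, hi⟩, map_zero]
    exact zero_mem _

theorem map_toQuadraticDual_le (j : ℕ) :
    (P.dual.gradingA (perp U) j).map (toQuadraticDual hP hU).toLinearMap ≤
      QuadraticDual.grading (P.gradingA U) j := by
  refine map_degreePiece_le (A := P.dual.A (perp U)) (B := QuadraticDual (P.gradingA U))
    (gen := P.dual.AGen (perp U)) (QuadraticDual.grading (P.gradingA U)) (toQuadraticDual hP hU)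
    (fun j x hx => ?_) j
  rcases hx with a | ⟨a, b, h⟩ | i
  · rw [mk_e₀, toQuadraticDual_eA]
    exact QuadraticQuotient.ofR_mem _ _
  · rw [mk_p₀]
    exact toQuadraticDual_pA_mem hP hU _ _
  -- The generator `u_i` of degree two has no direct counterpart in the quadratic dual; it is a
  -- combination of products of two arrows.
  · obtain ⟨m, hm⟩ := uA_eq hP.dual hU.dual i
    change toQuadraticDual hP hU (P.dual.uA (perp U) i) ∈ _
    simp only [hm, map_sum, map_smul, map_mul]
    exact Submodule.sum_mem _ fun a _ => Submodule.sum_mem _ fun j _ => Submodule.smul_mem _ _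
      (SetLike.GradedMul.mul_mem (i := 1) (j := 1) (toQuadraticDual_pA_mem hP hU _ _)
        (toQuadraticDual_pA_mem hP hU _ _))

theorem map_ofQuadraticDual_le (j : ℕ) :
    (QuadraticDual.grading (P.gradingA U) j).map (ofQuadraticDual hP hU).toLinearMap ≤
      P.dual.gradingA (perp U) j := by
  refine map_degreePiece_le (A := QuadraticDual (P.gradingA U)) (B := P.dual.A (perp U))
    (gen := QuadraticGen k _ _ (dualRelations (P.gradingA U))) (P.dual.gradingA (perp U)) (ofQuadraticDual hP hU)
    (fun j x hx => ?_) j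
  rcases hx with r | Φ
  · change ofQuadraticDual hP hU (QuadraticQuotient.ofR _ r) ∈ _
    rw [ofQuadraticDual_ofR, degZeroToDual_apply]
    exact Submodule.sum_mem _ fun a _ => Submodule.smul_mem _ _ (eA_mem _ _ _)
  · change ofQuadraticDual hP hU (QuadraticQuotient.ofV _ Φ) ∈ _
    rw [ofQuadraticDual_ofV, degOneDualToDual_apply]
    exact Submodule.sum_mem _ fun a _ => Submodule.sum_mem _ fun b _ => Submodule.smul_mem _ _
      (Submodule.smul_mem _ _ (pA_mem _ _ _ _))

theorem map_dualEquivQuadraticDual (j : ℕ) :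
    (P.dual.gradingA (perp U) j).map (dualEquivQuadraticDual hP hU).toLinearMap =
      QuadraticDual.grading (P.gradingA U) j := by
  refine le_antisymm (map_toQuadraticDual_le hP hU j) fun x hx => ?_
  exact ⟨ofQuadraticDual hP hU x, map_ofQuadraticDual_le hP hU j ⟨x, hx, rfl⟩,
    DFunLike.congr_fun (toQuadraticDual_comp_ofQuadraticDual hP hU) x⟩

end

end OMProgram

theorem theorem4p2 {E : Type*} [Fintype E] {k : Type*} [Field k] (P : OMProgram E)
    (hP : P.IsGeneric) (U : Submodule k (E → k)) (hU : P.IsParameterSpace U) :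
    IsQuadraticAlgebra (P.gradingA U) ∧
      ∃ φ : P.dual.A (perp U) ≃ₐ[k] QuadraticDual (P.gradingA U),
        ∀ j, (P.dual.gradingA (perp U) j).map φ.toLinearMap =
          QuadraticDual.grading (P.gradingA U) j :=
  ⟨OMProgram.isQuadraticAlgebra hP hU, OMProgram.dualEquivQuadraticDual hP hU,
    OMProgram.map_dualEquivQuadraticDual hP hU⟩
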